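/- **Setting.** Let $K$ be a commutative $\mathbb R$-algebra and let $w_{\lambda,u,h,k},\,s_{\lambda,\omega,h,k}\in K$ be arbitrary families (the *parameters*). In the formal case $K=\mathbb R[w,s]$ is the polynomial ring in the parameters; for $K=\mathbb R$ the parameters are numbers. A *δε-polynomial* is a polynomial in the variables $\delta_0,\delta_1,\dots,\epsilon_0,\epsilon_1,\dots$; the dot-product is the usual product. It acts on pairs of sequences by $\delta_i[y,u](t)=y(t-i)$, $\epsilon_j[y,u](t)=u(t-j)$. The star-product $P*[L,M]$ is the composition: every $\delta_i$ in $P$ is replaced by $L$ with all delays increased by $i$, every $\epsilon_j$ by $M$ with all delays increased by $j$. A *δε-operator* is a monomial $\delta_{\mathbf i}\epsilon_{\mathbf j}=\delta_{i_1}\cdots\delta_{i_n}\epsilon_{j_1}\cdots\epsilon_{j_m}$ with $i_1\le\dots\le i_n$, $j_1\le\dots\le j_m$; the empty index is written $e$, $\delta_e=\epsilon_e=1$. Indices are ordered first by dimension, and for equal dimension $\mathbf i<\mathbf i'$ if the right-most non-zero entry of $\mathbf i'-\mathbf i$ is positive; operators are ordered by $\mathbf i$ first, then by $\mathbf j$.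 A *zero* operator is one with $i_1=0$ (or $\mathbf i=e$) and $j_1=0$ (or $\mathbf j=e$). A polynomial $P$ without constant term is the sum of its pure δ-part $P_\delta$ (no $\epsilon$), its pure ε-part $P_\epsilon$ (no $\delta$) and its δε-part $P_{\delta\epsilon}$. **The FLF-Algorithm.** *Subroutine REMAINDER* (input $P$ and counters $u,\omega,h$). Split off the linear part of $P$ and let $R$ be the non-linear part, $\lambda=0$. While $R$ has a term whose operator is not a zero operator: put $\lambda:=\lambda+1$; let $c\,\delta_{i_1}\cdots\delta_{i_n}\epsilon_{j_1}\cdots\epsilon_{j_m}$ be the largest such term; form $L_{\lambda,u,h}=w_{\lambda,u,h,0}\delta_0+\dots+w_{\lambda,u,h,i_1-1}\delta_{i_1-1}+\delta_{i_1}$ (or $\delta_e$ if there is no $\delta$) and $M_{\lambda,\omega,h}=s_{\lambda,\omega,h,0}\epsilon_0+\dots+s_{\lambda,\omega,h,j_1-1}\epsilon_{j_1-1}+\epsilon_{j_1}$ (or $\epsilon_e$); put $c_{\lambda,u,\omega,h}=c$, $\delta_{\mathbf i_{\lambda,u,\omega,h}}\epsilon_{\mathbf j_{\lambda,u,\omega,h}}=\delta_0\delta_{i_2-i_1}\cdots\delta_{i_n-i_1}\,\epsilon_0\epsilon_{j_2-j_1}\cdots\epsilon_{j_m-j_1}$,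 and replace $R$ by $R-c_{\lambda,u,\omega,h}\delta_{\mathbf i_{\lambda,u,\omega,h}}\epsilon_{\mathbf j_{\lambda,u,\omega,h}}*[L_{\lambda,u,h},M_{\lambda,\omega,h}]$. The output is the last $R$; the number of passes is $v_{u,\omega,h}$. *Main loop*, for $h=0,1,\dots$, starting with $A$. (1) δ-part: for $u=1,2,\dots$ (at least once) apply REMAINDER with $\omega=0$ to the current $A_\delta$, call the linear part that is split off $L_{0,u,h}$, and write the output as $\delta_0^{\theta}\tilde R$ with $\tilde R$ without constant term and $\theta$ maximal; $\tilde R$ is the new $A_\delta$. Stop when $A_\delta$ is zero or contains no variable but $\delta_0$; call it $R_{\delta,h}$ and the number of passes $u_h^*\ge1$. (2) ε-part: in the same way with $u=0$, $\omega=1,2,\dots$, giving $M_{0,\omega,h}$, $R_{\epsilon,h}$, $\omega_h^*\ge1$. (3) If $A_{\delta\epsilon}$ is zero or contains no variables but $\delta_0,\epsilon_0$, put $R_{\delta\epsilon,h^*}=A_{\delta\epsilon}$, $h^*=h$, $v_{0,0,h}=0$, and stop. Otherwise apply REMAINDER with $u=\omega=0$ to $A_{\delta\epsilon}$, write the output as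 $\delta_0^{\kappa}\epsilon_0^{\sigma}\tilde R$ with $\tilde R$ without constant term and $\kappa,\sigma$ maximal, and continue with $A=\tilde R$ at level $h+1$. (Exponents factored out of the zero polynomial are $0$. If there are two maximal pairs $(\kappa,\sigma)$, a rule fixed in advance for each $h$ says whether $\kappa$ or $\sigma$ is maximised first.) Let $\mathcal L$ be the set of all $L_{\lambda,u,h}\neq\delta_e$ ($\lambda\ge1$) formed and all non-zero $L_{0,u,h}$, $\mathcal M$ the analogous set of ε-polynomials, $\mathcal C$ the set of all coefficients and $\mathcal O$ the set of all operators used, where a non-zero $L_{0,u,h}$ ($M_{0,\omega,h}$) contributes the coefficient $1$ and the operator $\delta_0$ ($\epsilon_0$). Let $\kappa_{0,h}$, $\sigma_{0,h}$ be the sums of the exponents $\kappa$, $\sigma$ factored out in (3) at the levels before $h$; for $u\ge1$ let $\kappa_{u,h}$ be the sum of the exponents $\theta$ factored out in (1) at level $h$ before pass $u$, and define $\sigma_{\omega,h}$, $\omega\ge1$, in the same way from (2). Put $\hat\kappa_{0,h}=\kappa_{0,h}$, $\hat\kappa_{u,h}=\kappa_{0,h}+\kappa_{u,h}$ for $u\ge1$,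 and define $\hat\sigma_{\omega,h}$ likewise. **Theorem 4.2.** Let $A$ be a real δε-polynomial without constant term. For every choice of the parameters the FLF-Algorithm applied to $A$ (over $K$) terminates, its output is unique, and $$A=\sum_{h=0}^{h^*}\sum_{\omega=0}^{\omega_h^*}\sum_{u=0}^{u_h^*}\sum_{\lambda=0}^{v_{u,\omega,h}}\delta_0^{\hat\kappa_{u,h}}\epsilon_0^{\hat\sigma_{\omega,h}}\cdot\bigl(c_{\lambda,u,\omega,h}\,\delta_{\mathbf i_{\lambda,u,\omega,h}}\epsilon_{\mathbf j_{\lambda,u,\omega,h}}*[L_{\lambda,u,h},M_{\lambda,\omega,h}]\bigr)+\mathbf R_\delta+\mathbf R_\epsilon+\mathbf R_{\delta\epsilon},\qquad(5)$$ where $$\mathbf R_\delta=\sum_{h=0}^{h^*}\delta_0^{\hat\kappa_{u_h^*+1,h}}\epsilon_0^{\sigma_{0,h}}R_{\delta,h},\quad \mathbf R_\epsilon=\sum_{h=0}^{h^*}\delta_0^{\kappa_{0,h}}\epsilon_0^{\hat\sigma_{\omega_h^*+1,h}}R_{\epsilon,h},\quad \mathbf R_{\delta\epsilon}=\delta_0^{\kappa_{0,h^*}}\epsilon_0^{\sigma_{0,h^*}}R_{\delta\epsilon,h^*},$$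 and $R_{\delta,h}$, $R_{\epsilon,h}$, $R_{\delta\epsilon,h^*}$ are polynomials in $\delta_0$, in $\epsilon_0$, and in $\delta_0,\epsilon_0$ respectively. (For $u,\omega\ge1$ we set $v_{u,\omega,h}=0$. A factor $L_{\lambda,0,h}$ or $M_{\lambda,0,h}$ standing in (5) after the operator part $\delta_e$ or $\epsilon_e$ does not matter.) In every non-zero summand $c_{\lambda,u,\omega,h}\in\mathcal C$, $\delta_{\mathbf i}\epsilon_{\mathbf j}\in\mathcal O$, $L_{\lambda,u,h}\in\mathcal L$ if $\mathbf i\ne e$, and $M_{\lambda,\omega,h}\in\mathcal M$ if $\mathbf j\neq e$. The $L_{0,u,h}$ and $M_{0,\omega,h}$ ($u,\omega\ge1$) are linear δ- and ε-polynomials; for $\lambda\ge1$ the linear factors are the formal linear polynomials described above. The border conditions hold, for $0\le h\le h^*$, $1\le u\le u_h^*$, $1\le\omega\le\omega_h^*$, $0\le\lambda\le v$: $$\kappa_{1,h}=\sigma_{1,h}=0,\quad \kappa_{0,0}=\sigma_{0,0}=0,\quad c_{0,0,\omega,h}=c_{0,u,0,h}=1,\quad c_{0,0,0,h}=0,\quad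 c_{\lambda,u,\omega,h}=0,$$ $$\delta_{\mathbf i_{0,u,0,h}}=\delta_0,\quad \delta_{\mathbf i_{\lambda,0,\omega,h}}=\delta_e,\quad \epsilon_{\mathbf j_{0,0,\omega,h}}=\epsilon_0,\quad \epsilon_{\mathbf j_{\lambda,u,0,h}}=\epsilon_e,$$ and $L_{0,1,0}$, $M_{0,1,0}$ are the linear δ-part and the linear ε-part of $A$. **Uniqueness.** Call an expression (5) of $A$ *admissible* for $w,s$ if in each block $(u,0,h)$, $(0,\omega,h)$, $(0,0,h)$ the polynomials $L_{0,u,h}$, $M_{0,\omega,h}$ are linear δ- and ε-polynomials, the terms with $\lambda\ge1$ are non-linear, belong to the δ-, ε-, δε-part respectively and come, by the construction of $L,M,\delta_{\mathbf i}\epsilon_{\mathbf j}$ in REMAINDER with the parameters $w,s$ (and arbitrary coefficients $c$), from operators that are not zero operators and strictly decrease in $\lambda$; everything that comes after a block in the part treated (including the power of $\delta_0,\epsilon_0$ factored out) consists of non-linear zero terms of that part; $R_{\delta,h}$, $R_{\epsilon,h}$ are polynomials in $\delta_0$, resp. $\epsilon_0$, without constant term and $R_{\delta\epsilon,h^*}$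 is a polynomial in $\delta_0,\epsilon_0$ all of whose terms contain both; there is at least one δ- and one ε-pass at each level, and the last level has no block $(0,0,h)$ terms and factors out nothing. Call it *reduced* if all $c_{\lambda,u,\omega,h}$ with $\lambda\ge1$ occurring in it are non-zero, the exponents factored out are maximal (in the sense of the algorithm), and it has a further pass or level only where the stopping condition of the algorithm fails. Then: 1. The expression produced by the algorithm is admissible and reduced, and it is the only admissible reduced expression of $A$ for the parameters $w,s$. It is also the only admissible expression of $A$ for $w,s$ with its numbers of levels, passes and terms, its operators and its exponents. 2. If the parameters are specialised to real numbers by an $\mathbb R$-algebra homomorphism $\varphi:K\to\mathbb R$, the specialised expression is an admissible expression of $A$ for $\varphi(w),\varphi(s)$, and it is the only one with the same numbers of levels, passes and terms, operators and exponents. -/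

import Mathlib

namespace FLF

open MvPolynomial

noncomputable section

universe u1 u2

/-! ### Operators and polynomials -/

/-- A δε-polynomial with coefficients in `K`: a polynomial in the shift operators
`δ_i` (variable `Sum.inl i`) and `ε_j` (variable `Sum.inr j`), `i, j = 0, 1, 2, …`.
The dot-product is the product of this polynomial ring, the null operators `δ_e`, `ε_e` are `1`. -/
abbrev DEPoly (K : Type u1) [CommRing K] := MvPolynomial (ℕ ⊕ ℕ) K

variable {K : Type u1} [CommRing K]

/-- The shift operator `δ_i`. -/
def del (i : ℕ) : DEPoly K := X (Sum.inl i)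

/-- The shift operator `ε_j`. -/
def eps (j : ℕ) : DEPoly K := X (Sum.inr j)

/-- Action of a δε-polynomial on a pair of sequences:
`δ_i` reads `y (t - i)` and `ε_j` reads `u (t - j)`. -/
def act (A : DEPoly K) (y u : ℤ → K) (t : ℤ) : K :=
  eval (Sum.elim (fun i : ℕ => y (t - i)) (fun j : ℕ => u (t - j))) A

/-- All delays are increased by `k`. -/
def shift (k : ℕ) : DEPoly K →ₐ[K] DEPoly K := rename (Sum.map (· + k) (· + k))

/-- The star-product `A * [B, C]`: substitution of `B` for the first sequence and of `C` for the
second one, so that `δ_i` becomes `B` delayed by `i` and `ε_j` becomes `C` delayed by `j`. -/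
def starProd (A B C : DEPoly K) : DEPoly K :=
  bind₁ (Sum.elim (fun i => shift i B) (fun j => shift j C)) A

theorem act_shift (k : ℕ) (B : DEPoly K) (y u : ℤ → K) (t : ℤ) :
    act (shift k B) y u t = act B y u (t - k) := by
  unfold act shift
  rw [eval_rename]
  congr 2
  funext v
  rcases v with i | j <;> simp <;> congr 1 <;> ring

/-- The star-product is the composition of the maps on pairs of sequences. -/
theorem act_star (A B C : DEPoly K) (y u : ℤ → K) :
    act (starProd A B C) y u = act A (act B y u) (act C y u) := by
  funext t
  have h : ∀ D : DEPoly K, ∀ f : ℕ ⊕ ℕ → K, ∀ g : ℕ ⊕ ℕ → DEPoly K,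
      eval f (bind₁ g D) = eval (fun v => eval f (g v)) D := by
    intro D f g
    rw [← coe_aeval_eq_eval, ← coe_aeval_eq_eval]
    exact aeval_bind₁ _ _ _
  have e : act (starProd A B C) y u t = eval (fun v => act
      (Sum.elim (fun i => shift i B) (fun j => shift j C) v) y u t) A := h _ _ _
  rw [e]
  unfold act
  congr 2
  funext v
  rcases v with i | j
  · exact act_shift i B y u t
  · exact act_shift j C y u t

/-- A δε-operator `δ_i ε_j`, given by its two multi-indices.  A multi-index is an ascending finite
vector of delays, i.e. a finite multiset; the empty one is the null index `e`. -/
abbrev Op := Multiset ℕ × Multiset ℕ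

/-- The monomial `δ_i ε_j` as an exponent vector. -/
def opExp (o : Op) : (ℕ ⊕ ℕ) →₀ ℕ :=
  Multiset.toFinsupp (o.1.map Sum.inl + o.2.map Sum.inr)

/-- The order of multi-indices: first the dimension; among ascending vectors of the same dimension
the right-most different entry decides (i.e. the vectors written in descending order are compared
lexicographically). -/
def idxKey (i : Multiset ℕ) : ℕ ×ₗ List ℕ := toLex (i.card, i.sort (· ≥ ·))

/-- The order of δε-operators: first the δ-index, then the ε-index. -/
def opKey (o : Op) : (ℕ ×ₗ List ℕ) ×ₗ (ℕ ×ₗ List ℕ) := toLex (idxKey o.1, idxKey o.2)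

/-- Zero operators: the lowest delay of the δ-part and the lowest delay of the ε-part are `0`
(a part that is absent, i.e. has index `e`, imposes nothing). -/
def IsZeroOp (o : Op) : Prop := (o.1 ≠ 0 → 0 ∈ o.1) ∧ (o.2 ≠ 0 → 0 ∈ o.2)

/-- All the terms of `P` are zero terms. -/
def AllZero (P : DEPoly K) : Prop := ∀ o : Op, coeff (opExp o) P ≠ 0 → IsZeroOp o

/-- `o` is the operator of the maximum non-zero term of `P`: the largest one among the terms of `P`
whose operator is not a zero operator. -/
def IsMaxNonzero (P : DEPoly K) (o : Op) : Prop :=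
  coeff (opExp o) P ≠ 0 ∧ ¬ IsZeroOp o ∧
    ∀ o' : Op, coeff (opExp o') P ≠ 0 → ¬ IsZeroOp o' → opKey o' ≤ opKey o

/-- The linear part. -/
def linPart (P : DEPoly K) : DEPoly K := homogeneousComponent 1 P

/-- The pure δ-part: the terms without ε. -/
def deltaPart (P : DEPoly K) : DEPoly K := bind₁ (Sum.elim del (fun _ => 0)) P

/-- The pure ε-part: the terms without δ. -/
def epsPart (P : DEPoly K) : DEPoly K := bind₁ (Sum.elim (fun _ => 0) eps) P

/-- The pure δε-part (for polynomials without constant term). -/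
def crossPart (P : DEPoly K) : DEPoly K := P - deltaPart P - epsPart P

/-- The minimum delay of a multi-index different from `e`. -/
def minDelay (i : Multiset ℕ) : ℕ := sInf {a | a ∈ i}

/-- `(i_1, i_2, …, i_n)` becomes `(0, i_2 - i_1, …, i_n - i_1)`. -/
def normIdx (i : Multiset ℕ) : Multiset ℕ := i.map (· - minDelay i)

/-- The formal linear polynomial `w_0 x_0 + w_1 x_1 + ⋯ + w_{p-1} x_{p-1} + x_p`,
for `x = δ` (`e = Sum.inl`) or `x = ε` (`e = Sum.inr`). -/
def formalLin (e : ℕ → ℕ ⊕ ℕ) (w : ℕ → K) (p : ℕ) : DEPoly K :=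
  (∑ k ∈ Finset.range p, C (w k) * X (e k)) + X (e p)

/-! ### The data recorded by the algorithm -/

/-- One pass of the inner loop of the subroutine: the maximum non-zero term
`c δ_I ε_J` and the polynomials `L`, `M` formed from it. -/
structure Term (K : Type u1) [CommRing K] where
  c : K
  I : Multiset ℕ
  J : Multiset ℕ
  L : DEPoly K
  M : DEPoly K

/-- The operator of the maximum non-zero term. -/
def Term.lead (t : Term K) : Op := (t.I, t.J)

/-- The operator `δ_0 δ_{i_2-i_1} ⋯ ε_0 ε_{j_2-j_1} ⋯` which is star-multiplied with `[L, M]`. -/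
def Term.op (t : Term K) : Op := (normIdx t.I, normIdx t.J)

/-- `c δ_i ε_j * [L, M]`. -/
def Term.value (t : Term K) : DEPoly K := starProd (monomial (opExp t.op) t.c) t.L t.M

/-- The term formed from `c δ_I ε_J`, with parameters `w_k`, `s_k`. -/
def mkTerm (w s : ℕ → K) (c : K) (o : Op) : Term K where
  c := c
  I := o.1
  J := o.2
  L := if o.1 = 0 then 1 else formalLin Sum.inl w (minDelay o.1)
  M := if o.2 = 0 then 1 else formalLin Sum.inr s (minDelay o.2)

/-- One pass of the loop that treats a pure part: the linear part, the terms found by the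
subroutine, and the exponent of `δ_0` (or `ε_0`) that is factored out of its remainder. -/
structure Pass (K : Type u1) [CommRing K] where
  lin : DEPoly K
  terms : List (Term K)
  exp : ℕ

/-- One iteration of the outer loop: the passes over the pure δ-part and their remainder, the
passes over the pure ε-part and their remainder, the terms of the δε-part, and the exponents of
`δ_0`, `ε_0` that are factored out of the remainder of the δε-part. -/
structure Level (K : Type u1) [CommRing K] where
  dPasses : List (Pass K)
  Rd : DEPoly K
  ePasses : List (Pass K)
  Re : DEPoly K
  cross : List (Term K)
  kap : ℕ
  sig : ℕ

/-- The complete output: the levels `h = 0, …, h*` and the δε-remainder. -/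
structure Output (K : Type u1) [CommRing K] where
  levels : List (Level K)
  Rde : DEPoly K

/-! ### The algorithm -/

/-- The repeat-loop of the subroutine REMAINDER.  `RemLoop w s l R ts R'`: started with counter
value `l` and current polynomial `R`, the loop produces the terms `ts` and stops with `R'`.
In the pass with counter value `l` the parameters are `w l k`, `s l k`. -/
inductive RemLoop (w s : ℕ → ℕ → K) : ℕ → DEPoly K → List (Term K) → DEPoly K → Prop
  | halt (l : ℕ) (R : DEPoly K) : AllZero R → RemLoop w s l R [] R
  | next (l : ℕ) (R : DEPoly K) (o : Op) (t : Term K) (ts : List (Term K)) (R' : DEPoly K) :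
      IsMaxNonzero R o →
      t = mkTerm (w (l + 1)) (s (l + 1)) (coeff (opExp o) R) o →
      RemLoop w s (l + 1) (R - t.value) ts R' →
      RemLoop w s l R (t :: ts) R'

/-- The subroutine REMAINDER: the linear part is split off and the loop is applied to the
non-linear part. -/
def Remainder (w s : ℕ → ℕ → K) (P : DEPoly K) (ts : List (Term K)) (R : DEPoly K) : Prop :=
  RemLoop w s 0 (P - linPart P) ts R

/-- `R = x^θ · R1` with `R1` without constant term and `θ` maximal
(`θ = 0` if `R = 0`, where there is no maximum). -/
def IsMaxFactor (x : ℕ ⊕ ℕ) (R : DEPoly K) (θ : ℕ) (R1 : DEPoly K) : Prop :=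
  R = X x ^ θ * R1 ∧ constantCoeff R1 = 0 ∧ (R = 0 → θ = 0) ∧
    (R ≠ 0 → ∀ (θ' : ℕ) (R1' : DEPoly K), R = X x ^ θ' * R1' → constantCoeff R1' = 0 → θ' ≤ θ)

/-- `R = δ_0^κ ε_0^σ · R1` with `R1` without constant term and `κ`, `σ` maximal
(`κ = σ = 0` if `R = 0`).  There can be two maximal pairs `(a, b - 1)` and `(a - 1, b)`; the first
one is taken if `tie` is `true`, the second one if it is `false`. -/
def IsMaxFactor₂ (tie : Bool) (R : DEPoly K) (κ σ : ℕ) (R1 : DEPoly K) : Prop :=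
  R = del 0 ^ κ * eps 0 ^ σ * R1 ∧ constantCoeff R1 = 0 ∧ (R = 0 → κ = 0 ∧ σ = 0) ∧
    (R ≠ 0 → ∀ (κ' σ' : ℕ) (R1' : DEPoly K),
      R = del 0 ^ κ' * eps 0 ^ σ' * R1' → constantCoeff R1' = 0 →
        if tie then κ' ≤ κ ∧ (κ' = κ → σ' ≤ σ) else σ' ≤ σ ∧ (σ' = σ → κ' ≤ κ))

/-- The repeat-until loop that treats the pure δ-part (`e = Sum.inl`, counter `u`) or the pure
ε-part (`e = Sum.inr`, counter `ω`).  `PartLoop e w s n P ps R`: started with counter value `n` and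
current polynomial `P`, the loop performs the passes `ps` (at least one) and stops as soon as the
current polynomial `R` is zero or contains no variable except `δ_0` (`ε_0`).
In the pass with counter value `n` the parameters are `w n l k`, `s n l k`. -/
inductive PartLoop (e : ℕ → ℕ ⊕ ℕ) (w s : ℕ → ℕ → ℕ → K) :
    ℕ → DEPoly K → List (Pass K) → DEPoly K → Prop
  | halt (n : ℕ) (P : DEPoly K) (ts : List (Term K)) (R : DEPoly K) (θ : ℕ) (P' : DEPoly K) :
      Remainder (w n) (s n) P ts R → IsMaxFactor (e 0) R θ P' → P'.vars ⊆ {e 0} →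
      PartLoop e w s n P [⟨linPart P, ts, θ⟩] P'
  | next (n : ℕ) (P : DEPoly K) (ts : List (Term K)) (R : DEPoly K) (θ : ℕ) (P' : DEPoly K)
      (ps : List (Pass K)) (R' : DEPoly K) :
      Remainder (w n) (s n) P ts R → IsMaxFactor (e 0) R θ P' → ¬ P'.vars ⊆ {e 0} →
      PartLoop e w s (n + 1) P' ps R' →
      PartLoop e w s n P (⟨linPart P, ts, θ⟩ :: ps) R'

/-- The treatment of the pure δ-part at level `h` (`ω = 0`, `u = 1, 2, …`);
the parameters are `w_{l,u,h,k}`. -/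
def DeltaLoop (w s : ℕ → ℕ → ℕ → ℕ → K) (h : ℕ) (P : DEPoly K) (ps : List (Pass K))
    (R : DEPoly K) : Prop :=
  PartLoop Sum.inl (fun u l => w l u h) (fun _ l => s l 0 h) 1 P ps R

/-- The treatment of the pure ε-part at level `h` (`u = 0`, `ω = 1, 2, …`);
the parameters are `s_{l,ω,h,k}`. -/
def EpsLoop (w s : ℕ → ℕ → ℕ → ℕ → K) (h : ℕ) (P : DEPoly K) (ps : List (Pass K))
    (R : DEPoly K) : Prop :=
  PartLoop Sum.inr (fun _ l => w l 0 h) (fun ω l => s l ω h) 1 P ps R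

/-- The outer loop.  `LevelLoop w s tie h A ls R`: started at level `h` with current polynomial `A`,
the algorithm terminates, having performed the levels `ls`, with δε-remainder `R`. -/
inductive LevelLoop (w s : ℕ → ℕ → ℕ → ℕ → K) (tie : ℕ → Bool) :
    ℕ → DEPoly K → List (Level K) → DEPoly K → Prop
  | halt (h : ℕ) (A : DEPoly K) (dp : List (Pass K)) (Rd : DEPoly K) (ep : List (Pass K))
      (Re : DEPoly K) :
      DeltaLoop w s h (deltaPart A) dp Rd → EpsLoop w s h (epsPart A) ep Re →
      (crossPart A).vars ⊆ {Sum.inl 0, Sum.inr 0} →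
      LevelLoop w s tie h A [⟨dp, Rd, ep, Re, [], 0, 0⟩] (crossPart A)
  | next (h : ℕ) (A : DEPoly K) (dp : List (Pass K)) (Rd : DEPoly K) (ep : List (Pass K))
      (Re : DEPoly K) (ts : List (Term K)) (R : DEPoly K) (κ σ : ℕ) (A' : DEPoly K)
      (ls : List (Level K)) (Rde : DEPoly K) :
      DeltaLoop w s h (deltaPart A) dp Rd → EpsLoop w s h (epsPart A) ep Re →
      ¬ (crossPart A).vars ⊆ {Sum.inl 0, Sum.inr 0} →
      Remainder (fun l => w l 0 h) (fun l => s l 0 h) (crossPart A) ts R →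
      IsMaxFactor₂ (tie h) R κ σ A' →
      LevelLoop w s tie (h + 1) A' ls Rde →
      LevelLoop w s tie h A (⟨dp, Rd, ep, Re, ts, κ, σ⟩ :: ls) Rde

/-- The Formal-Linear-Factors algorithm with parameters `w_{l,u,h,k}`, `s_{l,ω,h,k}`, applied to
`A`, terminates with the output `O`. -/
def Run (w s : ℕ → ℕ → ℕ → ℕ → K) (tie : ℕ → Bool) (A : DEPoly K) (O : Output K) : Prop :=
  LevelLoop w s tie 0 A O.levels O.Rde

/-! ### The output in index notation

`l` is the counter `λ` of the subroutine. -/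

namespace Output

variable (O : Output K)

/-- `h*` -/
def hStar : ℕ := O.levels.length - 1

/-- The record of level `h` (an empty one for `h > h*`). -/
def level (h : ℕ) : Level K := O.levels.getD h ⟨[], 0, [], 0, [], 0, 0⟩

/-- `u*_h` -/
def uStar (h : ℕ) : ℕ := (O.level h).dPasses.length

/-- `ω*_h` -/
def omStar (h : ℕ) : ℕ := (O.level h).ePasses.length

/-- The pass `u ≥ 1` over the pure δ-part of level `h`. -/
def dPass (u h : ℕ) : Pass K := (O.level h).dPasses.getD (u - 1) ⟨0, [], 0⟩

/-- The pass `ω ≥ 1` over the pure ε-part of level `h`. -/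
def ePass (om h : ℕ) : Pass K := (O.level h).ePasses.getD (om - 1) ⟨0, [], 0⟩

/-- The terms of the block `(u, ω, h)`: `u = ω = 0` is the δε-part, `u ≥ 1`, `ω = 0` is pass `u`
over the δ-part, `u = 0`, `ω ≥ 1` is pass `ω` over the ε-part; there are no other blocks. -/
def terms (u om h : ℕ) : List (Term K) :=
  if u = 0 then (if om = 0 then (O.level h).cross else (O.ePass om h).terms)
  else (if om = 0 then (O.dPass u h).terms else [])

/-- The number `v_{u,ω,h}` of terms of a block. -/
def v (u om h : ℕ) : ℕ := (O.terms u om h).length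

/-- Term number `l ≥ 1` of a block. -/
def term (l u om h : ℕ) : Term K := (O.terms u om h).getD (l - 1) ⟨0, 0, 0, 1, 1⟩

/-- `c_{l,u,ω,h}`; the number `l = 0` belongs to the linear part. -/
def c (l u om h : ℕ) : K :=
  if l = 0 then (if (u = 0 ∧ om ≠ 0) ∨ (u ≠ 0 ∧ om = 0) then 1 else 0) else (O.term l u om h).c

/-- The multi-index of `δ_{i_{l,u,ω,h}}`. -/
def iIdx (l u om h : ℕ) : Multiset ℕ :=
  if l = 0 then (if u ≠ 0 ∧ om = 0 then {0} else 0) else (O.term l u om h).op.1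

/-- The multi-index of `ε_{j_{l,u,ω,h}}`. -/
def jIdx (l u om h : ℕ) : Multiset ℕ :=
  if l = 0 then (if u = 0 ∧ om ≠ 0 then {0} else 0) else (O.term l u om h).op.2

/-- `L_{l,u,h}` -/
def L (l u h : ℕ) : DEPoly K :=
  if l = 0 then (if u = 0 then 1 else (O.dPass u h).lin) else (O.term l u 0 h).L

/-- `M_{l,ω,h}` -/
def M (l om h : ℕ) : DEPoly K :=
  if l = 0 then (if om = 0 then 1 else (O.ePass om h).lin) else (O.term l 0 om h).M

/-- `κ_{0,h}` is the exponent of `δ_0` factored out of the δε-parts of the levels before `h`;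
for `u ≥ 1`, `κ_{u,h}` is the exponent of `δ_0` factored out of the δ-part of level `h` before
pass `u`. -/
def kappa (u h : ℕ) : ℕ :=
  if u = 0 then ((O.levels.take h).map Level.kap).sum
  else (((O.level h).dPasses.take (u - 1)).map Pass.exp).sum

/-- `σ_{0,h}` and `σ_{ω,h}`, in the same way. -/
def sigma (om h : ℕ) : ℕ :=
  if om = 0 then ((O.levels.take h).map Level.sig).sum
  else (((O.level h).ePasses.take (om - 1)).map Pass.exp).sum

/-- The factor `δ_0^κ ε_0^σ` in front of the block `(u, ω, h)`: everything that has been factored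
out before this block was reached. -/
def prefactor (u om h : ℕ) : DEPoly K :=
  del 0 ^ (O.kappa 0 h + if u = 0 then 0 else O.kappa u h) *
    eps 0 ^ (O.sigma 0 h + if om = 0 then 0 else O.sigma om h)

/-- `δ_0^κ ε_0^σ · (c δ_i ε_j * [L, M])` with indices `(l, u, ω, h)`. -/
def summand (l u om h : ℕ) : DEPoly K :=
  O.prefactor u om h *
    starProd (monomial (opExp (O.iIdx l u om h, O.jIdx l u om h)) (O.c l u om h))
      (O.L l u h) (O.M l om h)

/-- The δ-remainders `R_{δ,h}`, with the factors that have been factored out before. -/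
def remD : DEPoly K :=
  ∑ h ∈ Finset.range (O.hStar + 1), O.prefactor (O.uStar h + 1) 0 h * (O.level h).Rd

/-- The ε-remainders `R_{ε,h}`, with the factors that have been factored out before. -/
def remE : DEPoly K :=
  ∑ h ∈ Finset.range (O.hStar + 1), O.prefactor 0 (O.omStar h + 1) h * (O.level h).Re

/-- The δε-remainder `R_{δε,h*}`, with the factors that have been factored out before. -/
def remDE : DEPoly K := O.prefactor 0 0 O.hStar * O.Rde

/-- The expression
`∑_h ∑_ω ∑_u ∑_l δ_0^κ ε_0^σ · (c δ_i ε_j * [L, M]) + R_δ + R_ε + R_δε`. -/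
def expr : DEPoly K :=
  (∑ h ∈ Finset.range (O.hStar + 1), ∑ om ∈ Finset.range (O.omStar h + 1),
    ∑ u ∈ Finset.range (O.uStar h + 1), ∑ l ∈ Finset.range (O.v u om h + 1),
      O.summand l u om h)
  + O.remD + O.remE + O.remDE

/-- All the terms produced by the calls of the subroutine. -/
def allTerms : List (Term K) :=
  O.levels.flatMap fun a =>
    a.dPasses.flatMap Pass.terms ++ a.ePasses.flatMap Pass.terms ++ a.cross

/-- All the non-zero linear parts split off from δ-parts. -/
def dLins : Set (DEPoly K) := {P | P ≠ 0 ∧ ∃ a ∈ O.levels, ∃ p ∈ a.dPasses, p.lin = P}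

/-- All the non-zero linear parts split off from ε-parts. -/
def eLins : Set (DEPoly K) := {P | P ≠ 0 ∧ ∃ a ∈ O.levels, ∃ p ∈ a.ePasses, p.lin = P}

/-- The set of the δ-linear factors. -/
def setL : Set (DEPoly K) := O.dLins ∪ {P | ∃ t ∈ O.allTerms, t.I ≠ 0 ∧ t.L = P}

/-- The set of the ε-linear factors. -/
def setM : Set (DEPoly K) := O.eLins ∪ {P | ∃ t ∈ O.allTerms, t.J ≠ 0 ∧ t.M = P}

/-- The set of the companion coefficients. -/
def setC : Set K :=
  {a | a = 1 ∧ (O.dLins ∪ O.eLins).Nonempty} ∪ {a | ∃ t ∈ O.allTerms, t.c = a}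

/-- The set of the operators. -/
def setO : Set Op :=
  {o | o = ({0}, 0) ∧ O.dLins.Nonempty} ∪ {o | o = (0, {0}) ∧ O.eLins.Nonempty} ∪
    {o | ∃ t ∈ O.allTerms, t.op = o}

end Output

/-! ### Expressions of the same kind, independently of the algorithm -/

/-- A linear δ-polynomial (`e = Sum.inl`) or ε-polynomial (`e = Sum.inr`). -/
def IsLinear (e : ℕ → ℕ ⊕ ℕ) (P : DEPoly K) : Prop :=
  P.IsHomogeneous 1 ∧ ∀ x ∈ P.vars, x ∈ Set.range e

/-- The value of a list of terms. -/
def termsVal (ts : List (Term K)) : DEPoly K := (ts.map Term.value).sum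

/-- `lin_1 + terms_1 + x^{θ_1} (lin_2 + terms_2 + x^{θ_2} (⋯ + x^{θ_n} R))`. -/
def passesVal (x : ℕ ⊕ ℕ) : List (Pass K) → DEPoly K → DEPoly K
  | [], R => R
  | p :: ps, R => p.lin + termsVal p.terms + X x ^ p.exp * passesVal x ps R

/-- The nested value of a list of levels. -/
def levelsVal : List (Level K) → DEPoly K → DEPoly K
  | [], R => R
  | a :: ls, R => passesVal (Sum.inl 0) a.dPasses a.Rd + passesVal (Sum.inr 0) a.ePasses a.Re +
      termsVal a.cross + del 0 ^ a.kap * eps 0 ^ a.sig * levelsVal ls R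

/-- A list of terms whose polynomials `L`, `M` are the formal linear polynomials belonging to the
operators `δ_I ε_J` and to the parameters `w_{l,k}`, `s_{l,k}` (`l` is the position in the list);
these operators are not zero operators and strictly decrease along the list. -/
def GoodTerms (w s : ℕ → ℕ → K) (ts : List (Term K)) : Prop :=
  (∀ (l : ℕ) (hl : l < ts.length),
    ts[l] = mkTerm (w (l + 1)) (s (l + 1)) ts[l].c ts[l].lead ∧ ¬ IsZeroOp ts[l].lead) ∧
  ts.Pairwise fun a b => opKey b.lead < opKey a.lead

/-- Passes over a pure part: linear polynomials, non-linear terms, what is left after each pass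
consists of non-linear zero terms, and the final remainder is a polynomial in `δ_0` (`ε_0`) without
constant term. -/
def GoodPasses (e : ℕ → ℕ ⊕ ℕ) (w s : ℕ → ℕ → ℕ → K) : ℕ → List (Pass K) → DEPoly K → Prop
  | _, [], R => R.vars ⊆ {e 0} ∧ constantCoeff R = 0
  | n, p :: ps, R =>
      IsLinear e p.lin ∧ GoodTerms (w n) (s n) p.terms ∧
      (∀ t ∈ p.terms, 2 ≤ t.I.card + t.J.card ∧ ∀ x ∈ (opExp t.lead).support, x ∈ Set.range e) ∧
      AllZero (X (e 0) ^ p.exp * passesVal (e 0) ps R) ∧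
      linPart (X (e 0) ^ p.exp * passesVal (e 0) ps R) = 0 ∧
      GoodPasses e w s (n + 1) ps R

/-- The conditions on the passes over the two pure parts of level `h`. -/
def GoodParts (w s : ℕ → ℕ → ℕ → ℕ → K) (h : ℕ) (a : Level K) : Prop :=
  a.dPasses ≠ [] ∧ a.ePasses ≠ [] ∧
  GoodPasses Sum.inl (fun u l => w l u h) (fun _ l => s l 0 h) 1 a.dPasses a.Rd ∧
  GoodPasses Sum.inr (fun _ l => w l 0 h) (fun om l => s l om h) 1 a.ePasses a.Re

/-- All the terms of `P` contain both a δ and an ε. -/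
def IsCross (P : DEPoly K) : Prop := deltaPart P = 0 ∧ epsPart P = 0

/-- The conditions on the levels: only cross-terms are treated in the δε-part, and what is left
consists of zero terms; the final δε-remainder is a polynomial in `δ_0`, `ε_0`. -/
def GoodLevels (w s : ℕ → ℕ → ℕ → ℕ → K) : ℕ → List (Level K) → DEPoly K → Prop
  | _, [], _ => False
  | h, [a], R => GoodParts w s h a ∧ a.cross = [] ∧ a.kap = 0 ∧ a.sig = 0 ∧
      IsCross R ∧ R.vars ⊆ {Sum.inl 0, Sum.inr 0}
  | h, a :: b :: ls, R => GoodParts w s h a ∧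
      GoodTerms (fun l => w l 0 h) (fun l => s l 0 h) a.cross ∧
      (∀ t ∈ a.cross, t.I ≠ 0 ∧ t.J ≠ 0) ∧
      IsCross (del 0 ^ a.kap * eps 0 ^ a.sig * levelsVal (b :: ls) R) ∧
      AllZero (del 0 ^ a.kap * eps 0 ^ a.sig * levelsVal (b :: ls) R) ∧
      GoodLevels w s (h + 1) (b :: ls) R

/-- `E` is a formal-linear-factor expression of `A`, with parameters `w`, `s`. -/
def IsExpansion (w s : ℕ → ℕ → ℕ → ℕ → K) (A : DEPoly K) (E : Output K) : Prop :=
  A = E.expr ∧ GoodLevels w s 0 E.levels E.Rde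

/-- No superfluous terms, maximal exponents, no superfluous passes (pure parts). -/
def ReducedPasses (x : ℕ ⊕ ℕ) : List (Pass K) → DEPoly K → Prop
  | [], _ => True
  | p :: ps, R =>
      (∀ t ∈ p.terms, t.c ≠ 0) ∧
      IsMaxFactor x (X x ^ p.exp * passesVal x ps R) p.exp (passesVal x ps R) ∧
      (ps ≠ [] → ¬ (passesVal x ps R).vars ⊆ {x}) ∧
      ReducedPasses x ps R

/-- No superfluous terms, maximal exponents, no superfluous passes and levels. -/
def ReducedLevels (tie : ℕ → Bool) : ℕ → List (Level K) → DEPoly K → Prop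
  | _, [], _ => True
  | h, a :: ls, R =>
      ReducedPasses (Sum.inl 0) a.dPasses a.Rd ∧ ReducedPasses (Sum.inr 0) a.ePasses a.Re ∧
      (∀ t ∈ a.cross, t.c ≠ 0) ∧
      (ls ≠ [] →
        IsMaxFactor₂ (tie h) (del 0 ^ a.kap * eps 0 ^ a.sig * levelsVal ls R) a.kap a.sig
          (levelsVal ls R) ∧
        ¬ (termsVal a.cross + del 0 ^ a.kap * eps 0 ^ a.sig * levelsVal ls R).vars
          ⊆ {Sum.inl 0, Sum.inr 0}) ∧
      ReducedLevels tie (h + 1) ls R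

/-- The expression contains no superfluous terms, passes or levels, and powers of `δ_0`, `ε_0` of
maximal exponent are factored out. -/
def IsReduced (tie : ℕ → Bool) (E : Output K) : Prop := ReducedLevels tie 0 E.levels E.Rde

/-- The shape of a list of passes: operators and exponents. -/
def passesShape (ps : List (Pass K)) : List (List Op × ℕ) :=
  ps.map fun p => (p.terms.map Term.lead, p.exp)

/-- The shape of an expression: the operators and the exponents of all the levels, without the
coefficients and the remainders. -/
def Output.shape (O : Output K) :
    List (List (List Op × ℕ) × List (List Op × ℕ) × List Op × ℕ × ℕ) :=
  O.levels.map fun a =>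
    (passesShape a.dPasses, passesShape a.ePasses, a.cross.map Term.lead, a.kap, a.sig)

/-! ### Evaluation of the parameters -/

section Eval

variable {K' : Type u2} [CommRing K']

def Term.mapCoeff (f : K →+* K') (t : Term K) : Term K' :=
  ⟨f t.c, t.I, t.J, map f t.L, map f t.M⟩

def Pass.mapCoeff (f : K →+* K') (p : Pass K) : Pass K' :=
  ⟨map f p.lin, p.terms.map (Term.mapCoeff f), p.exp⟩

def Level.mapCoeff (f : K →+* K') (a : Level K) : Level K' :=
  ⟨a.dPasses.map (Pass.mapCoeff f), map f a.Rd, a.ePasses.map (Pass.mapCoeff f), map f a.Re,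
    a.cross.map (Term.mapCoeff f), a.kap, a.sig⟩

/-- The ring homomorphism `f` is applied to all the coefficients of an expression. -/
def Output.mapCoeff (f : K →+* K') (O : Output K) : Output K' :=
  ⟨O.levels.map (Level.mapCoeff f), map f O.Rde⟩

end Eval

end

end FLF

/-!
The proof works with coefficients. Operators `δ_i ε_j` correspond bijectively to exponent vectors,
so a polynomial is known from its coefficients at the operators `opExp o`, and all the conditions on
polynomials that occur (pure, cross, non-linear, zero terms, bounded degree) say that the operators
of the polynomial lie in a certain set (`SuppIn`).

**The leading operator.** If `L` and `M` are the monic formal linear polynomials belonging to the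
operator `o = δ_I ε_J`, then the star-product formed in the subroutine has coefficient `1` at `o`,
and its other operators arise from `o` by lowering delays (`Lead`, `Below`;
`Term.IsFormed.value_eq`). Lowering delays makes an operator smaller (`Below.opKey_lt`), and it
changes neither the number of `δ`s nor that of `ε`s. So the subtraction removes the maximum non-zero
term and creates only smaller terms of the same kind (`IsMaxNonzero.opKey_lt_of_sub`).

**Termination.** The operators of the inner loop stay in a finite set and the maximum decreases
(`RemLoop.exists`). All the terms of a remainder are zero terms and non-linear; hence, unless the
remainder is zero, a positive power of `δ_0` or `ε_0` is factored out and the degree drops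
(`PartLoop.exists`, `LevelLoop.exists`). Each step is determined by its input, which gives the
uniqueness of the output.

**The expression.** The loops write their input as nested sums `passesVal`, `levelsVal`; these are
unfolded into the quadruple sum in `Output.expr_eq`.

**Uniqueness.** The summands of an admissible expression can be recovered from its value: the pure
parts and the δε-part are read off by their variables, the linear part by the degree, and since
everything after the first term of a block is smaller or a zero term, the coefficient of this term
is the coefficient of the polynomial at its operator (`GoodTerms.coeff_head`); powers of `δ_0`, `ε_0`
can be cancelled over every ring. So shape and value determine an admissible expression
(`GoodLevels.eq_of_value_eq`), and an admissible reduced expression is a run of the algorithm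
(`LevelLoop.of_goodLevels`). Admissibility is preserved by ring homomorphisms (`GoodLevels.map`),
which yields the assertion on specialised parameters.
-/

namespace FLF

open MvPolynomial

noncomputable section

universe u1 u2

variable {K : Type u1} [CommRing K]

/-! ### Operators as exponent vectors -/

theorem opExp_inl (o : Op) (a : ℕ) : opExp o (Sum.inl a) = o.1.count a := by
  have h : Multiset.count (Sum.inl a) (o.2.map (Sum.inr : ℕ → ℕ ⊕ ℕ)) = 0 := by
    simp
  rw [opExp, Multiset.toFinsupp_apply, Multiset.count_add, h,
    Multiset.count_map_eq_count' _ _ Sum.inl_injective, add_zero]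

theorem opExp_inr (o : Op) (a : ℕ) : opExp o (Sum.inr a) = o.2.count a := by
  have h : Multiset.count (Sum.inr a) (o.1.map (Sum.inl : ℕ → ℕ ⊕ ℕ)) = 0 := by
    simp
  rw [opExp, Multiset.toFinsupp_apply, Multiset.count_add, h,
    Multiset.count_map_eq_count' _ _ Sum.inr_injective, zero_add]

theorem opExp_injective : Function.Injective opExp := by
  intro o o' h
  refine Prod.ext (Multiset.ext.2 fun a => ?_) (Multiset.ext.2 fun a => ?_)
  · rw [← opExp_inl, ← opExp_inl, h]
  · rw [← opExp_inr, ← opExp_inr, h]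

theorem opExp_surjective : Function.Surjective opExp := by
  intro m
  refine ⟨((m.comapDomain Sum.inl Sum.inl_injective.injOn).toMultiset,
    (m.comapDomain Sum.inr Sum.inr_injective.injOn).toMultiset), ?_⟩
  ext (a | a)
  · rw [opExp_inl, Finsupp.count_toMultiset, Finsupp.comapDomain_apply]
  · rw [opExp_inr, Finsupp.count_toMultiset, Finsupp.comapDomain_apply]

theorem opExp_add (o o' : Op) : opExp (o + o') = opExp o + opExp o' := by
  ext (a | a) <;> simp [opExp_inl, opExp_inr]

theorem opExp_zero : opExp 0 = 0 := by
  ext (a | a) <;> simp [opExp_inl, opExp_inr]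

theorem degree_opExp (o : Op) : (opExp o).degree = o.1.card + o.2.card := by
  have h := Multiset.toFinsupp_sum_eq (o.1.map Sum.inl + o.2.map (Sum.inr : ℕ → ℕ ⊕ ℕ))
  rw [Multiset.card_add, Multiset.card_map, Multiset.card_map] at h
  exact h

theorem inl_mem_support_opExp {o : Op} {a : ℕ} : Sum.inl a ∈ (opExp o).support ↔ a ∈ o.1 := by
  rw [Finsupp.mem_support_iff, opExp_inl, Multiset.count_ne_zero]

theorem inr_mem_support_opExp {o : Op} {a : ℕ} : Sum.inr a ∈ (opExp o).support ↔ a ∈ o.2 := by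
  rw [Finsupp.mem_support_iff, opExp_inr, Multiset.count_ne_zero]

/-- The operator consisting of a single variable. -/
def varOp : ℕ ⊕ ℕ → Op := Sum.elim (fun a => ({a}, 0)) (fun a => (0, {a}))

theorem opExp_varOp (x : ℕ ⊕ ℕ) : opExp (varOp x) = Finsupp.single x 1 := by
  rcases x with a | a <;> ext (b | b) <;>
    simp [opExp_inl, opExp_inr, varOp, Finsupp.single_apply, Multiset.count_singleton, eq_comm]

theorem X_eq_monomial_varOp (x : ℕ ⊕ ℕ) : (X x : DEPoly K) = monomial (opExp (varOp x)) 1 := by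
  rw [opExp_varOp]; rfl

theorem X_pow_eq_monomial_varOp (x : ℕ ⊕ ℕ) (n : ℕ) :
    (X x ^ n : DEPoly K) = monomial (opExp (n • varOp x)) 1 := by
  induction n with
  | zero => rw [pow_zero, zero_smul, opExp_zero]; rfl
  | succ n ih => rw [pow_succ, ih, X_eq_monomial_varOp, monomial_mul, one_mul, succ_nsmul, opExp_add]

theorem monomial_opExp (o : Op) (c : K) :
    (monomial (opExp o) c : DEPoly K) = C c * ((o.1.map del).prod * (o.2.map eps).prod) := by
  have h1 : ∀ s : Multiset ℕ, (s.map del).prod = (monomial (opExp (s, 0)) 1 : DEPoly K) := by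
    intro s
    induction s using Multiset.induction with
    | empty => exact (congrArg (monomial · (1 : K)) opExp_zero).symm
    | cons a s ih =>
      have e : ((a ::ₘ s, 0) : Op) = varOp (Sum.inl a) + (s, 0) := by
        simp [varOp]
      rw [Multiset.map_cons, Multiset.prod_cons, ih, e, opExp_add, del, X_eq_monomial_varOp,
        monomial_mul, one_mul]
  have h2 : ∀ s : Multiset ℕ, (s.map eps).prod = (monomial (opExp (0, s)) 1 : DEPoly K) := by
    intro s
    induction s using Multiset.induction with
    | empty => exact (congrArg (monomial · (1 : K)) opExp_zero).symm
    | cons a s ih =>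
      have e : ((0, a ::ₘ s) : Op) = varOp (Sum.inr a) + (0, s) := by
        simp [varOp]
      rw [Multiset.map_cons, Multiset.prod_cons, ih, e, opExp_add, eps, X_eq_monomial_varOp,
        monomial_mul, one_mul]
  rw [h1, h2, monomial_mul, ← opExp_add, C_mul_monomial]
  simp

theorem algHom_monomial_opExp {R : Type*} [CommRing R] [Algebra K R] (f : DEPoly K →ₐ[K] R)
    (o : Op) (c : K) : f (monomial (opExp o) c) = algebraMap K R c *
      ((o.1.map fun a => f (del a)).prod * (o.2.map fun a => f (eps a)).prod) := by
  rw [monomial_opExp, map_mul, map_mul, map_multiset_prod, map_multiset_prod, Multiset.map_map,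
    Multiset.map_map, ← algebraMap_eq, AlgHom.commutes]
  rfl

theorem ext_op {P Q : DEPoly K} (h : ∀ o : Op, coeff (opExp o) P = coeff (opExp o) Q) : P = Q := by
  ext m
  obtain ⟨o, rfl⟩ := opExp_surjective m
  exact h o

/-! ### Polynomials whose operators lie in a given set -/

/-- All operators that occur in `P` belong to `T`. -/
def SuppIn (T : Set Op) (P : DEPoly K) : Prop := ∀ o : Op, coeff (opExp o) P ≠ 0 → o ∈ T

theorem SuppIn.mono {T T' : Set Op} {P : DEPoly K} (h : SuppIn T P) (hT : T ⊆ T') : SuppIn T' P :=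
  fun o ho => hT (h o ho)

theorem SuppIn.coeff_eq_zero {T : Set Op} {P : DEPoly K} (h : SuppIn T P) {o : Op} (ho : o ∉ T) :
    coeff (opExp o) P = 0 := by
  by_contra hc
  exact ho (h o hc)

theorem SuppIn.zero (T : Set Op) : SuppIn T (0 : DEPoly K) := fun _ ho => absurd (coeff_zero _) ho

theorem SuppIn.add {T : Set Op} {P Q : DEPoly K} (hP : SuppIn T P) (hQ : SuppIn T Q) :
    SuppIn T (P + Q) := by
  intro o ho
  by_contra hT
  rw [coeff_add, hP.coeff_eq_zero hT, hQ.coeff_eq_zero hT, add_zero] at ho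
  exact ho rfl

theorem SuppIn.sub {T : Set Op} {P Q : DEPoly K} (hP : SuppIn T P) (hQ : SuppIn T Q) :
    SuppIn T (P - Q) := by
  intro o ho
  by_contra hT
  rw [coeff_sub, hP.coeff_eq_zero hT, hQ.coeff_eq_zero hT, sub_zero] at ho
  exact ho rfl

theorem SuppIn.C_mul {T : Set Op} {P : DEPoly K} (hP : SuppIn T P) (c : K) :
    SuppIn T (C c * P) := by
  intro o ho
  by_contra hT
  rw [coeff_C_mul, hP.coeff_eq_zero hT, mul_zero] at ho
  exact ho rfl

theorem SuppIn.monomial {T : Set Op} {o : Op} (ho : o ∈ T) (c : K) :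
    SuppIn T (monomial (opExp o) c) := by
  intro o' ho'
  rw [coeff_monomial] at ho'
  by_cases h : opExp o = opExp o'
  · rwa [← opExp_injective h]
  · rw [if_neg h] at ho'
    exact absurd rfl ho'

theorem SuppIn.mul {T T' T'' : Set Op} {P Q : DEPoly K} (hP : SuppIn T P) (hQ : SuppIn T' Q)
    (hT : ∀ o ∈ T, ∀ o' ∈ T', o + o' ∈ T'') : SuppIn T'' (P * Q) := by
  classical
  intro o ho
  have h := support_mul P Q (mem_support_iff.2 ho)
  obtain ⟨m, hm, m', hm', hmm⟩ := Finset.mem_add.1 h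
  obtain ⟨a, rfl⟩ := opExp_surjective m
  obtain ⟨b, rfl⟩ := opExp_surjective m'
  rw [← opExp_add] at hmm
  rw [← opExp_injective hmm]
  exact hT a (hP a (mem_support_iff.1 hm)) b (hQ b (mem_support_iff.1 hm'))

theorem SuppIn.map {K' : Type u2} [CommRing K'] (f : K →+* K') {T : Set Op} {P : DEPoly K}
    (hP : SuppIn T P) : SuppIn T (map f P) := by
  intro o ho
  rw [coeff_map] at ho
  exact hP o fun h => ho (by rw [h, map_zero])

theorem coeff_X_pow_mul_varOp (x : ℕ ⊕ ℕ) (n : ℕ) (P : DEPoly K) (o : Op) :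
    coeff (opExp (n • varOp x + o)) (X x ^ n * P) = coeff (opExp o) P := by
  rw [X_pow_eq_monomial_varOp, opExp_add, coeff_monomial_mul, one_mul]

theorem X_pow_mul_cancel (x : ℕ ⊕ ℕ) (n : ℕ) {P Q : DEPoly K} (h : X x ^ n * P = X x ^ n * Q) :
    P = Q := by
  refine ext_op fun o => ?_
  rw [← coeff_X_pow_mul_varOp x n P, h, coeff_X_pow_mul_varOp]

theorem SuppIn.of_X_pow_mul {T : Set Op} {x : ℕ ⊕ ℕ} {n : ℕ} {P : DEPoly K}
    (h : SuppIn T (X x ^ n * P)) : SuppIn {o | n • varOp x + o ∈ T} P := by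
  intro o ho
  rw [← coeff_X_pow_mul_varOp x n] at ho
  exact h _ ho

theorem SuppIn.X_pow_mul {T T' : Set Op} {x : ℕ ⊕ ℕ} {n : ℕ} {P : DEPoly K}
    (h : SuppIn T P) (hT : ∀ o ∈ T, n • varOp x + o ∈ T') : SuppIn T' (X x ^ n * P) := by
  refine SuppIn.mul (T := {n • varOp x}) (T' := T) ?_ h ?_
  · rw [X_pow_eq_monomial_varOp]
    exact SuppIn.monomial (Set.mem_singleton _) 1
  · rintro _ rfl o ho
    exact hT o ho

/-- A polynomial whose operators all contain the variable `x` is divisible by `x`. -/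
theorem exists_eq_X_mul {x : ℕ ⊕ ℕ} {P : DEPoly K}
    (h : SuppIn {o | x ∈ (opExp o).support} P) : ∃ Q, P = X x * Q := by
  refine ⟨divMonomial P (Finsupp.single x 1), ?_⟩
  have e := divMonomial_add_modMonomial_single P x
  have z : modMonomial P (Finsupp.single x 1) = 0 := by
    ext m
    rw [coeff_zero]
    by_cases hm : Finsupp.single x 1 ≤ m
    · exact coeff_modMonomial_of_le _ hm
    · rw [coeff_modMonomial_of_not_le _ hm]
      obtain ⟨o, rfl⟩ := opExp_surjective m
      refine h.coeff_eq_zero fun ho => hm ?_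
      rw [Finsupp.single_le_iff]
      exact Nat.one_le_iff_ne_zero.2 (Finsupp.mem_support_iff.1 ho)
  rw [z, add_zero] at e
  exact e.symm

theorem coeff_opExp_zero (P : DEPoly K) : coeff (opExp 0) P = constantCoeff P := by
  rw [opExp_zero]; rfl

/-- The number of variables of an operator, counted with multiplicity. -/
def opDeg (o : Op) : ℕ := o.1.card + o.2.card

theorem opDeg_add (o o' : Op) : opDeg (o + o') = opDeg o + opDeg o' := by
  simp only [opDeg, Prod.fst_add, Prod.snd_add, Multiset.card_add]
  omega

theorem opDeg_nsmul_varOp (n : ℕ) (x : ℕ ⊕ ℕ) : opDeg (n • varOp x) = n := by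
  rcases x with a | a <;> simp [opDeg, varOp]

theorem opDeg_eq_zero {o : Op} (h : opDeg o = 0) : o = 0 := by
  have h' : o.1.card + o.2.card = 0 := h
  exact Prod.ext (Multiset.card_eq_zero.1 (by omega)) (Multiset.card_eq_zero.1 (by omega))

theorem exists_suppIn_opDeg_le (P : DEPoly K) : ∃ d, SuppIn {o | opDeg o ≤ d} P := by
  refine ⟨P.support.sup Finsupp.degree, fun o ho => ?_⟩
  have h := Finset.le_sup (f := Finsupp.degree) (mem_support_iff.2 ho)
  rwa [degree_opExp] at h

theorem coeff_linPart (P : DEPoly K) (o : Op) :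
    coeff (opExp o) (linPart P) = if opDeg o = 1 then coeff (opExp o) P else 0 := by
  rw [linPart, coeff_homogeneousComponent, degree_opExp]
  rfl

theorem coeff_deltaPart (P : DEPoly K) (o : Op) :
    coeff (opExp o) (deltaPart P) = if o.2 = 0 then coeff (opExp o) P else 0 := by
  induction P using MvPolynomial.induction_on' with
  | monomial m c =>
    obtain ⟨o', rfl⟩ := opExp_surjective m
    have h : deltaPart (monomial (opExp o') c) =
        if o'.2 = 0 then monomial (opExp o') c else 0 := by
      rw [deltaPart, algHom_monomial_opExp]
      have e1 : ∀ a, bind₁ (Sum.elim del fun _ => (0 : DEPoly K)) (del a) = del a := fun a => by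
        rw [del, bind₁_X_right]; rfl
      have e2 : ∀ a, bind₁ (Sum.elim del fun _ => (0 : DEPoly K)) (eps a) = 0 := fun a => by
        rw [eps, bind₁_X_right]; rfl
      simp only [e1, e2]
      split_ifs with h0
      · rw [monomial_opExp, h0]; rfl
      · rw [Multiset.map_const', Multiset.prod_replicate, zero_pow (by simpa using h0), mul_zero,
          mul_zero]
    rw [h]
    split_ifs with h1 h2 h2
    · rfl
    · rw [coeff_monomial, if_neg]
      intro h3
      exact h2 (opExp_injective h3 ▸ h1)
    · rw [coeff_monomial, if_neg, coeff_zero]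
      intro h3
      exact h1 (opExp_injective h3 ▸ h2)
    · rw [coeff_zero]
  | add P Q hP hQ =>
    have h : deltaPart (P + Q) = deltaPart P + deltaPart Q := map_add _ _ _
    rw [h, coeff_add, coeff_add, hP, hQ]
    split_ifs <;> simp

theorem coeff_epsPart (P : DEPoly K) (o : Op) :
    coeff (opExp o) (epsPart P) = if o.1 = 0 then coeff (opExp o) P else 0 := by
  induction P using MvPolynomial.induction_on' with
  | monomial m c =>
    obtain ⟨o', rfl⟩ := opExp_surjective m
    have h : epsPart (monomial (opExp o') c) =
        if o'.1 = 0 then monomial (opExp o') c else 0 := by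
      rw [epsPart, algHom_monomial_opExp]
      have e1 : ∀ a, bind₁ (Sum.elim (fun _ => (0 : DEPoly K)) eps) (eps a) = eps a := fun a => by
        rw [eps, bind₁_X_right]; rfl
      have e2 : ∀ a, bind₁ (Sum.elim (fun _ => (0 : DEPoly K)) eps) (del a) = 0 := fun a => by
        rw [del, bind₁_X_right]; rfl
      simp only [e1, e2]
      split_ifs with h0
      · rw [monomial_opExp, h0]; rfl
      · rw [Multiset.map_const', Multiset.prod_replicate, zero_pow (by simpa using h0), zero_mul,
          mul_zero]
    rw [h]
    split_ifs with h1 h2 h2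
    · rfl
    · rw [coeff_monomial, if_neg]
      intro h3
      exact h2 (opExp_injective h3 ▸ h1)
    · rw [coeff_monomial, if_neg, coeff_zero]
      intro h3
      exact h1 (opExp_injective h3 ▸ h2)
    · rw [coeff_zero]
  | add P Q hP hQ =>
    have h : epsPart (P + Q) = epsPart P + epsPart Q := map_add _ _ _
    rw [h, coeff_add, coeff_add, hP, hQ]
    split_ifs <;> simp

/-! ### The order of operators -/

/-- `o'` arises from `o` by lowering some of the delays. -/
def Below (o' o : Op) : Prop := Multiset.Rel (· ≤ ·) o'.1 o.1 ∧ Multiset.Rel (· ≤ ·) o'.2 o.2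

theorem Below.add {a b c d : Op} (h : Below a b) (h' : Below c d) : Below (a + c) (b + d) :=
  ⟨h.1.add h'.1, h.2.add h'.2⟩

theorem Below.refl (o : Op) : Below o o :=
  ⟨Multiset.rel_refl_of_refl_on fun _ _ => le_rfl, Multiset.rel_refl_of_refl_on fun _ _ => le_rfl⟩

theorem rel_le_sum {s t : Multiset ℕ} (h : Multiset.Rel (· ≤ ·) s t) :
    s.sum ≤ t.sum ∧ (s.sum = t.sum → s = t) := by
  induction h with
  | zero => simp
  | @cons a b as bs hab _ ih =>
    simp only [Multiset.sum_cons]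
    refine ⟨by omega, fun h => ?_⟩
    rw [ih.2 (by omega), show a = b by omega]

/-- No cancellation in the leading coefficient of a product: the sum of the delays strictly
decreases when a delay is lowered. -/
theorem Below.eq_of_add_eq {a b c d : Op} (h : Below a b) (h' : Below c d)
    (e : a + c = b + d) : a = b ∧ c = d := by
  have e1 := congrArg (fun o : Op => o.1.sum) e
  have e2 := congrArg (fun o : Op => o.2.sum) e
  simp only [Prod.fst_add, Prod.snd_add, Multiset.sum_add] at e1 e2
  have h1 := rel_le_sum h.1
  have h2 := rel_le_sum h.2
  have h3 := rel_le_sum h'.1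
  have h4 := rel_le_sum h'.2
  exact ⟨Prod.ext (h1.2 (by omega)) (h2.2 (by omega)), Prod.ext (h3.2 (by omega)) (h4.2 (by omega))⟩

theorem orderedInsert_eq_cons {x : ℕ} {l : List ℕ} (h : (x :: l).Pairwise (· ≥ ·)) :
    l.orderedInsert (· ≥ ·) x = x :: l := by
  cases l with
  | nil => rfl
  | cons y l => exact List.orderedInsert_cons_of_le _ _ (by simp_all)

/-- Insertion into descending lists is monotone for the entrywise order. -/
theorem forall₂_orderedInsert {l l' : List ℕ} (h : List.Forall₂ (· ≤ ·) l l') :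
    l.Pairwise (· ≥ ·) → l'.Pairwise (· ≥ ·) → ∀ {a b : ℕ}, a ≤ b →
      List.Forall₂ (· ≤ ·) (l.orderedInsert (· ≥ ·) a) (l'.orderedInsert (· ≥ ·) b) := by
  induction h with
  | nil => intro _ _ a b hab; simpa using hab
  | @cons x y l l' hxy hl ih =>
    intro h1 h2 a b hab
    have i1 : l.orderedInsert (· ≥ ·) x = x :: l :=
      orderedInsert_eq_cons h1
    have i2 : l'.orderedInsert (· ≥ ·) y = y :: l' :=
      orderedInsert_eq_cons h2
    have IH : ∀ {a b : ℕ}, a ≤ b → _ := ih h1.of_cons h2.of_cons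
    simp only [List.orderedInsert_cons]
    split_ifs with ha hb hb
    · exact .cons hab (.cons hxy hl)
    · refine .cons (by omega) ?_
      rw [← i1]
      exact IH (by omega)
    · refine .cons (by omega) ?_
      rw [← i2]
      exact IH (by omega)
    · exact .cons hxy (IH hab)

theorem sort_cons_eq_orderedInsert (a : ℕ) (s : Multiset ℕ) :
    (a ::ₘ s).sort (· ≥ ·) = (s.sort (· ≥ ·)).orderedInsert (· ≥ ·) a := by
  have h : (((s.sort (· ≥ ·)).orderedInsert (· ≥ ·) a : List ℕ) : Multiset ℕ) = a ::ₘ s := by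
    rw [Multiset.coe_eq_coe.2 (List.perm_orderedInsert _ _ _), ← Multiset.cons_coe,
      Multiset.sort_eq]
  rw [← h, Multiset.coe_sort]
  exact List.mergeSort_eq_self _ ((Multiset.pairwise_sort _ _).orderedInsert _ _)

theorem forall₂_sort {s t : Multiset ℕ} (h : Multiset.Rel (· ≤ ·) s t) :
    List.Forall₂ (· ≤ ·) (s.sort (· ≥ ·)) (t.sort (· ≥ ·)) := by
  induction h with
  | zero => simp
  | cons hab _ ih =>
    rw [sort_cons_eq_orderedInsert, sort_cons_eq_orderedInsert]
    exact forall₂_orderedInsert ih (Multiset.pairwise_sort _ _) (Multiset.pairwise_sort _ _) hab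

theorem le_of_forall₂ {l l' : List ℕ} (h : List.Forall₂ (· ≤ ·) l l') : l ≤ l' := by
  induction h with
  | nil => exact le_rfl
  | cons hab _ ih =>
    rcases hab.lt_or_eq with h | h
    · exact (List.Lex.rel h : _ < _).le
    · subst h
      rcases ih.lt_or_eq with h | h
      · exact (List.Lex.cons h : _ < _).le
      · rw [h]

theorem idxKey_le {s t : Multiset ℕ} (h : Multiset.Rel (· ≤ ·) s t) : idxKey s ≤ idxKey t := by
  rw [idxKey, idxKey, Prod.Lex.toLex_le_toLex]
  exact .inr ⟨Multiset.card_eq_card_of_rel h, le_of_forall₂ (forall₂_sort h)⟩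

theorem idxKey_injective : Function.Injective idxKey := by
  intro s t h
  have h' := congrArg (fun x => (((ofLex x).2 : List ℕ) : Multiset ℕ)) h
  simpa [idxKey] using h'

theorem opKey_injective : Function.Injective opKey := by
  intro o o' h
  have h1 := congrArg (fun x => (ofLex x).1) h
  have h2 := congrArg (fun x => (ofLex x).2) h
  exact Prod.ext (idxKey_injective h1) (idxKey_injective h2)

theorem Below.opKey_le {o o' : Op} (h : Below o' o) : opKey o' ≤ opKey o := by
  rw [opKey, opKey, Prod.Lex.toLex_le_toLex]
  rcases (idxKey_le h.1).lt_or_eq with h1 | h1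
  · exact .inl h1
  · exact .inr ⟨h1, idxKey_le h.2⟩

theorem Below.opKey_lt {o o' : Op} (h : Below o' o) (hne : o' ≠ o) : opKey o' < opKey o :=
  lt_of_le_of_ne h.opKey_le fun e => hne (opKey_injective e)

theorem Below.card_fst {o o' : Op} (h : Below o' o) : o'.1.card = o.1.card :=
  Multiset.card_eq_card_of_rel h.1

theorem Below.card_snd {o o' : Op} (h : Below o' o) : o'.2.card = o.2.card :=
  Multiset.card_eq_card_of_rel h.2

/-! ### Leading operators of star-products -/

/-- `Q` has the leading term `1 · o`, and all its operators arise from `o` by lowering delays. -/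
def Lead (Q : DEPoly K) (o : Op) : Prop := coeff (opExp o) Q = 1 ∧ SuppIn {o' | Below o' o} Q

theorem Lead.one : Lead (1 : DEPoly K) 0 := by
  refine ⟨by rw [coeff_opExp_zero, map_one], ?_⟩
  have h : (1 : DEPoly K) = monomial (opExp 0) 1 := by rw [opExp_zero]; rfl
  rw [h]
  exact SuppIn.monomial (Below.refl 0) 1

theorem Lead.mul {P Q : DEPoly K} {o o' : Op} (hP : Lead P o) (hQ : Lead Q o') :
    Lead (P * Q) (o + o') := by
  classical
  refine ⟨?_, hP.2.mul hQ.2 fun a ha b hb => Below.add ha hb⟩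
  rw [coeff_mul, Finset.sum_eq_single (opExp o, opExp o')]
  · rw [hP.1, hQ.1, one_mul]
  · rintro ⟨m, m'⟩ hm hne
    rw [Finset.HasAntidiagonal.mem_antidiagonal] at hm
    obtain ⟨a, rfl⟩ := opExp_surjective m
    obtain ⟨b, rfl⟩ := opExp_surjective m'
    rw [← opExp_add] at hm
    have hab := opExp_injective hm
    by_contra h0
    have ha := hP.2 a (left_ne_zero_of_mul h0)
    have hb := hQ.2 b (right_ne_zero_of_mul h0)
    obtain ⟨rfl, rfl⟩ := Below.eq_of_add_eq ha hb hab
    exact hne rfl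
  · intro h
    exact absurd (by rw [Finset.HasAntidiagonal.mem_antidiagonal, opExp_add]) h

theorem below_varOp {e : ℕ → ℕ ⊕ ℕ} (he : e = Sum.inl ∨ e = Sum.inr) {a b : ℕ} (h : a ≤ b) :
    Below (varOp (e a)) (varOp (e b)) := by
  have hs : Multiset.Rel (· ≤ ·) ({a} : Multiset ℕ) {b} :=
    Multiset.rel_cons_left.2 ⟨b, 0, h, .zero, rfl⟩
  rcases he with rfl | rfl
  · exact ⟨hs, .zero⟩
  · exact ⟨.zero, hs⟩

theorem lead_shift_formalLin {e : ℕ → ℕ ⊕ ℕ} (he : e = Sum.inl ∨ e = Sum.inr) (w : ℕ → K)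
    (p a : ℕ) : Lead (shift a (formalLin e w p)) (varOp (e (a + p))) := by
  have hinj : ∀ {k l : ℕ}, e k = e l → k = l := by
    rcases he with rfl | rfl
    · exact fun h => Sum.inl_injective h
    · exact fun h => Sum.inr_injective h
  have h : shift a (formalLin e w p) =
      (∑ k ∈ Finset.range p, C (w k) * X (e (a + k))) + X (e (a + p)) := by
    rcases he with rfl | rfl <;> simp [shift, formalLin, add_comm a]
  rw [h]
  constructor
  · rw [coeff_add, coeff_sum, Finset.sum_eq_zero, zero_add, X_eq_monomial_varOp, coeff_monomial,
      if_pos rfl]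
    intro k hk
    rw [coeff_C_mul, X_eq_monomial_varOp, coeff_monomial, if_neg, mul_zero]
    intro h'
    rw [opExp_varOp, opExp_varOp] at h'
    have h1 := hinj (Finsupp.single_left_injective one_ne_zero h')
    have h2 := Finset.mem_range.1 hk
    omega
  · refine SuppIn.add ?_ ?_
    · refine Finset.sum_induction _ (SuppIn _) (fun _ _ => SuppIn.add) (SuppIn.zero _) ?_
      intro k hk
      rw [X_eq_monomial_varOp]
      have h2 := Finset.mem_range.1 hk
      exact (SuppIn.monomial (T := {o' | Below o' (varOp (e (a + p)))})
        (below_varOp he (by omega)) 1).C_mul _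
    · rw [X_eq_monomial_varOp]
      exact SuppIn.monomial (Below.refl _) 1

theorem lead_prod {e : ℕ → ℕ ⊕ ℕ} (he : e = Sum.inl ∨ e = Sum.inr) (w : ℕ → K) (p : ℕ)
    (A : Multiset ℕ) : Lead ((A.map fun a => shift a (formalLin e w p)).prod)
      ((A.map fun a => varOp (e (a + p))).sum) := by
  induction A using Multiset.induction with
  | empty => exact Lead.one
  | cons a A ih =>
    rw [Multiset.map_cons, Multiset.map_cons, Multiset.prod_cons, Multiset.sum_cons]
    exact (lead_shift_formalLin he w p a).mul ih

theorem sum_varOp_inl (A : Multiset ℕ) :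
    (A.map fun a => varOp (Sum.inl a)).sum = ((A, 0) : Op) := by
  induction A using Multiset.induction with
  | empty => rfl
  | cons a A ih =>
    rw [Multiset.map_cons, Multiset.sum_cons, ih]
    simp [varOp]

theorem sum_varOp_inr (A : Multiset ℕ) :
    (A.map fun a => varOp (Sum.inr a)).sum = ((0, A) : Op) := by
  induction A using Multiset.induction with
  | empty => rfl
  | cons a A ih =>
    rw [Multiset.map_cons, Multiset.sum_cons, ih]
    simp [varOp]

theorem normIdx_map_add (I : Multiset ℕ) : (normIdx I).map (· + minDelay I) = I := by
  rw [normIdx, Multiset.map_map]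
  conv_rhs => rw [← Multiset.map_id I]
  refine Multiset.map_congr rfl fun a ha => ?_
  have h : minDelay I ≤ a := Nat.sInf_le ha
  simp only [Function.comp, id]
  omega

theorem normIdx_eq_zero {I : Multiset ℕ} : normIdx I = 0 ↔ I = 0 := Multiset.map_eq_zero

theorem lead_factor_inl (w : ℕ → K) (I : Multiset ℕ) :
    Lead (((normIdx I).map fun a =>
      shift a (if I = 0 then 1 else formalLin Sum.inl w (minDelay I))).prod) (I, 0) := by
  split_ifs with h
  · subst h
    exact Lead.one
  · have h1 := lead_prod (.inl rfl) w (minDelay I) (normIdx I)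
    have h2 := sum_varOp_inl ((normIdx I).map (· + minDelay I))
    rw [Multiset.map_map, normIdx_map_add] at h2
    rwa [← h2]

theorem lead_factor_inr (w : ℕ → K) (I : Multiset ℕ) :
    Lead (((normIdx I).map fun a =>
      shift a (if I = 0 then 1 else formalLin Sum.inr w (minDelay I))).prod) (0, I) := by
  split_ifs with h
  · subst h
    exact Lead.one
  · have h1 := lead_prod (.inr rfl) w (minDelay I) (normIdx I)
    have h2 := sum_varOp_inr ((normIdx I).map (· + minDelay I))
    rw [Multiset.map_map, normIdx_map_add] at h2
    rwa [← h2]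

theorem starProd_monomial (o : Op) (c : K) (L M : DEPoly K) :
    starProd (monomial (opExp o) c) L M =
      C c * ((o.1.map fun a => shift a L).prod * (o.2.map fun a => shift a M).prod) := by
  rw [starProd, algHom_monomial_opExp]
  simp only [del, eps, bind₁_X_right]
  rfl

/-- The terms that the subroutine can form. -/
def Term.IsFormed (t : Term K) : Prop := ∃ w s : ℕ → K, t = mkTerm w s t.c t.lead

theorem Term.IsFormed.value_eq {t : Term K} (h : t.IsFormed) :
    ∃ Q, Lead Q t.lead ∧ t.value = C t.c * Q := by
  obtain ⟨w, s, h⟩ := h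
  refine ⟨_, ?_, starProd_monomial t.op t.c t.L t.M⟩
  have e : t.lead = (t.I, 0) + (0, t.J) := by simp [Term.lead]
  have hL : t.L = if t.I = 0 then 1 else formalLin Sum.inl w (minDelay t.I) := congrArg Term.L h
  have hM : t.M = if t.J = 0 then 1 else formalLin Sum.inr s (minDelay t.J) := congrArg Term.M h
  rw [e, hL, hM]
  exact (lead_factor_inl w t.I).mul (lead_factor_inr s t.J)

theorem Term.IsFormed.coeff_value {t : Term K} (h : t.IsFormed) :
    coeff (opExp t.lead) t.value = t.c := by
  obtain ⟨Q, hQ, e⟩ := h.value_eq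
  rw [e, coeff_C_mul, hQ.1, mul_one]

theorem Term.IsFormed.suppIn_value {t : Term K} (h : t.IsFormed) :
    SuppIn {o | Below o t.lead} t.value := by
  obtain ⟨Q, hQ, e⟩ := h.value_eq
  rw [e]
  exact hQ.2.C_mul _

/-! ### Lists of terms -/

/-- A set of operators that is stable under lowering of delays. -/
def DownClosed (T : Set Op) : Prop := ∀ o ∈ T, ∀ o', Below o' o → o' ∈ T

theorem termsVal_cons (t : Term K) (ts : List (Term K)) :
    termsVal (t :: ts) = t.value + termsVal ts := by
  simp [termsVal]

theorem suppIn_termsVal {ts : List (Term K)} (h : ∀ t ∈ ts, t.IsFormed) :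
    SuppIn {o | ∃ t ∈ ts, Below o t.lead} (termsVal ts) := by
  induction ts with
  | nil => exact SuppIn.zero _
  | cons t ts ih =>
    rw [termsVal_cons]
    refine SuppIn.add ?_ ?_
    · exact (h t List.mem_cons_self).suppIn_value.mono fun o ho => ⟨t, List.mem_cons_self, ho⟩
    · refine (ih fun t ht => h t (List.mem_cons_of_mem _ ht)).mono ?_
      rintro o ⟨t', ht', ho⟩
      exact ⟨t', List.mem_cons_of_mem _ ht', ho⟩

theorem suppIn_termsVal_of_downClosed {T : Set Op} (hT : DownClosed T) {ts : List (Term K)}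
    (h : ∀ t ∈ ts, t.IsFormed) (hl : ∀ t ∈ ts, t.lead ∈ T) : SuppIn T (termsVal ts) := by
  refine (suppIn_termsVal h).mono ?_
  rintro o ⟨t, ht, ho⟩
  exact hT _ (hl t ht) _ ho

theorem goodTerms_nil (w s : ℕ → ℕ → K) : GoodTerms w s [] :=
  ⟨fun l hl => absurd hl (Nat.not_lt_zero l), List.Pairwise.nil⟩

theorem goodTerms_cons {w s : ℕ → ℕ → K} {t : Term K} {ts : List (Term K)} :
    GoodTerms w s (t :: ts) ↔ (t = mkTerm (w 1) (s 1) t.c t.lead ∧ ¬ IsZeroOp t.lead) ∧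
      (∀ t' ∈ ts, opKey t'.lead < opKey t.lead) ∧
      GoodTerms (fun l => w (l + 1)) (fun l => s (l + 1)) ts := by
  constructor
  · rintro ⟨h1, h2⟩
    rw [List.pairwise_cons] at h2
    exact ⟨h1 0 (Nat.succ_pos _), h2.1, fun l hl => h1 (l + 1) (Nat.succ_lt_succ hl), h2.2⟩
  · rintro ⟨h0, h1, h2, h3⟩
    refine ⟨?_, List.pairwise_cons.2 ⟨h1, h3⟩⟩
    rintro (_ | l) hl
    · exact h0
    · exact h2 l (Nat.lt_of_succ_lt_succ hl)

theorem GoodTerms.isFormed {w s : ℕ → ℕ → K} {ts : List (Term K)} (h : GoodTerms w s ts) :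
    ∀ t ∈ ts, t.IsFormed := by
  intro t ht
  obtain ⟨l, hl, rfl⟩ := List.getElem_of_mem ht
  exact ⟨_, _, (h.1 l hl).1⟩

/-- In a list of terms with strictly decreasing operators, followed by zero terms, the coefficient
at the first operator is that of the first term: all the later operators are smaller. -/
theorem GoodTerms.coeff_head {w s : ℕ → ℕ → K} {t : Term K} {ts : List (Term K)} {R : DEPoly K}
    (h : GoodTerms w s (t :: ts)) (hR : AllZero R) :
    coeff (opExp t.lead) (termsVal (t :: ts) + R) = t.c := by
  have hf := h.isFormed
  obtain ⟨h0, h1, h2⟩ := goodTerms_cons.1 h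
  have e1 : coeff (opExp t.lead) (termsVal ts) = 0 := by
    refine (suppIn_termsVal h2.isFormed).coeff_eq_zero ?_
    rintro ⟨t', ht', hb⟩
    exact absurd hb.opKey_le (not_le.2 (h1 t' ht'))
  have e2 : coeff (opExp t.lead) R = 0 := by
    by_contra hc
    exact h0.2 (hR _ hc)
  rw [termsVal_cons, coeff_add, coeff_add, e1, e2, (hf t List.mem_cons_self).coeff_value, add_zero,
    add_zero]

theorem GoodTerms.isMaxNonzero {w s : ℕ → ℕ → K} {t : Term K} {ts : List (Term K)} {R : DEPoly K}
    (h : GoodTerms w s (t :: ts)) (hR : AllZero R) (hc : t.c ≠ 0) :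
    IsMaxNonzero (termsVal (t :: ts) + R) t.lead := by
  refine ⟨by rwa [h.coeff_head hR], (goodTerms_cons.1 h).1.2, fun o ho hz => ?_⟩
  have h' : coeff (opExp o) (termsVal (t :: ts)) ≠ 0 := by
    intro h0
    rw [coeff_add, h0, zero_add] at ho
    exact hz (hR o ho)
  obtain ⟨t', ht', hb⟩ := suppIn_termsVal h.isFormed o h'
  refine hb.opKey_le.trans ?_
  rcases List.mem_cons.1 ht' with rfl | ht'
  · exact le_rfl
  · exact ((goodTerms_cons.1 h).2.1 t' ht').le

/-- The operators of a list of terms and the value determine the coefficients. -/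
theorem GoodTerms.eq_of_value_eq {ts : List (Term K)} : ∀ {w s : ℕ → ℕ → K} {ts' : List (Term K)}
    {R R' : DEPoly K}, GoodTerms w s ts → GoodTerms w s ts' → AllZero R → AllZero R' →
    ts.map Term.lead = ts'.map Term.lead → termsVal ts + R = termsVal ts' + R' →
    ts = ts' ∧ R = R' := by
  induction ts with
  | nil =>
    intro w s ts' R R' _ _ _ _ hs hv
    obtain rfl : ts' = [] := by simpa using hs.symm
    exact ⟨rfl, add_left_cancel hv⟩
  | cons t ts ih =>
    intro w s ts' R R' h h' hR hR' hs hv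
    rcases ts' with _ | ⟨t', ts'⟩
    · simp at hs
    rw [List.map_cons, List.map_cons, List.cons.injEq] at hs
    have hc : t.c = t'.c := by
      rw [← h.coeff_head hR, ← h'.coeff_head hR', hv, hs.1]
    obtain ⟨h0, -, h2⟩ := goodTerms_cons.1 h
    obtain ⟨h0', -, h2'⟩ := goodTerms_cons.1 h'
    obtain rfl : t = t' := by rw [h0.1, h0'.1, hc, hs.1]
    rw [termsVal_cons, termsVal_cons, add_assoc, add_assoc] at hv
    obtain ⟨rfl, rfl⟩ := ih h2 h2' hR hR' hs.2 (add_left_cancel hv)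
    exact ⟨rfl, rfl⟩

/-! ### The subroutine -/

theorem isFormed_mkTerm (w s : ℕ → K) (c : K) (o : Op) : (mkTerm w s c o).IsFormed := ⟨w, s, rfl⟩

theorem IsMaxNonzero.unique {P : DEPoly K} {o o' : Op} (h : IsMaxNonzero P o)
    (h' : IsMaxNonzero P o') : o = o' :=
  opKey_injective (le_antisymm (h'.2.2 o h.1 h.2.1) (h.2.2 o' h'.1 h'.2.1))

/-- Subtraction of the term formed from the maximum non-zero term leaves smaller operators only. -/
theorem IsMaxNonzero.opKey_lt_of_sub {R : DEPoly K} {o : Op} (h : IsMaxNonzero R o) (w s : ℕ → K)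
    {o' : Op} (ho' : coeff (opExp o') (R - (mkTerm w s (coeff (opExp o) R) o).value) ≠ 0)
    (hz : ¬ IsZeroOp o') : opKey o' < opKey o := by
  have hf := isFormed_mkTerm w s (coeff (opExp o) R) o
  have hne : o' ≠ o := by
    rintro rfl
    rw [coeff_sub] at ho'
    exact ho' (sub_eq_zero.2 hf.coeff_value.symm)
  by_cases h1 : coeff (opExp o') R = 0
  · have h2 : coeff (opExp o') (mkTerm w s (coeff (opExp o) R) o).value ≠ 0 := by
      intro h2
      rw [coeff_sub, h1, h2, sub_zero] at ho'
      exact ho' rfl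
    exact (hf.suppIn_value o' h2).opKey_lt hne
  · exact lt_of_le_of_ne (h.2.2 o' h1 hz) fun e => hne (opKey_injective e)

theorem RemLoop.unique {w s : ℕ → ℕ → K} {l : ℕ} {R : DEPoly K} {ts : List (Term K)} {R' : DEPoly K}
    (h : RemLoop w s l R ts R') : ∀ {ts₂ : List (Term K)} {R₂ : DEPoly K},
      RemLoop w s l R ts₂ R₂ → ts = ts₂ ∧ R' = R₂ := by
  induction h with
  | halt l R hR =>
    intro ts₂ R₂ h₂
    cases h₂ with
    | halt => exact ⟨rfl, rfl⟩
    | next _ _ o _ _ _ ho => exact absurd (hR o ho.1) ho.2.1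
  | next l R o t ts R' ho ht _ ih =>
    intro ts₂ R₂ h₂
    cases h₂ with
    | halt _ _ hR => exact absurd (hR o ho.1) ho.2.1
    | next _ _ o' t' ts' _ ho' ht' h' =>
      obtain rfl := ho.unique ho'
      obtain rfl : t = t' := ht.trans ht'.symm
      obtain ⟨rfl, rfl⟩ := ih h'
      exact ⟨rfl, rfl⟩

theorem RemLoop.lead_lt {w s : ℕ → ℕ → K} {l : ℕ} {R : DEPoly K} {ts : List (Term K)}
    {R' : DEPoly K} (h : RemLoop w s l R ts R') : ∀ {o : Op},
    (∀ o', coeff (opExp o') R ≠ 0 → ¬ IsZeroOp o' → opKey o' < opKey o) →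
      ∀ t ∈ ts, opKey t.lead < opKey o := by
  induction h with
  | halt => simp
  | next l R o t ts R' ho ht _ ih =>
    intro k hk t' ht'
    subst ht
    have h0 : opKey o < opKey k := hk o ho.1 ho.2.1
    rcases List.mem_cons.1 ht' with rfl | ht'
    · exact h0
    · exact ih (fun o' h1 h2 => (ho.opKey_lt_of_sub _ _ h1 h2).trans h0) t' ht'

theorem RemLoop.spec {w s : ℕ → ℕ → K} {l : ℕ} {R : DEPoly K} {ts : List (Term K)} {R' : DEPoly K}
    (h : RemLoop w s l R ts R') : R = termsVal ts + R' ∧ AllZero R' ∧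
      GoodTerms (fun i => w (i + l)) (fun i => s (i + l)) ts ∧ ∀ t ∈ ts, t.c ≠ 0 := by
  induction h with
  | halt l R hR => exact ⟨by simp [termsVal], hR, goodTerms_nil _ _, by simp⟩
  | next l R o t ts R' ho ht hloop ih =>
    obtain ⟨h1, h2, h3, h4⟩ := ih
    subst ht
    refine ⟨?_, h2, goodTerms_cons.2 ⟨⟨?_, ho.2.1⟩, ?_, ?_⟩, ?_⟩
    · rw [termsVal_cons, add_assoc, ← h1]
      ring
    · simp only [add_comm 1 l]
      rfl
    · exact fun t' ht' => hloop.lead_lt (fun o' h1 h2 => ho.opKey_lt_of_sub _ _ h1 h2) t' ht'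
    · simpa only [add_comm l 1, add_assoc] using h3
    · intro t ht
      rcases List.mem_cons.1 ht with rfl | ht
      · exact ho.1
      · exact h4 t ht

/-- Conversely, admissible terms with non-zero coefficients, followed by zero terms, are what the
loop finds in their sum. -/
theorem RemLoop.of_goodTerms {ts : List (Term K)} : ∀ {w s : ℕ → ℕ → K} {l : ℕ} {R : DEPoly K},
    GoodTerms (fun i => w (i + l)) (fun i => s (i + l)) ts → AllZero R → (∀ t ∈ ts, t.c ≠ 0) →
    RemLoop w s l (termsVal ts + R) ts R := by
  induction ts with
  | nil =>
    intro w s l R _ hR _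
    rw [show termsVal ([] : List (Term K)) + R = R by simp [termsVal]]
    exact .halt l R hR
  | cons t ts ih =>
    intro w s l R h hR hc
    have hmax := h.isMaxNonzero hR (hc t List.mem_cons_self)
    refine .next l _ t.lead t ts R hmax ?_ ?_
    · rw [h.coeff_head hR, add_comm l 1]
      exact (goodTerms_cons.1 h).1.1
    · rw [termsVal_cons, add_assoc, add_sub_cancel_left]
      refine ih ?_ hR fun t ht => hc t (List.mem_cons_of_mem _ ht)
      simpa only [add_comm l 1, add_assoc] using (goodTerms_cons.1 h).2.2

/-- The loop creates no operators outside a set that is stable under lowering of delays; this is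
used for pure operators, cross operators and bounds of the degree. -/
theorem RemLoop.suppIn {T : Set Op} (hT : DownClosed T) {w s : ℕ → ℕ → K} {l : ℕ} {R : DEPoly K}
    {ts : List (Term K)} {R' : DEPoly K} (h : RemLoop w s l R ts R') (hR : SuppIn T R) :
    (∀ t ∈ ts, t.lead ∈ T) ∧ SuppIn T R' := by
  induction h with
  | halt l R _ => exact ⟨by simp, hR⟩
  | next l R o t ts R' ho ht hloop ih =>
    subst ht
    have ho' : o ∈ T := hR o ho.1
    have hf := isFormed_mkTerm (w (l + 1)) (s (l + 1)) (coeff (opExp o) R) o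
    obtain ⟨h1, h2⟩ := ih (hR.sub (hf.suppIn_value.mono fun o' hb => hT o ho' o' hb))
    refine ⟨fun t ht => ?_, h2⟩
    rcases List.mem_cons.1 ht with rfl | ht
    · exact ho'
    · exact h1 t ht

theorem exists_isMaxNonzero {R : DEPoly K} (h : ¬ AllZero R) : ∃ o, IsMaxNonzero R o := by
  classical
  have hfin : {o : Op | coeff (opExp o) R ≠ 0 ∧ ¬ IsZeroOp o}.Finite := by
    refine Set.Finite.subset (R.support.finite_toSet.preimage opExp_injective.injOn) ?_
    exact fun o ho => mem_support_iff.2 ho.1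
  have hne : {o : Op | coeff (opExp o) R ≠ 0 ∧ ¬ IsZeroOp o}.Nonempty := by
    simp only [AllZero, not_forall] at h
    obtain ⟨o, h1, h2⟩ := h
    exact ⟨o, h1, h2⟩
  obtain ⟨o, ho, hmax⟩ := Set.exists_max_image _ opKey hfin hne
  exact ⟨o, ho.1, ho.2, fun o' h1 h2 => hmax o' ⟨h1, h2⟩⟩

/-- The operators with at most `d` variables, all delays being at most `N`. -/
def boxOps (d N : ℕ) : Set Op :=
  {o | (o.1.card ≤ d ∧ ∀ a ∈ o.1, a ≤ N) ∧ (o.2.card ≤ d ∧ ∀ a ∈ o.2, a ≤ N)}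

theorem finite_boxOps (d N : ℕ) : (boxOps d N).Finite := by
  have h : {s : Multiset ℕ | s.card ≤ d ∧ ∀ a ∈ s, a ≤ N}.Finite := by
    refine (Set.finite_Iic (d • (Finset.range (N + 1)).val)).subset ?_
    rintro s ⟨h1, h2⟩
    rw [Set.mem_Iic, Multiset.le_iff_count]
    intro a
    rw [Multiset.count_nsmul]
    by_cases ha : a ∈ s
    · have h3 : Multiset.count a (Finset.range (N + 1)).val = 1 := by
        refine Multiset.count_eq_one_of_mem (Finset.range (N + 1)).nodup ?_
        exact Finset.mem_range.2 (Nat.lt_succ_of_le (h2 a ha))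
      rw [h3, mul_one]
      exact (Multiset.count_le_card a s).trans h1
    · rw [Multiset.count_eq_zero_of_notMem ha]
      exact Nat.zero_le _
  exact h.prod h

theorem rel_le_bound {s t : Multiset ℕ} (h : Multiset.Rel (· ≤ ·) s t) {N : ℕ}
    (ht : ∀ a ∈ t, a ≤ N) : ∀ a ∈ s, a ≤ N := by
  intro a ha
  obtain ⟨b, hb, hab⟩ := Multiset.exists_mem_of_rel_of_mem h ha
  exact hab.trans (ht b hb)

theorem downClosed_boxOps (d N : ℕ) : DownClosed (boxOps d N) := fun _ ho _ hb =>
  ⟨⟨hb.card_fst.trans_le ho.1.1, rel_le_bound hb.1 ho.1.2⟩,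
    ⟨hb.card_snd.trans_le ho.2.1, rel_le_bound hb.2 ho.2.2⟩⟩

theorem exists_suppIn_boxOps (P : DEPoly K) : ∃ d N, SuppIn (boxOps d N) P := by
  obtain ⟨d, hd⟩ := exists_suppIn_opDeg_le P
  refine ⟨d, P.vars.sup (Sum.elim id id), fun o ho => ?_⟩
  have h1 : opDeg o ≤ d := hd o ho
  have h2 : ∀ x ∈ (opExp o).support, Sum.elim id id x ≤ P.vars.sup (Sum.elim id id) := fun x hx =>
    Finset.le_sup (f := Sum.elim id id) ((mem_vars_iff_mem_support _).2 ⟨_, mem_support_iff.2 ho, hx⟩)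
  unfold opDeg at h1
  refine ⟨⟨by omega, fun a ha => ?_⟩, ⟨by omega, fun a ha => ?_⟩⟩
  · exact h2 _ (inl_mem_support_opExp.2 ha)
  · exact h2 _ (inr_mem_support_opExp.2 ha)

/-- The loop of the subroutine terminates: its operators lie in a finite set that is stable under
lowering of delays, and the maximum non-zero operator strictly decreases. -/
theorem RemLoop.exists (w s : ℕ → ℕ → K) (l : ℕ) (R : DEPoly K) :
    ∃ ts R', RemLoop w s l R ts R' := by
  classical
  obtain ⟨d, N, hR⟩ := exists_suppIn_boxOps R
  have key : ∀ n l, ∀ R : DEPoly K, SuppIn (boxOps d N) R →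
      {o ∈ boxOps d N | ∃ o', coeff (opExp o') R ≠ 0 ∧ ¬ IsZeroOp o' ∧
        opKey o ≤ opKey o'}.ncard ≤ n → ∃ ts R', RemLoop w s l R ts R' := by
    intro n
    induction n with
    | zero =>
      intro l R hR hn
      refine ⟨[], R, .halt l R fun o ho => ?_⟩
      by_contra hz
      rw [Nat.le_zero, Set.ncard_eq_zero ((finite_boxOps d N).subset (Set.sep_subset _ _))] at hn
      have : o ∈ (∅ : Set Op) := hn ▸ ⟨hR o ho, o, ho, hz, le_rfl⟩
      exact this
    | succ n ih =>
      intro l R hR hn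
      by_cases hz : AllZero R
      · exact ⟨[], R, .halt l R hz⟩
      obtain ⟨o, ho⟩ := exists_isMaxNonzero hz
      have hf := isFormed_mkTerm (w (l + 1)) (s (l + 1)) (coeff (opExp o) R) o
      have hoB := hR o ho.1
      have hR' := hR.sub (hf.suppIn_value.mono fun o' hb => downClosed_boxOps d N o hoB o' hb)
      obtain ⟨ts, R', hloop⟩ := ih (l + 1) _ hR' (by
        refine Nat.le_of_lt_succ (lt_of_lt_of_le (Set.ncard_lt_ncard ?_
          ((finite_boxOps d N).subset (Set.sep_subset _ _))) hn)
        refine (Set.ssubset_iff_of_subset ?_).2 ⟨o, ⟨hoB, o, ho.1, ho.2.1, le_rfl⟩, ?_⟩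
        · rintro a ⟨ha, o', h1, h2, h3⟩
          exact ⟨ha, o, ho.1, ho.2.1, h3.trans (ho.opKey_lt_of_sub _ _ h1 h2).le⟩
        · rintro ⟨-, o', h1, h2, h3⟩
          exact absurd (ho.opKey_lt_of_sub _ _ h1 h2) (not_lt.2 h3))
      exact ⟨_, R', .next l R o _ ts R' ho rfl hloop⟩
  exact key _ l R hR le_rfl

/-! ### Powers that are factored out -/

theorem exists_coeff_ne_zero {P : DEPoly K} (h : P ≠ 0) : ∃ o, coeff (opExp o) P ≠ 0 := by
  by_contra hc
  push Not at hc
  exact h (ext_op fun o => by rw [hc o, coeff_zero])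

theorem suppIn_ne_zero_iff {P : DEPoly K} : SuppIn {o | o ≠ 0} P ↔ constantCoeff P = 0 := by
  rw [← coeff_opExp_zero]
  constructor
  · intro h
    exact h.coeff_eq_zero fun h0 => h0 rfl
  · rintro h o ho rfl
    exact ho h

theorem exists_nat_max {p : ℕ → Prop} {d : ℕ} (h : ∃ n, p n) (hd : ∀ n, p n → n ≤ d) :
    ∃ n, p n ∧ ∀ m, p m → m ≤ n :=
  ⟨sSup {n | p n}, Nat.sSup_mem h ⟨d, hd⟩, fun _ hm => le_csSup ⟨d, hd⟩ hm⟩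

theorem exists_lex_max {p : ℕ → ℕ → Prop} {d : ℕ} (h : ∃ a b, p a b)
    (hd : ∀ a b, p a b → a ≤ d ∧ b ≤ d) :
    ∃ a b, p a b ∧ ∀ a' b', p a' b' → a' ≤ a ∧ (a' = a → b' ≤ b) := by
  obtain ⟨a, ⟨b₀, hb₀⟩, hmax⟩ := exists_nat_max (p := fun a => ∃ b, p a b) h
    fun a ⟨b, hb⟩ => (hd a b hb).1
  obtain ⟨b, hb, hmax'⟩ := exists_nat_max (p := p a) ⟨b₀, hb₀⟩ fun b hb => (hd a b hb).2
  refine ⟨a, b, hb, fun a' b' h' => ⟨hmax a' ⟨b', h'⟩, ?_⟩⟩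
  rintro rfl
  exact hmax' b' h'

theorem add_opDeg_le_of_eq_X_pow_mul {x : ℕ ⊕ ℕ} {R R1 : DEPoly K} {θ d : ℕ}
    (hd : SuppIn {o | opDeg o ≤ d} R) (h : R = X x ^ θ * R1) :
    SuppIn {o | θ + opDeg o ≤ d} R1 := by
  intro o ho
  have h1 := (h ▸ hd).of_X_pow_mul o ho
  rw [Set.mem_ofPred_eq, Set.mem_ofPred_eq, opDeg_add, opDeg_nsmul_varOp] at h1
  exact h1

theorem exponent_le {x : ℕ ⊕ ℕ} {R R1 : DEPoly K} {θ d : ℕ} (hR : R ≠ 0)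
    (hd : SuppIn {o | opDeg o ≤ d} R) (h : R = X x ^ θ * R1) : θ ≤ d := by
  have h1 : R1 ≠ 0 := by
    rintro rfl
    exact hR (by rw [h, mul_zero])
  obtain ⟨o, ho⟩ := exists_coeff_ne_zero h1
  exact (Nat.le_add_right _ _).trans (add_opDeg_le_of_eq_X_pow_mul hd h o ho)

theorem isMaxFactor_zero (x : ℕ ⊕ ℕ) : IsMaxFactor x (0 : DEPoly K) 0 0 :=
  ⟨by simp, map_zero _, fun _ => rfl, fun h => absurd rfl h⟩

theorem IsMaxFactor.exists (x : ℕ ⊕ ℕ) {R : DEPoly K} (h : constantCoeff R = 0) :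
    ∃ θ R1, IsMaxFactor x R θ R1 := by
  by_cases hR : R = 0
  · subst hR
    exact ⟨0, 0, isMaxFactor_zero x⟩
  obtain ⟨d, hd⟩ := exists_suppIn_opDeg_le R
  obtain ⟨θ, ⟨R1, h1, h2⟩, hmax⟩ := exists_nat_max
    (p := fun θ => ∃ R1, R = X x ^ θ * R1 ∧ constantCoeff R1 = 0)
    ⟨0, R, by simp, h⟩ fun θ ⟨R1, h1, _⟩ => exponent_le hR hd h1
  exact ⟨θ, R1, h1, h2, fun h0 => absurd h0 hR, fun _ θ' R1' h1' h2' => hmax θ' ⟨R1', h1', h2'⟩⟩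

theorem IsMaxFactor.unique {x : ℕ ⊕ ℕ} {R R1 R1' : DEPoly K} {θ θ' : ℕ}
    (h : IsMaxFactor x R θ R1) (h' : IsMaxFactor x R θ' R1') : θ = θ' ∧ R1 = R1' := by
  obtain rfl : θ = θ' := by
    by_cases hR : R = 0
    · rw [h.2.2.1 hR, h'.2.2.1 hR]
    · exact le_antisymm (h'.2.2.2 hR _ _ h.1 h.2.1) (h.2.2.2 hR _ _ h'.1 h'.2.1)
  exact ⟨rfl, X_pow_mul_cancel x θ (h.1 ▸ h'.1)⟩

/-- If the variable `x` occurs in all the terms of a non-zero polynomial, but not as a linear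
term, then a positive power of `x` is factored out. -/
theorem IsMaxFactor.pos {x : ℕ ⊕ ℕ} {R R1 : DEPoly K} {θ : ℕ} (h : IsMaxFactor x R θ R1)
    (hR : R ≠ 0) (hx : SuppIn {o | x ∈ (opExp o).support} R)
    (h0 : coeff (opExp (varOp x)) R = 0) : 0 < θ := by
  obtain ⟨Q, hQ⟩ := exists_eq_X_mul hx
  have hQ' : R = X x ^ 1 * Q := by rw [pow_one, hQ]
  refine h.2.2.2 hR 1 Q hQ' ?_
  rw [← coeff_opExp_zero, ← coeff_X_pow_mul_varOp x 1, ← hQ', one_smul, add_zero, h0]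

theorem factor₂_eq (κ σ : ℕ) (R : DEPoly K) :
    del 0 ^ κ * eps 0 ^ σ * R = X (Sum.inl 0) ^ κ * (X (Sum.inr 0) ^ σ * R) := mul_assoc _ _ _

theorem factor₂_eq' (κ σ : ℕ) (R : DEPoly K) :
    del 0 ^ κ * eps 0 ^ σ * R = X (Sum.inr 0) ^ σ * (X (Sum.inl 0) ^ κ * R) := by
  rw [factor₂_eq]
  ring

theorem factor₂_cancel {κ σ : ℕ} {P Q : DEPoly K}
    (h : del 0 ^ κ * eps 0 ^ σ * P = del 0 ^ κ * eps 0 ^ σ * Q) : P = Q := by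
  rw [factor₂_eq, factor₂_eq] at h
  exact X_pow_mul_cancel _ _ (X_pow_mul_cancel _ _ h)

theorem IsMaxFactor₂.exists (tie : Bool) {R : DEPoly K} (h : constantCoeff R = 0) :
    ∃ κ σ R1, IsMaxFactor₂ tie R κ σ R1 := by
  by_cases hR : R = 0
  · subst hR
    exact ⟨0, 0, 0, by simp, map_zero _, fun _ => ⟨rfl, rfl⟩, fun h => absurd rfl h⟩
  obtain ⟨d, hd⟩ := exists_suppIn_opDeg_le R
  have h0 : R = del 0 ^ 0 * eps 0 ^ 0 * R ∧ constantCoeff R = 0 := ⟨by simp, h⟩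
  have hb : ∀ κ σ, (∃ R1 : DEPoly K, R = del 0 ^ κ * eps 0 ^ σ * R1 ∧ constantCoeff R1 = 0) →
      κ ≤ d ∧ σ ≤ d := by
    rintro κ σ ⟨R1, h1, -⟩
    exact ⟨exponent_le hR hd (h1.trans (factor₂_eq _ _ _)),
      exponent_le hR hd (h1.trans (factor₂_eq' _ _ _))⟩
  cases tie with
  | true =>
    obtain ⟨κ, σ, ⟨R1, h1, h2⟩, hmax⟩ := exists_lex_max ⟨0, 0, R, h0⟩ hb
    exact ⟨κ, σ, R1, h1, h2, fun h => absurd h hR, fun _ κ' σ' R1' h1' h2' => by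
      simpa using hmax κ' σ' ⟨R1', h1', h2'⟩⟩
  | false =>
    obtain ⟨σ, κ, ⟨R1, h1, h2⟩, hmax⟩ := exists_lex_max
      (p := fun σ κ => ∃ R1, R = del 0 ^ κ * eps 0 ^ σ * R1 ∧ constantCoeff R1 = 0)
      ⟨0, 0, R, h0⟩ fun σ κ h => (hb κ σ h).symm
    exact ⟨κ, σ, R1, h1, h2, fun h => absurd h hR, fun _ κ' σ' R1' h1' h2' => by
      simpa using hmax σ' κ' ⟨R1', h1', h2'⟩⟩

theorem IsMaxFactor₂.unique {tie : Bool} {R R1 R1' : DEPoly K} {κ σ κ' σ' : ℕ}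
    (h : IsMaxFactor₂ tie R κ σ R1) (h' : IsMaxFactor₂ tie R κ' σ' R1') :
    κ = κ' ∧ σ = σ' ∧ R1 = R1' := by
  obtain ⟨rfl, rfl⟩ : κ = κ' ∧ σ = σ' := by
    by_cases hR : R = 0
    · have h1 := h.2.2.1 hR
      have h2 := h'.2.2.1 hR
      omega
    · have h1 := h.2.2.2 hR _ _ _ h'.1 h'.2.1
      have h2 := h'.2.2.2 hR _ _ _ h.1 h.2.1
      cases tie <;> simp only [if_true, Bool.false_eq_true, if_false] at h1 h2 <;> omega
  exact ⟨rfl, rfl, factor₂_cancel (h.1 ▸ h'.1)⟩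

/-- If all the terms contain `δ_0` and `ε_0`, both exponent pairs `(1, 0)` and `(0, 1)` are possible,
so that a maximal pair is not `(0, 0)`, whatever the rule for ties is. -/
theorem IsMaxFactor₂.pos {tie : Bool} {R R1 : DEPoly K} {κ σ : ℕ} (h : IsMaxFactor₂ tie R κ σ R1)
    (hR : R ≠ 0) (hx : SuppIn {o | 0 ∈ o.1 ∧ 0 ∈ o.2} R) : 0 < κ + σ := by
  obtain ⟨P, hP⟩ := exists_eq_X_mul (x := Sum.inl 0)
    (hx.mono fun o ho => inl_mem_support_opExp.2 ho.1)
  obtain ⟨Q, hQ⟩ := exists_eq_X_mul (x := Sum.inr 0)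
    (hx.mono fun o ho => inr_mem_support_opExp.2 ho.2)
  have hP0 : constantCoeff P = 0 := by
    rw [← coeff_opExp_zero, ← coeff_X_pow_mul_varOp (Sum.inl 0) 1, pow_one, ← hP]
    exact hx.coeff_eq_zero fun ho => by simpa [varOp] using ho.2
  have hQ0 : constantCoeff Q = 0 := by
    rw [← coeff_opExp_zero, ← coeff_X_pow_mul_varOp (Sum.inr 0) 1, pow_one, ← hQ]
    exact hx.coeff_eq_zero fun ho => by simpa [varOp] using ho.1
  have h1 := h.2.2.2 hR 1 0 P (by rw [pow_one, pow_zero, mul_one]; exact hP) hP0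
  have h2 := h.2.2.2 hR 0 1 Q (by rw [pow_one, pow_zero, one_mul]; exact hQ) hQ0
  cases tie <;> simp only [if_true, Bool.false_eq_true, if_false] at h1 h2 <;> omega

/-! ### Pure parts -/

section Pure

/-- The non-empty operators in the variables `e 0, e 1, …`. -/
def partOps (e : ℕ → ℕ ⊕ ℕ) : Set Op := {o | o ≠ 0 ∧ ∀ x ∈ (opExp o).support, x ∈ Set.range e}

theorem mem_partOps_inl {o : Op} : o ∈ partOps Sum.inl ↔ o.1 ≠ 0 ∧ o.2 = 0 := by
  constructor
  · rintro ⟨h0, h⟩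
    have h2 : o.2 = 0 := by
      refine Multiset.eq_zero_of_forall_notMem fun a ha => ?_
      obtain ⟨b, hb⟩ := h _ (inr_mem_support_opExp.2 ha)
      exact Sum.inl_ne_inr hb
    exact ⟨fun h1 => h0 (Prod.ext h1 h2), h2⟩
  · rintro ⟨h1, h2⟩
    refine ⟨fun h => h1 (congrArg Prod.fst h), ?_⟩
    rintro (a | a) ha
    · exact ⟨a, rfl⟩
    · rw [inr_mem_support_opExp, h2] at ha
      exact absurd ha (Multiset.notMem_zero a)

theorem mem_partOps_inr {o : Op} : o ∈ partOps Sum.inr ↔ o.1 = 0 ∧ o.2 ≠ 0 := by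
  constructor
  · rintro ⟨h0, h⟩
    have h1 : o.1 = 0 := by
      refine Multiset.eq_zero_of_forall_notMem fun a ha => ?_
      obtain ⟨b, hb⟩ := h _ (inl_mem_support_opExp.2 ha)
      exact Sum.inr_ne_inl hb
    exact ⟨h1, fun h2 => h0 (Prod.ext h1 h2)⟩
  · rintro ⟨h1, h2⟩
    refine ⟨fun h => h2 (congrArg Prod.snd h), ?_⟩
    rintro (a | a) ha
    · rw [inl_mem_support_opExp, h1] at ha
      exact absurd ha (Multiset.notMem_zero a)
    · exact ⟨a, rfl⟩

variable {e : ℕ → ℕ ⊕ ℕ}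

theorem downClosed_partOps (he : e = Sum.inl ∨ e = Sum.inr) : DownClosed (partOps e) := by
  intro o ho o' hb
  have h1 := hb.card_fst
  have h2 := hb.card_snd
  rcases he with rfl | rfl
  · simp only [mem_partOps_inl, ne_eq, ← Multiset.card_eq_zero] at ho ⊢
    omega
  · simp only [mem_partOps_inr, ne_eq, ← Multiset.card_eq_zero] at ho ⊢
    omega

theorem nsmul_varOp_add_mem_partOps (n : ℕ) {o : Op} (ho : o ∈ partOps e) :
    n • varOp (e 0) + o ∈ partOps e := by
  refine ⟨fun h => ?_, fun x hx => ?_⟩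
  · have h1 := congrArg opDeg h
    rw [opDeg_add] at h1
    exact ho.1 (opDeg_eq_zero (Nat.eq_zero_of_add_eq_zero_left h1))
  · rw [opExp_add, Finsupp.mem_support_iff, Finsupp.add_apply] at hx
    by_cases hx' : opExp o x = 0
    · rw [hx', add_zero] at hx
      have h2 : opExp (n • varOp (e 0)) = n • Finsupp.single (e 0) 1 := by
        rw [← opExp_varOp]
        exact map_nsmul (⟨⟨opExp, opExp_zero⟩, opExp_add⟩ : Op →+ (ℕ ⊕ ℕ →₀ ℕ)) n _
      rw [h2, Finsupp.smul_apply, Finsupp.single_apply] at hx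
      by_cases h3 : e 0 = x
      · exact ⟨0, h3⟩
      · rw [if_neg h3, smul_zero] at hx
        exact absurd rfl hx
    · exact ho.2 x (Finsupp.mem_support_iff.2 hx')

theorem SuppIn.partOps_of_X_pow_mul {n : ℕ} {P : DEPoly K}
    (h : SuppIn (partOps e) (X (e 0) ^ n * P)) (h0 : constantCoeff P = 0) :
    SuppIn (partOps e) P := by
  intro o ho
  refine ⟨suppIn_ne_zero_iff.2 h0 o ho, fun x hx => ?_⟩
  refine (h.of_X_pow_mul o ho).2 x ?_
  rw [opExp_add, Finsupp.mem_support_iff, Finsupp.add_apply]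
  have := Finsupp.mem_support_iff.1 hx
  omega

theorem SuppIn.constantCoeff_partOps {P : DEPoly K} (h : SuppIn (partOps e) P) :
    constantCoeff P = 0 := suppIn_ne_zero_iff.1 (h.mono fun _ ho => ho.1)

theorem SuppIn.vars_partOps {P : DEPoly K} (h : SuppIn (partOps e) P) :
    ∀ x ∈ P.vars, x ∈ Set.range e := by
  intro x hx
  obtain ⟨m, hm, hxm⟩ := (mem_vars_iff_mem_support _).1 hx
  obtain ⟨o, rfl⟩ := opExp_surjective m
  exact (h o (mem_support_iff.1 hm)).2 x hxm

theorem suppIn_partOps_of_vars {P : DEPoly K} (h : ∀ x ∈ P.vars, x ∈ Set.range e)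
    (h0 : constantCoeff P = 0) : SuppIn (partOps e) P := fun o ho =>
  ⟨suppIn_ne_zero_iff.2 h0 o ho, fun x hx =>
    h x ((mem_vars_iff_mem_support _).2 ⟨_, mem_support_iff.2 ho, hx⟩)⟩

theorem suppIn_sub_linPart {T : Set Op} {P : DEPoly K} (h : SuppIn T P)
    (h0 : constantCoeff P = 0) : SuppIn (T ∩ {o | 2 ≤ opDeg o}) (P - linPart P) := by
  intro o ho
  rw [coeff_sub, coeff_linPart] at ho
  split_ifs at ho with h1
  · rw [sub_self] at ho
    exact absurd rfl ho
  · rw [sub_zero] at ho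
    refine ⟨h o ho, ?_⟩
    have h2 : opDeg o ≠ 0 := fun h2 => suppIn_ne_zero_iff.2 h0 o ho (opDeg_eq_zero h2)
    rw [Set.mem_ofPred_eq]
    omega

theorem linPart_eq_zero_iff {P : DEPoly K} : linPart P = 0 ↔ SuppIn {o | opDeg o ≠ 1} P := by
  constructor
  · intro h o ho h1
    have h2 := coeff_linPart P o
    rw [h, coeff_zero, if_pos h1] at h2
    exact ho h2.symm
  · intro h
    refine ext_op fun o => ?_
    rw [coeff_linPart, coeff_zero]
    split_ifs with h1
    · exact h.coeff_eq_zero fun h2 => h2 h1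
    · rfl

theorem linPart_add (P Q : DEPoly K) : linPart (P + Q) = linPart P + linPart Q := map_add _ _ _

theorem IsLinear.linPart_eq {P : DEPoly K} (h : IsLinear e P) : linPart P = P := by
  refine ext_op fun o => ?_
  rw [coeff_linPart]
  split_ifs with h1
  · rfl
  · by_contra hc
    refine h1 ?_
    rw [opDeg, ← degree_opExp, Finsupp.degree_eq_weight_one]
    exact h.1 fun h0 => hc h0.symm

theorem IsLinear.suppIn {P : DEPoly K} (h : IsLinear e P) : SuppIn (partOps e) P := by
  refine suppIn_partOps_of_vars h.2 ?_
  rw [← coeff_opExp_zero, ← h.linPart_eq, coeff_linPart, if_neg]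
  simp [opDeg]

theorem SuppIn.isLinear_linPart {P : DEPoly K} (h : SuppIn (partOps e) P) :
    IsLinear e (linPart P) := by
  refine ⟨homogeneousComponent_isHomogeneous 1 P, SuppIn.vars_partOps fun o ho => ?_⟩
  rw [coeff_linPart] at ho
  split_ifs at ho with h1
  · exact h o ho
  · exact absurd rfl ho

theorem downClosed_opDeg (p : ℕ → Prop) : DownClosed {o | p (opDeg o)} := by
  intro o ho o' hb
  rw [Set.mem_ofPred_eq, opDeg, hb.card_fst, hb.card_snd]
  exact ho

theorem DownClosed.inter {T T' : Set Op} (h : DownClosed T) (h' : DownClosed T') :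
    DownClosed (T ∩ T') := fun o ho o' hb => ⟨h o ho.1 o' hb, h' o ho.2 o' hb⟩

theorem Remainder.spec {T : Set Op} (hT : DownClosed T) {w s : ℕ → ℕ → K} {P R : DEPoly K}
    {ts : List (Term K)} (h : Remainder w s P ts R) (hP : SuppIn T P)
    (h0 : constantCoeff P = 0) : P = linPart P + termsVal ts + R ∧ AllZero R ∧ GoodTerms w s ts ∧
      (∀ t ∈ ts, t.c ≠ 0) ∧ (∀ t ∈ ts, t.lead ∈ T ∧ 2 ≤ opDeg t.lead) ∧
      SuppIn (T ∩ {o | 2 ≤ opDeg o}) R := by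
  obtain ⟨h1, h2, h3, h4⟩ := RemLoop.spec h
  obtain ⟨h5, h6⟩ := RemLoop.suppIn (hT.inter (downClosed_opDeg (2 ≤ ·))) h
    (suppIn_sub_linPart hP h0)
  refine ⟨?_, h2, h3, h4, h5, h6⟩
  rw [add_assoc, ← h1]
  ring

/-! ### Passes over a pure part -/

theorem PartLoop.spec (he : e = Sum.inl ∨ e = Sum.inr) {w s : ℕ → ℕ → ℕ → K} {n : ℕ}
    {P R : DEPoly K} {ps : List (Pass K)} (h : PartLoop e w s n P ps R)
    (hP : SuppIn (partOps e) P) : P = passesVal (e 0) ps R ∧ GoodPasses e w s n ps R ∧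
      ReducedPasses (e 0) ps R ∧ ps ≠ [] := by
  induction h with
  | halt n P ts R θ P' hrem hfac hvars =>
    obtain ⟨h1, h2, h3, h4, h5, h6⟩ := hrem.spec (downClosed_partOps he) hP
      hP.constantCoeff_partOps
    have hR : X (e 0) ^ θ * P' = R := hfac.1.symm
    have hlin : linPart R = 0 :=
      linPart_eq_zero_iff.2 (h6.mono fun o ho => (show 1 < opDeg o from ho.2).ne')
    refine ⟨?_, ⟨hP.isLinear_linPart, h3, fun t ht => ⟨(h5 t ht).2, (h5 t ht).1.2⟩, ?_, ?_,
      hvars, hfac.2.1⟩, ⟨h4, ?_, fun h => absurd rfl h, trivial⟩, List.cons_ne_nil _ _⟩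
    · rw [passesVal, passesVal, hR]
      exact h1
    · rw [passesVal, hR]
      exact h2
    · rw [passesVal, hR]
      exact hlin
    · rw [passesVal, hR]
      exact hfac
  | next n P ts R θ P' ps R' hrem hfac hvars _ ih =>
    obtain ⟨h1, h2, h3, h4, h5, h6⟩ := hrem.spec (downClosed_partOps he) hP
      hP.constantCoeff_partOps
    have hR : X (e 0) ^ θ * P' = R := hfac.1.symm
    have hlin : linPart R = 0 :=
      linPart_eq_zero_iff.2 (h6.mono fun o ho => (show 1 < opDeg o from ho.2).ne')
    have hP' : SuppIn (partOps e) P' :=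
      SuppIn.partOps_of_X_pow_mul (n := θ) (hR ▸ h6.mono Set.inter_subset_left) hfac.2.1
    obtain ⟨i1, i2, i3, -⟩ := ih hP'
    refine ⟨?_, ⟨hP.isLinear_linPart, h3, fun t ht => ⟨(h5 t ht).2, (h5 t ht).1.2⟩, ?_, ?_,
      i2⟩, ⟨h4, ?_, fun _ => ?_, i3⟩, List.cons_ne_nil _ _⟩
    · rw [passesVal, ← i1, hR]
      exact h1
    · rw [← i1, hR]
      exact h2
    · rw [← i1, hR]
      exact hlin
    · rw [← i1, hR]
      exact hfac
    · rw [← i1]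
      exact hvars

theorem Remainder.unique {w s : ℕ → ℕ → K} {P R R' : DEPoly K} {ts ts' : List (Term K)}
    (h : Remainder w s P ts R) (h' : Remainder w s P ts' R') : ts = ts' ∧ R = R' :=
  RemLoop.unique h h'

theorem PartLoop.unique {w s : ℕ → ℕ → ℕ → K} {n : ℕ} {P R : DEPoly K} {ps : List (Pass K)}
    (h : PartLoop e w s n P ps R) : ∀ {ps₂ : List (Pass K)} {R₂ : DEPoly K},
      PartLoop e w s n P ps₂ R₂ → ps = ps₂ ∧ R = R₂ := by
  induction h with
  | halt n P ts R θ P' hrem hfac hvars =>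
    intro ps₂ R₂ h₂
    cases h₂ with
    | halt _ _ ts₂ _ θ₂ _ hrem₂ hfac₂ =>
      obtain ⟨rfl, rfl⟩ := hrem.unique hrem₂
      obtain ⟨rfl, rfl⟩ := hfac.unique hfac₂
      exact ⟨rfl, rfl⟩
    | next _ _ ts₂ _ θ₂ _ _ _ hrem₂ hfac₂ hvars₂ =>
      obtain ⟨rfl, rfl⟩ := hrem.unique hrem₂
      obtain ⟨rfl, rfl⟩ := hfac.unique hfac₂
      exact absurd hvars hvars₂
  | next n P ts R θ P' ps R' hrem hfac hvars _ ih =>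
    intro ps₂ R₂ h₂
    cases h₂ with
    | halt _ _ ts₂ _ θ₂ _ hrem₂ hfac₂ hvars₂ =>
      obtain ⟨rfl, rfl⟩ := hrem.unique hrem₂
      obtain ⟨rfl, rfl⟩ := hfac.unique hfac₂
      exact absurd hvars₂ hvars
    | next _ _ ts₂ _ θ₂ _ _ _ hrem₂ hfac₂ _ h₂ =>
      obtain ⟨rfl, rfl⟩ := hrem.unique hrem₂
      obtain ⟨rfl, rfl⟩ := hfac.unique hfac₂
      obtain ⟨rfl, rfl⟩ := ih h₂
      exact ⟨rfl, rfl⟩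

theorem zero_var_mem_of_isZeroOp (he : e = Sum.inl ∨ e = Sum.inr) {o : Op} (h : o ∈ partOps e)
    (hz : IsZeroOp o) : e 0 ∈ (opExp o).support := by
  rcases he with rfl | rfl
  · exact inl_mem_support_opExp.2 (hz.1 (mem_partOps_inl.1 h).1)
  · exact inr_mem_support_opExp.2 (hz.2 (mem_partOps_inr.1 h).2)

theorem opDeg_varOp (x : ℕ ⊕ ℕ) : opDeg (varOp x) = 1 := by
  simpa using opDeg_nsmul_varOp 1 x

/-- The loop over a pure part terminates: all the terms of a remainder are non-linear and contain
the variable with delay `0`, so that the degree decreases when a power is factored out. -/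
theorem PartLoop.exists (he : e = Sum.inl ∨ e = Sum.inr) (w s : ℕ → ℕ → ℕ → K) (n : ℕ)
    {P : DEPoly K} (hP : SuppIn (partOps e) P) : ∃ ps R, PartLoop e w s n P ps R := by
  obtain ⟨d, hd⟩ := exists_suppIn_opDeg_le P
  induction d generalizing n P with
  | zero =>
    have h0 : P = 0 := by
      by_contra hne
      obtain ⟨o, ho⟩ := exists_coeff_ne_zero hne
      exact (hP o ho).1 (opDeg_eq_zero (Nat.le_zero.1 (hd o ho)))
    subst h0
    refine ⟨_, _, .halt n 0 [] 0 0 0 ?_ (isMaxFactor_zero _) (by simp)⟩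
    have e0 : (0 : DEPoly K) - linPart 0 = 0 := by simp [linPart]
    rw [Remainder, e0]
    exact .halt 0 0 fun o ho => absurd (coeff_zero _) ho
  | succ d ih =>
    obtain ⟨ts, R, hrem⟩ := RemLoop.exists (w n) (s n) 0 (P - linPart P)
    have hrem : Remainder (w n) (s n) P ts R := hrem
    obtain ⟨-, h2, -, -, -, h6⟩ := hrem.spec
      ((downClosed_partOps he).inter (downClosed_opDeg (· ≤ d + 1)))
      (fun o ho => ⟨hP o ho, hd o ho⟩) hP.constantCoeff_partOps
    have hRp : SuppIn (partOps e) R := h6.mono fun o ho => ho.1.1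
    obtain ⟨θ, P', hfac⟩ := IsMaxFactor.exists (e 0) hRp.constantCoeff_partOps
    by_cases hvars : P'.vars ⊆ {e 0}
    · exact ⟨_, _, .halt n P ts R θ P' hrem hfac hvars⟩
    have hR0 : R ≠ 0 := by
      rintro rfl
      obtain ⟨-, rfl⟩ := hfac.unique (isMaxFactor_zero _)
      exact hvars (by simp)
    have hθ : 0 < θ := hfac.pos hR0
      (fun o ho => zero_var_mem_of_isZeroOp he (hRp o ho) (h2 o ho))
      (h6.coeff_eq_zero fun ho => by
        have h7 : 2 ≤ opDeg (varOp (e 0)) := ho.2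
        rw [opDeg_varOp] at h7
        omega)
    obtain ⟨ps, R', hloop⟩ := ih (n + 1)
      (SuppIn.partOps_of_X_pow_mul (n := θ) (hfac.1 ▸ hRp) hfac.2.1)
      (fun o ho => by
        have h8 := add_opDeg_le_of_eq_X_pow_mul (h6.mono fun o ho => ho.1.2) hfac.1 o ho
        rw [Set.mem_ofPred_eq] at h8 ⊢
        omega)
    exact ⟨_, _, .next n P ts R θ P' ps R' hrem hfac hvars hloop⟩

theorem GoodPasses.suppIn_terms (he : e = Sum.inl ∨ e = Sum.inr) {w s : ℕ → ℕ → K}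
    {ts : List (Term K)} (h : GoodTerms w s ts)
    (h' : ∀ t ∈ ts, 2 ≤ t.I.card + t.J.card ∧ ∀ x ∈ (opExp t.lead).support, x ∈ Set.range e) :
    SuppIn (partOps e ∩ {o | 2 ≤ opDeg o}) (termsVal ts) := by
  refine suppIn_termsVal_of_downClosed
    ((downClosed_partOps he).inter (downClosed_opDeg (2 ≤ ·))) h.isFormed fun t ht => ?_
  have h2 : 2 ≤ opDeg t.lead := (h' t ht).1
  refine ⟨⟨?_, (h' t ht).2⟩, h2⟩
  intro h0
  rw [h0] at h2
  exact absurd h2 (by simp [opDeg])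

theorem GoodPasses.suppIn (he : e = Sum.inl ∨ e = Sum.inr) {w s : ℕ → ℕ → ℕ → K}
    {ps : List (Pass K)} {n : ℕ} {R : DEPoly K} (h : GoodPasses e w s n ps R) :
    SuppIn (partOps e) (passesVal (e 0) ps R) := by
  induction ps generalizing n with
  | nil =>
    refine suppIn_partOps_of_vars (fun x hx => ?_) h.2
    exact ⟨0, (Finset.mem_singleton.1 (h.1 hx)).symm⟩
  | cons p ps ih =>
    obtain ⟨h1, h2, h3, -, -, h6⟩ := h
    exact (h1.suppIn.add ((suppIn_terms he h2 h3).mono Set.inter_subset_left)).add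
      ((ih h6).X_pow_mul fun o ho => nsmul_varOp_add_mem_partOps _ ho)

theorem GoodPasses.linPart_eq (he : e = Sum.inl ∨ e = Sum.inr) {w s : ℕ → ℕ → ℕ → K} {p : Pass K}
    {ps : List (Pass K)} {n : ℕ} {R : DEPoly K} (h : GoodPasses e w s n (p :: ps) R) :
    linPart (passesVal (e 0) (p :: ps) R) = p.lin := by
  obtain ⟨h1, h2, h3, -, h5, -⟩ := h
  have h7 : linPart (termsVal p.terms) = 0 := linPart_eq_zero_iff.2
    ((suppIn_terms he h2 h3).mono fun o ho => (show 1 < opDeg o from ho.2).ne')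
  rw [passesVal, linPart_add, linPart_add, h1.linPart_eq, h5, h7, add_zero, add_zero]

theorem GoodPasses.remainder (he : e = Sum.inl ∨ e = Sum.inr) {w s : ℕ → ℕ → ℕ → K} {p : Pass K}
    {ps : List (Pass K)} {n : ℕ} {R : DEPoly K} (h : GoodPasses e w s n (p :: ps) R)
    (hc : ∀ t ∈ p.terms, t.c ≠ 0) : Remainder (w n) (s n) (passesVal (e 0) (p :: ps) R) p.terms
      (X (e 0) ^ p.exp * passesVal (e 0) ps R) := by
  have hl := h.linPart_eq he
  obtain ⟨-, h2, -, h4, -, -⟩ := h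
  rw [Remainder, hl, passesVal, add_assoc, add_sub_cancel_left]
  exact RemLoop.of_goodTerms h2 h4 hc

/-- Admissible reduced passes are a run of the loop on their value. -/
theorem PartLoop.of_goodPasses (he : e = Sum.inl ∨ e = Sum.inr) {w s : ℕ → ℕ → ℕ → K}
    {ps : List (Pass K)} {n : ℕ} {R : DEPoly K} (hne : ps ≠ []) (h : GoodPasses e w s n ps R)
    (hr : ReducedPasses (e 0) ps R) : PartLoop e w s n (passesVal (e 0) ps R) ps R := by
  induction ps generalizing n with
  | nil => exact absurd rfl hne
  | cons p ps ih =>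
    have hrem := h.remainder he hr.1
    have hp : p = ⟨linPart (passesVal (e 0) (p :: ps) R), p.terms, p.exp⟩ := by
      rw [h.linPart_eq he]
    rcases ps with _ | ⟨q, ps⟩
    · have hl := PartLoop.halt n _ p.terms _ p.exp _ hrem hr.2.1 h.2.2.2.2.2.1
      rwa [← hp] at hl
    · have hl := PartLoop.next n _ p.terms _ p.exp _ (q :: ps) R hrem hr.2.1
        (hr.2.2.1 (List.cons_ne_nil _ _)) (ih (List.cons_ne_nil _ _) h.2.2.2.2.2 hr.2.2.2)
      rwa [← hp] at hl

theorem GoodPasses.eq_of_value_eq (he : e = Sum.inl ∨ e = Sum.inr) {w s : ℕ → ℕ → ℕ → K}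
    {ps : List (Pass K)} {n : ℕ} {ps' : List (Pass K)} {R R' : DEPoly K}
    (h : GoodPasses e w s n ps R) (h' : GoodPasses e w s n ps' R')
    (hs : passesShape ps = passesShape ps')
    (hv : passesVal (e 0) ps R = passesVal (e 0) ps' R') : ps = ps' ∧ R = R' := by
  induction ps generalizing n ps' with
  | nil =>
    obtain rfl : ps' = [] := by simpa [passesShape] using hs.symm
    exact ⟨rfl, hv⟩
  | cons p ps ih =>
    rcases ps' with _ | ⟨p', ps'⟩
    · simp [passesShape] at hs
    simp only [passesShape, List.map_cons, List.cons.injEq, Prod.mk.injEq] at hs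
    obtain ⟨⟨hs1, hs2⟩, hs3⟩ := hs
    have hl : p.lin = p'.lin := by rw [← h.linPart_eq he, hv, h'.linPart_eq he]
    rw [passesVal, passesVal, hl, add_assoc, add_assoc] at hv
    obtain ⟨ht, hR⟩ := h.2.1.eq_of_value_eq h'.2.1 h.2.2.2.1 h'.2.2.2.1 hs1 (add_left_cancel hv)
    rw [hs2] at hR
    obtain ⟨rfl, rfl⟩ := ih h.2.2.2.2.2 h'.2.2.2.2.2 hs3 (X_pow_mul_cancel _ _ hR)
    refine ⟨?_, rfl⟩
    rw [show p = p' by cases p; cases p'; simp_all]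

end Pure

/-! ### The three parts of a polynomial -/

/-- The operators that contain both a δ and an ε. -/
def crossOps : Set Op := {o | o.1 ≠ 0 ∧ o.2 ≠ 0}

theorem downClosed_crossOps : DownClosed crossOps := by
  intro o ho o' hb
  have h1 := hb.card_fst
  have h2 := hb.card_snd
  simp only [crossOps, Set.mem_ofPred_eq, ne_eq, ← Multiset.card_eq_zero] at ho ⊢
  omega

theorem two_le_opDeg_of_mem_crossOps {o : Op} (ho : o ∈ crossOps) : 2 ≤ opDeg o := by
  simp only [crossOps, Set.mem_ofPred_eq, ne_eq, ← Multiset.card_eq_zero] at ho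
  rw [opDeg]
  omega

theorem isCross_iff {P : DEPoly K} : IsCross P ↔ SuppIn crossOps P := by
  constructor
  · rintro ⟨h1, h2⟩ o ho
    refine ⟨fun h => ho ?_, fun h => ho ?_⟩
    · have h3 := coeff_epsPart P o
      rw [if_pos h, h2, coeff_zero] at h3
      exact h3.symm
    · have h3 := coeff_deltaPart P o
      rw [if_pos h, h1, coeff_zero] at h3
      exact h3.symm
  · intro h
    constructor
    · refine ext_op fun o => ?_
      rw [coeff_deltaPart, coeff_zero]
      split_ifs with h0
      · exact h.coeff_eq_zero fun ho => ho.2 h0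
      · rfl
    · refine ext_op fun o => ?_
      rw [coeff_epsPart, coeff_zero]
      split_ifs with h0
      · exact h.coeff_eq_zero fun ho => ho.1 h0
      · rfl

theorem deltaPart_add_epsPart_add_crossPart (P : DEPoly K) :
    deltaPart P + epsPart P + crossPart P = P := by
  rw [crossPart]
  ring

theorem deltaPart_eq {X Y Z : DEPoly K} (hX : SuppIn (partOps Sum.inl) X)
    (hY : SuppIn (partOps Sum.inr) Y) (hZ : SuppIn crossOps Z) : deltaPart (X + Y + Z) = X := by
  refine ext_op fun o => ?_
  rw [coeff_deltaPart, coeff_add, coeff_add]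
  split_ifs with h
  · rw [hY.coeff_eq_zero fun ho => (mem_partOps_inr.1 ho).2 h, hZ.coeff_eq_zero fun ho => ho.2 h,
      add_zero, add_zero]
  · exact (hX.coeff_eq_zero fun ho => h (mem_partOps_inl.1 ho).2).symm

theorem epsPart_eq {X Y Z : DEPoly K} (hX : SuppIn (partOps Sum.inl) X)
    (hY : SuppIn (partOps Sum.inr) Y) (hZ : SuppIn crossOps Z) : epsPart (X + Y + Z) = Y := by
  refine ext_op fun o => ?_
  rw [coeff_epsPart, coeff_add, coeff_add]
  split_ifs with h
  · rw [hX.coeff_eq_zero fun ho => (mem_partOps_inl.1 ho).1 h, hZ.coeff_eq_zero fun ho => ho.1 h,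
      add_zero, zero_add]
  · exact (hY.coeff_eq_zero fun ho => h (mem_partOps_inr.1 ho).1).symm

theorem crossPart_eq {X Y Z : DEPoly K} (hX : SuppIn (partOps Sum.inl) X)
    (hY : SuppIn (partOps Sum.inr) Y) (hZ : SuppIn crossOps Z) : crossPart (X + Y + Z) = Z := by
  rw [crossPart, deltaPart_eq hX hY hZ, epsPart_eq hX hY hZ]
  ring

theorem suppIn_deltaPart {T : Set Op} {A : DEPoly K} (hA : SuppIn T A)
    (h0 : constantCoeff A = 0) : SuppIn (partOps Sum.inl ∩ T) (deltaPart A) := by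
  intro o ho
  rw [coeff_deltaPart] at ho
  split_ifs at ho with h
  · exact ⟨mem_partOps_inl.2 ⟨fun h1 => suppIn_ne_zero_iff.2 h0 o ho (Prod.ext h1 h), h⟩, hA o ho⟩
  · exact absurd rfl ho

theorem suppIn_epsPart {T : Set Op} {A : DEPoly K} (hA : SuppIn T A)
    (h0 : constantCoeff A = 0) : SuppIn (partOps Sum.inr ∩ T) (epsPart A) := by
  intro o ho
  rw [coeff_epsPart] at ho
  split_ifs at ho with h
  · exact ⟨mem_partOps_inr.2 ⟨h, fun h1 => suppIn_ne_zero_iff.2 h0 o ho (Prod.ext h h1)⟩, hA o ho⟩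
  · exact absurd rfl ho

theorem suppIn_crossPart {T : Set Op} {A : DEPoly K} (hA : SuppIn T A)
    (h0 : constantCoeff A = 0) : SuppIn (crossOps ∩ T) (crossPart A) := by
  intro o ho
  rw [crossPart, coeff_sub, coeff_sub, coeff_deltaPart, coeff_epsPart] at ho
  by_cases h1 : o.1 = 0 <;> by_cases h2 : o.2 = 0
  · exfalso
    refine ho ?_
    rw [show o = 0 from Prod.ext h1 h2, coeff_opExp_zero, h0]
    simp
  · simp [h1, h2] at ho
  · simp [h1, h2] at ho
  · rw [if_neg h1, if_neg h2, sub_zero, sub_zero] at ho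
    exact ⟨⟨h1, h2⟩, hA o ho⟩

theorem suppIn_univ (P : DEPoly K) : SuppIn Set.univ P := fun _ _ => trivial

theorem SuppIn.constantCoeff_crossOps {P : DEPoly K} (h : SuppIn crossOps P) :
    constantCoeff P = 0 := suppIn_ne_zero_iff.1 (h.mono fun _ ho h0 => ho.1 (h0 ▸ rfl))

theorem SuppIn.linPart_crossOps {P : DEPoly K} (h : SuppIn crossOps P) : linPart P = 0 :=
  linPart_eq_zero_iff.2 (h.mono fun _ ho h1 => by
    have := two_le_opDeg_of_mem_crossOps ho
    omega)

/-! ### The outer loop -/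

theorem GoodParts.of_loops {w s : ℕ → ℕ → ℕ → ℕ → K} {h : ℕ} {A : DEPoly K}
    (h0 : constantCoeff A = 0) {a : Level K}
    (hd : DeltaLoop w s h (deltaPart A) a.dPasses a.Rd)
    (he : EpsLoop w s h (epsPart A) a.ePasses a.Re) :
    GoodParts w s h a ∧ deltaPart A = passesVal (Sum.inl 0) a.dPasses a.Rd ∧
      epsPart A = passesVal (Sum.inr 0) a.ePasses a.Re ∧
      ReducedPasses (Sum.inl 0) a.dPasses a.Rd ∧ ReducedPasses (Sum.inr 0) a.ePasses a.Re := by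
  obtain ⟨d1, d2, d3, d4⟩ := PartLoop.spec (.inl rfl) hd
    ((suppIn_deltaPart (suppIn_univ A) h0).mono Set.inter_subset_left)
  obtain ⟨e1, e2, e3, e4⟩ := PartLoop.spec (.inr rfl) he
    ((suppIn_epsPart (suppIn_univ A) h0).mono Set.inter_subset_left)
  exact ⟨⟨d4, e4, d2, e2⟩, d1, e1, d3, e3⟩

theorem LevelLoop.spec {w s : ℕ → ℕ → ℕ → ℕ → K} {tie : ℕ → Bool} {h : ℕ} {A : DEPoly K}
    {ls : List (Level K)} {Rde : DEPoly K} (hl : LevelLoop w s tie h A ls Rde)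
    (h0 : constantCoeff A = 0) :
    A = levelsVal ls Rde ∧ GoodLevels w s h ls Rde ∧ ReducedLevels tie h ls Rde := by
  induction hl with
  | halt h A dp Rd ep Re hd he hvars =>
    obtain ⟨g, d1, e1, d3, e3⟩ := GoodParts.of_loops (a := ⟨dp, Rd, ep, Re, [], 0, 0⟩) h0 hd he
    have hc : SuppIn crossOps (crossPart A) :=
      (suppIn_crossPart (suppIn_univ A) h0).mono Set.inter_subset_left
    refine ⟨?_, ⟨g, rfl, rfl, rfl, isCross_iff.2 hc, hvars⟩,
      ⟨d3, e3, by simp, fun h => absurd rfl h, trivial⟩⟩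
    simp only [levelsVal, ← d1, ← e1, termsVal, List.map_nil, List.sum_nil, add_zero, pow_zero,
      one_mul]
    exact (deltaPart_add_epsPart_add_crossPart A).symm
  | next h A dp Rd ep Re ts R κ σ A' ls Rde hd he hvars hrem hfac _ ih =>
    obtain ⟨g, d1, e1, d3, e3⟩ := GoodParts.of_loops (a := ⟨dp, Rd, ep, Re, ts, κ, σ⟩) h0 hd he
    have hc : SuppIn crossOps (crossPart A) :=
      (suppIn_crossPart (suppIn_univ A) h0).mono Set.inter_subset_left
    obtain ⟨r1, r2, r3, r4, r5, r6⟩ := hrem.spec downClosed_crossOps hc hc.constantCoeff_crossOps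
    rw [hc.linPart_crossOps, zero_add] at r1
    obtain ⟨i1, i2, i3⟩ := ih hfac.2.1
    have hR : del 0 ^ κ * eps 0 ^ σ * levelsVal ls Rde = R := by rw [← i1, ← hfac.1]
    refine ⟨?_, ?_, ⟨d3, e3, r4, fun _ => ⟨?_, ?_⟩, i3⟩⟩
    · rw [levelsVal, hR, ← d1, ← e1, add_assoc, ← r1]
      exact (deltaPart_add_epsPart_add_crossPart A).symm
    · rcases ls with _ | ⟨b, ls⟩
      · exact i2.elim
      · refine ⟨g, r3, fun t ht => (r5 t ht).1, ?_, ?_, i2⟩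
        · rw [hR]
          exact isCross_iff.2 (r6.mono Set.inter_subset_left)
        · rw [hR]
          exact r2
    · rw [hR, ← i1]
      exact hfac
    · rw [hR, ← r1]
      exact hvars

theorem LevelLoop.unique {w s : ℕ → ℕ → ℕ → ℕ → K} {tie : ℕ → Bool} {h : ℕ} {A : DEPoly K}
    {ls : List (Level K)} {Rde : DEPoly K} (hl : LevelLoop w s tie h A ls Rde) :
    ∀ {ls₂ : List (Level K)} {Rde₂ : DEPoly K}, LevelLoop w s tie h A ls₂ Rde₂ →
      ls = ls₂ ∧ Rde = Rde₂ := by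
  induction hl with
  | halt h A dp Rd ep Re hd he hvars =>
    intro ls₂ Rde₂ hl₂
    cases hl₂ with
    | halt _ _ dp₂ Rd₂ ep₂ Re₂ hd₂ he₂ _ =>
      obtain ⟨rfl, rfl⟩ := PartLoop.unique hd hd₂
      obtain ⟨rfl, rfl⟩ := PartLoop.unique he he₂
      exact ⟨rfl, rfl⟩
    | next _ _ _ _ _ _ _ _ _ _ _ _ _ _ _ hvars₂ => exact absurd hvars hvars₂
  | next h A dp Rd ep Re ts R κ σ A' ls Rde hd he hvars hrem hfac _ ih =>
    intro ls₂ Rde₂ hl₂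
    cases hl₂ with
    | halt _ _ _ _ _ _ _ _ hvars₂ => exact absurd hvars₂ hvars
    | next _ _ dp₂ Rd₂ ep₂ Re₂ ts₂ R₂ κ₂ σ₂ A₂ ls₂ _ hd₂ he₂ _ hrem₂ hfac₂ hl₂ =>
      obtain ⟨rfl, rfl⟩ := PartLoop.unique hd hd₂
      obtain ⟨rfl, rfl⟩ := PartLoop.unique he he₂
      obtain ⟨rfl, rfl⟩ := hrem.unique hrem₂
      obtain ⟨rfl, rfl, rfl⟩ := hfac.unique hfac₂
      obtain ⟨rfl, rfl⟩ := ih hl₂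
      exact ⟨rfl, rfl⟩

theorem exists_partLoops (w s : ℕ → ℕ → ℕ → ℕ → K) (h : ℕ) {A : DEPoly K}
    (h0 : constantCoeff A = 0) : (∃ dp Rd, DeltaLoop w s h (deltaPart A) dp Rd) ∧
      ∃ ep Re, EpsLoop w s h (epsPart A) ep Re :=
  ⟨PartLoop.exists (.inl rfl) _ _ _
      ((suppIn_deltaPart (suppIn_univ A) h0).mono Set.inter_subset_left),
    PartLoop.exists (.inr rfl) _ _ _
      ((suppIn_epsPart (suppIn_univ A) h0).mono Set.inter_subset_left)⟩

/-- The outer loop terminates: all the terms of a remainder contain `δ_0` and `ε_0`, so that the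
degree decreases from level to level, except for a last level with the zero polynomial. -/
theorem LevelLoop.exists (w s : ℕ → ℕ → ℕ → ℕ → K) (tie : ℕ → Bool) (h : ℕ) {A : DEPoly K}
    (h0 : constantCoeff A = 0) : ∃ ls Rde, LevelLoop w s tie h A ls Rde := by
  have halts : ∀ h, ∀ A : DEPoly K, constantCoeff A = 0 →
      (crossPart A).vars ⊆ {Sum.inl 0, Sum.inr 0} → ∃ ls Rde, LevelLoop w s tie h A ls Rde := by
    intro h A h0 hvars
    obtain ⟨⟨dp, Rd, hd⟩, ep, Re, he⟩ := exists_partLoops w s h h0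
    exact ⟨_, _, .halt h A dp Rd ep Re hd he hvars⟩
  have zero : ∀ h, ∃ ls Rde, LevelLoop w s tie h (0 : DEPoly K) ls Rde := fun h =>
    halts h 0 (map_zero _) (by simp [crossPart, deltaPart, epsPart])
  obtain ⟨d, hd⟩ := exists_suppIn_opDeg_le A
  induction d generalizing h A with
  | zero =>
    have hA : A = 0 := by
      by_contra hne
      obtain ⟨o, ho⟩ := exists_coeff_ne_zero hne
      exact suppIn_ne_zero_iff.2 h0 o ho (opDeg_eq_zero (Nat.le_zero.1 (hd o ho)))
    rw [hA]
    exact zero h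
  | succ d ih =>
    by_cases hvars : (crossPart A).vars ⊆ {Sum.inl 0, Sum.inr 0}
    · exact halts h A h0 hvars
    obtain ⟨⟨dp, Rd, hdl⟩, ep, Re, hel⟩ := exists_partLoops w s h h0
    have hc := suppIn_crossPart hd h0
    obtain ⟨ts, R, hrem⟩ := RemLoop.exists (fun l => w l 0 h) (fun l => s l 0 h) 0
      (crossPart A - linPart (crossPart A))
    have hrem : Remainder (fun l => w l 0 h) (fun l => s l 0 h) (crossPart A) ts R := hrem
    obtain ⟨-, r2, -, -, -, r6⟩ := hrem.spec
      (downClosed_crossOps.inter (downClosed_opDeg (· ≤ d + 1))) hc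
      (hc.mono Set.inter_subset_left).constantCoeff_crossOps
    have hRc : SuppIn crossOps R := r6.mono fun o ho => ho.1.1
    obtain ⟨κ, σ, A', hfac⟩ := IsMaxFactor₂.exists (tie h) hRc.constantCoeff_crossOps
    have hA' : ∃ ls Rde, LevelLoop w s tie (h + 1) A' ls Rde := by
      by_cases hR : R = 0
      · have e : A' = 0 := by
          refine factor₂_cancel (κ := κ) (σ := σ) ?_
          rw [← hfac.1, hR, mul_zero]
        rw [e]
        exact zero (h + 1)
      · have hpos := hfac.pos hR fun o ho =>
          ⟨(r2 o ho).1 (hRc o ho).1, (r2 o ho).2 (hRc o ho).2⟩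
        refine ih (h + 1) hfac.2.1 ?_
        have k1 := add_opDeg_le_of_eq_X_pow_mul (r6.mono fun o ho => ho.1.2)
          (hfac.1.trans (factor₂_eq κ σ A'))
        intro o ho
        have k2 := k1 (σ • varOp (Sum.inr 0) + o) (by rwa [coeff_X_pow_mul_varOp])
        rw [Set.mem_ofPred_eq, opDeg_add, opDeg_nsmul_varOp] at k2
        rw [Set.mem_ofPred_eq]
        omega
    obtain ⟨ls, Rde, hl⟩ := hA'
    exact ⟨_, _, .next h A dp Rd ep Re ts R κ σ A' ls Rde hdl hel hvars hrem hfac hl⟩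

/-! ### Expansions -/

theorem GoodLevels.ne_nil {w s : ℕ → ℕ → ℕ → ℕ → K} {h : ℕ} {ls : List (Level K)} {R : DEPoly K}
    (hg : GoodLevels w s h ls R) : ls ≠ [] := by
  rintro rfl
  exact hg

theorem GoodParts.suppIn_inl {w s : ℕ → ℕ → ℕ → ℕ → K} {h : ℕ} {a : Level K}
    (g : GoodParts w s h a) :
    SuppIn (partOps Sum.inl) (passesVal (Sum.inl 0) a.dPasses a.Rd) :=
  GoodPasses.suppIn (.inl rfl) g.2.2.1

theorem GoodParts.suppIn_inr {w s : ℕ → ℕ → ℕ → ℕ → K} {h : ℕ} {a : Level K}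
    (g : GoodParts w s h a) :
    SuppIn (partOps Sum.inr) (passesVal (Sum.inr 0) a.ePasses a.Re) :=
  GoodPasses.suppIn (.inr rfl) g.2.2.2

/-- The three summands of which a good expression consists at its first level are the pure parts
and the δε-part of its value. -/
theorem GoodLevels.head {w s : ℕ → ℕ → ℕ → ℕ → K} {h : ℕ} {a : Level K} {ls : List (Level K)}
    {R : DEPoly K} (hg : GoodLevels w s h (a :: ls) R) : GoodParts w s h a ∧
      GoodTerms (fun l => w l 0 h) (fun l => s l 0 h) a.cross ∧
      (∀ t ∈ a.cross, t.lead ∈ crossOps) ∧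
      SuppIn crossOps (termsVal a.cross + del 0 ^ a.kap * eps 0 ^ a.sig * levelsVal ls R) := by
  rcases ls with _ | ⟨b, ls⟩
  · obtain ⟨g, h1, h2, h3, h4, -⟩ := hg
    rw [h1, h2, h3]
    refine ⟨g, goodTerms_nil _ _, by simp, ?_⟩
    simpa [termsVal, levelsVal] using isCross_iff.1 h4
  · obtain ⟨g, h1, h2, h3, -, -⟩ := hg
    exact ⟨g, h1, h2,
      (suppIn_termsVal_of_downClosed downClosed_crossOps h1.isFormed h2).add (isCross_iff.1 h3)⟩

theorem levelsVal_cons (a : Level K) (ls : List (Level K)) (R : DEPoly K) :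
    levelsVal (a :: ls) R = passesVal (Sum.inl 0) a.dPasses a.Rd +
      passesVal (Sum.inr 0) a.ePasses a.Re +
      (termsVal a.cross + del 0 ^ a.kap * eps 0 ^ a.sig * levelsVal ls R) := by
  rw [levelsVal, add_assoc _ (termsVal a.cross)]

theorem GoodLevels.parts {w s : ℕ → ℕ → ℕ → ℕ → K} {h : ℕ} {a : Level K} {ls : List (Level K)}
    {R : DEPoly K} (hg : GoodLevels w s h (a :: ls) R) :
    deltaPart (levelsVal (a :: ls) R) = passesVal (Sum.inl 0) a.dPasses a.Rd ∧
    epsPart (levelsVal (a :: ls) R) = passesVal (Sum.inr 0) a.ePasses a.Re ∧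
    crossPart (levelsVal (a :: ls) R) =
      termsVal a.cross + del 0 ^ a.kap * eps 0 ^ a.sig * levelsVal ls R := by
  obtain ⟨g, -, -, hc⟩ := hg.head
  rw [levelsVal_cons]
  exact ⟨deltaPart_eq g.suppIn_inl g.suppIn_inr hc, epsPart_eq g.suppIn_inl g.suppIn_inr hc,
    crossPart_eq g.suppIn_inl g.suppIn_inr hc⟩

/-- An admissible reduced expression is a run of the algorithm on its value. -/
theorem LevelLoop.of_goodLevels {w s : ℕ → ℕ → ℕ → ℕ → K} {tie : ℕ → Bool} {ls : List (Level K)}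
    {h : ℕ} {R : DEPoly K} (hg : GoodLevels w s h ls R) (hr : ReducedLevels tie h ls R) :
    LevelLoop w s tie h (levelsVal ls R) ls R := by
  induction ls generalizing h with
  | nil => exact hg.elim
  | cons a ls ih =>
    obtain ⟨p1, p2, p3⟩ := hg.parts
    obtain ⟨g, -, -, hc⟩ := hg.head
    obtain ⟨r1, r2, r3, r4, r5⟩ := hr
    have hd : DeltaLoop w s h (deltaPart (levelsVal (a :: ls) R)) a.dPasses a.Rd := by
      rw [p1]
      exact PartLoop.of_goodPasses (.inl rfl) g.1 g.2.2.1 r1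
    have he : EpsLoop w s h (epsPart (levelsVal (a :: ls) R)) a.ePasses a.Re := by
      rw [p2]
      exact PartLoop.of_goodPasses (.inr rfl) g.2.1 g.2.2.2 r2
    rcases ls with _ | ⟨b, ls⟩
    · obtain ⟨-, h1, h2, h3, -, h5⟩ := hg
      obtain ⟨dp, Rd, ep, Re, ts, κ, σ⟩ := a
      subst h1 h2 h3
      have e : crossPart (levelsVal [⟨dp, Rd, ep, Re, [], 0, 0⟩] R) = R := by
        rw [p3]
        simp [termsVal, levelsVal]
      have hl := LevelLoop.halt (tie := tie) h _ dp Rd ep Re hd he (by rw [e]; exact h5)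
      rwa [e] at hl
    · obtain ⟨-, h1, -, -, h4, h5⟩ := hg
      obtain ⟨m1, m2⟩ := r4 (List.cons_ne_nil _ _)
      refine LevelLoop.next h _ a.dPasses a.Rd a.ePasses a.Re a.cross _ a.kap a.sig _ (b :: ls) R
        hd he (by rw [p3]; exact m2) ?_ m1 (ih h5 r5)
      rw [Remainder, p3, hc.linPart_crossOps, sub_zero]
      exact RemLoop.of_goodTerms h1 h4 r3

/-- The shape of a list of levels. -/
def levelsShape (ls : List (Level K)) :
    List (List (List Op × ℕ) × List (List Op × ℕ) × List Op × ℕ × ℕ) :=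
  ls.map fun a =>
    (passesShape a.dPasses, passesShape a.ePasses, a.cross.map Term.lead, a.kap, a.sig)

/-- An expansion is determined by its value and its shape. -/
theorem GoodLevels.eq_of_value_eq {w s : ℕ → ℕ → ℕ → ℕ → K} {ls : List (Level K)} {h : ℕ}
    {ls' : List (Level K)} {R R' : DEPoly K} (hg : GoodLevels w s h ls R)
    (hg' : GoodLevels w s h ls' R') (hs : levelsShape ls = levelsShape ls')
    (hv : levelsVal ls R = levelsVal ls' R') : ls = ls' ∧ R = R' := by
  induction ls generalizing h ls' with
  | nil => exact hg.elim
  | cons a ls ih =>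
    rcases ls' with _ | ⟨a', ls'⟩
    · exact hg'.elim
    simp only [levelsShape, List.map_cons, List.cons.injEq, Prod.mk.injEq] at hs
    obtain ⟨⟨s1, s2, s3, s4, s5⟩, s6⟩ := hs
    obtain ⟨p1, p2, p3⟩ := hg.parts
    obtain ⟨p1', p2', p3'⟩ := hg'.parts
    obtain ⟨g, t1, -⟩ := hg.head
    obtain ⟨g', t1', -⟩ := hg'.head
    have e1 := GoodPasses.eq_of_value_eq (.inl rfl) g.2.2.1 g'.2.2.1 s1 (by rw [← p1, ← p1', hv])
    have e2 := GoodPasses.eq_of_value_eq (.inr rfl) g.2.2.2 g'.2.2.2 s2 (by rw [← p2, ← p2', hv])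
    have e3 : termsVal a.cross + del 0 ^ a.kap * eps 0 ^ a.sig * levelsVal ls R =
        termsVal a'.cross + del 0 ^ a'.kap * eps 0 ^ a'.sig * levelsVal ls' R' := by
      rw [← p3, ← p3', hv]
    have hlen : ls.length = ls'.length := by simpa using congrArg List.length s6
    have key : a.cross = a'.cross ∧ ls = ls' ∧ R = R' := by
      rcases ls with _ | ⟨b, ls⟩
      · obtain rfl : ls' = [] := List.length_eq_zero_iff.1 hlen.symm
        obtain ⟨-, h1, h2, h3, -⟩ := hg
        obtain ⟨-, h1', h2', h3', -⟩ := hg'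
        rw [h1, h2, h3, h1', h2', h3'] at e3
        exact ⟨h1.trans h1'.symm, rfl, factor₂_cancel (add_left_cancel e3)⟩
      · rcases ls' with _ | ⟨b', ls'⟩
        · simp at hlen
        obtain ⟨k1, k2⟩ := t1.eq_of_value_eq t1' hg.2.2.2.2.1 hg'.2.2.2.2.1 s3 e3
        rw [s4, s5] at k2
        exact ⟨k1, ih hg.2.2.2.2.2 hg'.2.2.2.2.2 s6 (factor₂_cancel k2)⟩
    obtain ⟨k1, rfl, rfl⟩ := key
    refine ⟨?_, rfl⟩
    rw [show a = a' by cases a; cases a'; simp_all]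

/-! ### The expression as a quadruple sum -/

theorem sum_range_getD {α : Type*} {M : Type*} [AddCommMonoid M] (ls : List α) (d : α)
    (f : α → M) : ∑ i ∈ Finset.range ls.length, f (ls.getD i d) = (ls.map f).sum := by
  induction ls with
  | nil => rfl
  | cons a ls ih =>
    rw [List.length_cons, Finset.sum_range_succ', List.map_cons, List.sum_cons, ← ih, add_comm]
    rfl

theorem getD_mem {α : Type*} {ls : List α} {i : ℕ} (h : i < ls.length) (d : α) :
    ls.getD i d ∈ ls := by
  rw [List.getD_eq_getElem _ _ h]
  exact List.getElem_mem h

/-- The nested sum of the passes, expanded: pass `i` is multiplied by everything that has been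
factored out before it. -/
theorem passesVal_eq_sum (x : ℕ ⊕ ℕ) (ps : List (Pass K)) (R : DEPoly K) (d : Pass K) :
    passesVal x ps R = (∑ i ∈ Finset.range ps.length, X x ^ ((ps.take i).map Pass.exp).sum *
      ((ps.getD i d).lin + termsVal (ps.getD i d).terms)) + X x ^ (ps.map Pass.exp).sum * R := by
  induction ps with
  | nil => simp [passesVal]
  | cons p ps ih =>
    rw [passesVal, ih, List.length_cons, Finset.sum_range_succ', mul_add, Finset.mul_sum]
    simp only [List.take_succ_cons, List.map_cons, List.sum_cons, List.getD_cons_succ, pow_add,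
      List.take_zero, List.map_nil, List.sum_nil, pow_zero, one_mul, List.getD_cons_zero, mul_assoc]
    ring

theorem factor₂_mul (a b a' b' : ℕ) (P : DEPoly K) :
    del 0 ^ a * eps 0 ^ b * (del 0 ^ a' * eps 0 ^ b' * P) =
      del 0 ^ a * del 0 ^ a' * (eps 0 ^ b * eps 0 ^ b') * P := by
  ring

theorem levelsVal_eq_sum (ls : List (Level K)) (R : DEPoly K) (d : Level K) :
    levelsVal ls R = (∑ h ∈ Finset.range ls.length,
      del 0 ^ ((ls.take h).map Level.kap).sum * eps 0 ^ ((ls.take h).map Level.sig).sum *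
        (passesVal (Sum.inl 0) (ls.getD h d).dPasses (ls.getD h d).Rd +
          passesVal (Sum.inr 0) (ls.getD h d).ePasses (ls.getD h d).Re +
          termsVal (ls.getD h d).cross)) +
      del 0 ^ (ls.map Level.kap).sum * eps 0 ^ (ls.map Level.sig).sum * R := by
  induction ls with
  | nil => simp [levelsVal]
  | cons a ls ih =>
    rw [levelsVal, ih, List.length_cons, Finset.sum_range_succ', mul_add, Finset.mul_sum]
    simp only [List.take_succ_cons, List.map_cons, List.sum_cons, List.getD_cons_succ, pow_add,
      List.take_zero, List.map_nil, List.sum_nil, pow_zero, one_mul, List.getD_cons_zero]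
    rw [Finset.sum_congr rfl fun h _ => factor₂_mul _ _ _ _ _, factor₂_mul]
    ring

theorem shift_zero (P : DEPoly K) : shift 0 P = P := by
  have h : (Sum.map (· + 0) (· + 0) : ℕ ⊕ ℕ → ℕ ⊕ ℕ) = id := by
    funext x
    rcases x with a | a <;> rfl
  rw [shift, h, rename_id]
  rfl

theorem GoodPasses.pass {e : ℕ → ℕ ⊕ ℕ} {w s : ℕ → ℕ → ℕ → K} {ps : List (Pass K)} {n : ℕ}
    {R : DEPoly K} (h : GoodPasses e w s n ps R) {i : ℕ} (hi : i < ps.length) (d : Pass K) :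
    IsLinear e (ps.getD i d).lin ∧ GoodTerms (w (n + i)) (s (n + i)) (ps.getD i d).terms ∧
      ∀ t ∈ (ps.getD i d).terms, t.lead ∈ partOps e := by
  induction ps generalizing n i with
  | nil => exact absurd hi (Nat.not_lt_zero i)
  | cons p ps ih =>
    rcases i with _ | i
    · refine ⟨h.1, h.2.1, fun t ht => ⟨fun h0 => ?_, (h.2.2.1 t ht).2⟩⟩
      have h2 : 2 ≤ opDeg t.lead := (h.2.2.1 t ht).1
      rw [h0] at h2
      exact absurd h2 (by simp [opDeg])
    · rw [List.getD_cons_succ, ← add_assoc, add_right_comm]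
      exact ih h.2.2.2.2.2 (Nat.lt_of_succ_lt_succ hi)

theorem GoodPasses.vars {e : ℕ → ℕ ⊕ ℕ} {w s : ℕ → ℕ → ℕ → K} {ps : List (Pass K)} {n : ℕ}
    {R : DEPoly K} (h : GoodPasses e w s n ps R) : R.vars ⊆ {e 0} := by
  induction ps generalizing n with
  | nil => exact h.1
  | cons p ps ih => exact ih h.2.2.2.2.2

theorem GoodLevels.level {w s : ℕ → ℕ → ℕ → ℕ → K} {ls : List (Level K)} {n : ℕ} {R : DEPoly K}
    (hg : GoodLevels w s n ls R) {h : ℕ} (hh : h < ls.length) (d : Level K) :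
    GoodParts w s (n + h) (ls.getD h d) ∧
      GoodTerms (fun l => w l 0 (n + h)) (fun l => s l 0 (n + h)) (ls.getD h d).cross ∧
      ∀ t ∈ (ls.getD h d).cross, t.lead ∈ crossOps := by
  induction ls generalizing n h with
  | nil => exact hg.elim
  | cons a ls ih =>
    rcases h with _ | h
    · obtain ⟨h1, h2, h3, -⟩ := hg.head
      exact ⟨h1, h2, h3⟩
    · rw [List.getD_cons_succ, ← add_assoc, add_right_comm]
      rcases ls with _ | ⟨b, ls⟩
      · exact absurd hh (by simp)
      · exact ih hg.2.2.2.2.2 (Nat.lt_of_succ_lt_succ hh)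

theorem GoodLevels.vars {w s : ℕ → ℕ → ℕ → ℕ → K} {ls : List (Level K)} {n : ℕ} {R : DEPoly K}
    (hg : GoodLevels w s n ls R) : R.vars ⊆ {Sum.inl 0, Sum.inr 0} := by
  induction ls generalizing n with
  | nil => exact hg.elim
  | cons a ls ih =>
    rcases ls with _ | ⟨b, ls⟩
    · exact hg.2.2.2.2.2
    · exact ih hg.2.2.2.2.2

/-- The last level factors out nothing. -/
theorem GoodLevels.sum_take {w s : ℕ → ℕ → ℕ → ℕ → K} {ls : List (Level K)} {n : ℕ} {R : DEPoly K}
    (hg : GoodLevels w s n ls R) :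
    ((ls.take (ls.length - 1)).map Level.kap).sum = (ls.map Level.kap).sum ∧
      ((ls.take (ls.length - 1)).map Level.sig).sum = (ls.map Level.sig).sum := by
  induction ls generalizing n with
  | nil => exact hg.elim
  | cons a ls ih =>
    rcases ls with _ | ⟨b, ls⟩
    · simp [hg.2.2.1, hg.2.2.2.1]
    · have h := ih hg.2.2.2.2.2
      simp only [List.length_cons, Nat.add_sub_cancel, List.take_succ_cons, List.map_cons,
        List.sum_cons] at h ⊢
      omega

namespace Output

variable (O : Output K)

theorem term_mem {l u om h : ℕ} (h1 : 1 ≤ l) (hl : l ≤ O.v u om h) :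
    O.term l u om h ∈ O.terms u om h := getD_mem (by unfold v at hl; omega) _

theorem v_eq_zero {u om h : ℕ} (hu : u ≠ 0) (hom : om ≠ 0) : O.v u om h = 0 := by
  rw [v, terms, if_neg hu, if_neg hom]
  rfl

variable {O} {w s : ℕ → ℕ → ℕ → ℕ → K}

theorem hStar_add_one (hg : GoodLevels w s 0 O.levels O.Rde) : O.hStar + 1 = O.levels.length := by
  have := List.length_pos_of_ne_nil hg.ne_nil
  rw [hStar]
  omega

theorem good_level (hg : GoodLevels w s 0 O.levels O.Rde) {h : ℕ} (hh : h ≤ O.hStar) :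
    GoodParts w s h (O.level h) ∧
      GoodTerms (fun l => w l 0 h) (fun l => s l 0 h) (O.terms 0 0 h) ∧
      ∀ t ∈ O.terms 0 0 h, t.lead ∈ crossOps := by
  have h1 := hg.level (h := h) (by rw [← hStar_add_one hg]; omega) ⟨[], 0, [], 0, [], 0, 0⟩
  rw [zero_add] at h1
  exact h1

theorem good_dPass (hg : GoodLevels w s 0 O.levels O.Rde) {h u : ℕ} (hh : h ≤ O.hStar)
    (hu : 1 ≤ u) (hu' : u ≤ O.uStar h) : IsLinear Sum.inl (O.dPass u h).lin ∧
      GoodTerms (fun l => w l u h) (fun l => s l 0 h) (O.terms u 0 h) ∧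
      ∀ t ∈ O.terms u 0 h, t.lead ∈ partOps Sum.inl := by
  have h1 := (good_level hg hh).1.2.2.1.pass (i := u - 1) (by unfold uStar at hu'; omega)
    ⟨0, [], 0⟩
  rw [terms, if_neg (by omega), if_pos rfl]
  simp only [Nat.add_sub_cancel' hu] at h1
  exact h1

theorem good_ePass (hg : GoodLevels w s 0 O.levels O.Rde) {h om : ℕ} (hh : h ≤ O.hStar)
    (hom : 1 ≤ om) (hom' : om ≤ O.omStar h) : IsLinear Sum.inr (O.ePass om h).lin ∧
      GoodTerms (fun l => w l 0 h) (fun l => s l om h) (O.terms 0 om h) ∧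
      ∀ t ∈ O.terms 0 om h, t.lead ∈ partOps Sum.inr := by
  have h1 := (good_level hg hh).1.2.2.2.pass (i := om - 1) (by unfold omStar at hom'; omega)
    ⟨0, [], 0⟩
  rw [terms, if_pos rfl, if_neg (by omega)]
  simp only [Nat.add_sub_cancel' hom] at h1
  exact h1

theorem summand_of_c_eq_zero {l u om h : ℕ} (hc : O.c l u om h = 0) :
    O.summand l u om h = 0 := by
  rw [summand, hc, starProd_monomial]
  simp

theorem summand_zero_delta {u h : ℕ} (hu : u ≠ 0) :
    O.summand 0 u 0 h = O.prefactor u 0 h * (O.dPass u h).lin := by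
  simp [summand, starProd_monomial, iIdx, jIdx, c, L, hu, shift_zero]

theorem summand_zero_eps {om h : ℕ} (hom : om ≠ 0) :
    O.summand 0 0 om h = O.prefactor 0 om h * (O.ePass om h).lin := by
  simp [summand, starProd_monomial, iIdx, jIdx, c, M, hom, shift_zero]

/-- A factor that stands after an empty operator part does not matter. -/
theorem summand_succ {l u om h : ℕ} (h1 : om = 0 ∨ (O.term (l + 1) u om h).I = 0)
    (h2 : u = 0 ∨ (O.term (l + 1) u om h).J = 0) :
    O.summand (l + 1) u om h = O.prefactor u om h * (O.term (l + 1) u om h).value := by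
  rw [summand, Term.value, starProd_monomial, starProd_monomial]
  have e1 : (O.iIdx (l + 1) u om h).map (fun a => shift a (O.L (l + 1) u h)) =
      (O.term (l + 1) u om h).op.1.map fun a => shift a (O.term (l + 1) u om h).L := by
    rcases h1 with rfl | h1
    · rfl
    · simp [iIdx, Term.op, h1, normIdx]
  have e2 : (O.jIdx (l + 1) u om h).map (fun a => shift a (O.M (l + 1) om h)) =
      (O.term (l + 1) u om h).op.2.map fun a => shift a (O.term (l + 1) u om h).M := by
    rcases h2 with rfl | h2
    · rfl
    · simp [jIdx, Term.op, h2, normIdx]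
  have e3 : O.c (l + 1) u om h = (O.term (l + 1) u om h).c := rfl
  simp only [e1, e2, e3]

theorem sum_summand {u om h : ℕ}
    (hI : ∀ t ∈ O.terms u om h, (om = 0 ∨ t.I = 0) ∧ (u = 0 ∨ t.J = 0)) :
    ∑ l ∈ Finset.range (O.v u om h + 1), O.summand l u om h =
      O.summand 0 u om h + O.prefactor u om h * termsVal (O.terms u om h) := by
  rw [Finset.sum_range_succ', add_comm, termsVal, ← sum_range_getD _ ⟨0, 0, 0, 1, 1⟩,
    Finset.mul_sum]
  refine congrArg₂ (· + ·) rfl (Finset.sum_congr (by rfl) fun l hl => ?_)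
  have hm := O.term_mem (l := l + 1) (u := u) (om := om) (h := h) (by omega)
    (Finset.mem_range.1 hl)
  rw [summand_succ (hI _ hm).1 (hI _ hm).2, show O.term (l + 1) u om h =
    (O.terms u om h).getD l ⟨0, 0, 0, 1, 1⟩ from rfl]

theorem prefactor_delta (i h : ℕ) : O.prefactor (i + 1) 0 h = O.prefactor 0 0 h *
    X (Sum.inl 0) ^ (((O.level h).dPasses.take i).map Pass.exp).sum := by
  rw [prefactor, prefactor, kappa, kappa, if_neg (Nat.succ_ne_zero i), if_pos rfl,
    if_neg (Nat.succ_ne_zero i), if_pos rfl, if_pos rfl, pow_add, add_zero, mul_right_comm]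
  rfl

theorem prefactor_eps (i h : ℕ) : O.prefactor 0 (i + 1) h = O.prefactor 0 0 h *
    X (Sum.inr 0) ^ (((O.level h).ePasses.take i).map Pass.exp).sum := by
  rw [prefactor, prefactor, sigma, sigma, if_neg (Nat.succ_ne_zero i), if_pos rfl,
    if_neg (Nat.succ_ne_zero i), if_pos rfl, if_pos rfl, add_zero, add_zero, pow_add, ← mul_assoc]
  rfl

/-- The part of the expression that belongs to level `h`. -/
theorem level_sum (hg : GoodLevels w s 0 O.levels O.Rde) {h : ℕ} (hh : h ≤ O.hStar) :
    (∑ om ∈ Finset.range (O.omStar h + 1), ∑ u ∈ Finset.range (O.uStar h + 1),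
      ∑ l ∈ Finset.range (O.v u om h + 1), O.summand l u om h) +
      O.prefactor (O.uStar h + 1) 0 h * (O.level h).Rd +
      O.prefactor 0 (O.omStar h + 1) h * (O.level h).Re =
    O.prefactor 0 0 h * (passesVal (Sum.inl 0) (O.level h).dPasses (O.level h).Rd +
      passesVal (Sum.inr 0) (O.level h).ePasses (O.level h).Re + termsVal (O.level h).cross) := by
  have h00 : ∑ l ∈ Finset.range (O.v 0 0 h + 1), O.summand l 0 0 h =
      O.prefactor 0 0 h * termsVal (O.level h).cross := by
    rw [sum_summand fun t _ => ⟨.inl rfl, .inl rfl⟩, summand_of_c_eq_zero (by simp [c]), zero_add]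
    rfl
  have hd : ∀ i ∈ Finset.range (O.uStar h),
      ∑ l ∈ Finset.range (O.v (i + 1) 0 h + 1), O.summand l (i + 1) 0 h =
        O.prefactor 0 0 h * (X (Sum.inl 0) ^ (((O.level h).dPasses.take i).map Pass.exp).sum *
          (((O.level h).dPasses.getD i ⟨0, [], 0⟩).lin +
            termsVal ((O.level h).dPasses.getD i ⟨0, [], 0⟩).terms)) := by
    intro i hi
    have hi' := Finset.mem_range.1 hi
    obtain ⟨-, -, h3⟩ := good_dPass (u := i + 1) hg hh (by omega) (by omega)
    rw [sum_summand fun t ht => ⟨.inl rfl, .inr (mem_partOps_inl.1 (h3 t ht)).2⟩,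
      summand_zero_delta (by omega), ← mul_add, prefactor_delta, mul_assoc]
    rfl
  have he : ∀ i ∈ Finset.range (O.omStar h),
      ∑ l ∈ Finset.range (O.v 0 (i + 1) h + 1), O.summand l 0 (i + 1) h =
        O.prefactor 0 0 h * (X (Sum.inr 0) ^ (((O.level h).ePasses.take i).map Pass.exp).sum *
          (((O.level h).ePasses.getD i ⟨0, [], 0⟩).lin +
            termsVal ((O.level h).ePasses.getD i ⟨0, [], 0⟩).terms)) := by
    intro i hi
    have hi' := Finset.mem_range.1 hi
    obtain ⟨-, -, h3⟩ := good_ePass (om := i + 1) hg hh (by omega) (by omega)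
    rw [sum_summand fun t ht => ⟨.inr (mem_partOps_inr.1 (h3 t ht)).1, .inl rfl⟩,
      summand_zero_eps (by omega), ← mul_add, prefactor_eps, mul_assoc]
    rfl
  -- blocks with `u ≥ 1` and `ω ≥ 1` are empty
  have hde : ∀ om ∈ Finset.range (O.omStar h), ∑ u ∈ Finset.range (O.uStar h),
      ∑ l ∈ Finset.range (O.v (u + 1) (om + 1) h + 1), O.summand l (u + 1) (om + 1) h = 0 := by
    intro om _
    refine Finset.sum_eq_zero fun u _ => Finset.sum_eq_zero fun l hl => ?_
    rw [O.v_eq_zero (by omega) (by omega), Finset.mem_range] at hl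
    obtain rfl : l = 0 := by omega
    exact summand_of_c_eq_zero (by simp [c])
  rw [Finset.sum_range_succ', Finset.sum_congr rfl fun om _ => Finset.sum_range_succ' _ _,
    Finset.sum_add_distrib, Finset.sum_eq_zero hde, zero_add, Finset.sum_range_succ' _ (O.uStar h),
    h00, Finset.sum_congr rfl hd, Finset.sum_congr rfl he, ← Finset.mul_sum, ← Finset.mul_sum,
    passesVal_eq_sum (Sum.inl 0) _ _ ⟨0, [], 0⟩, passesVal_eq_sum (Sum.inr 0) _ _ ⟨0, [], 0⟩,
    prefactor_delta, prefactor_eps, uStar, omStar, List.take_length, List.take_length]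
  ring

theorem expr_eq (hg : GoodLevels w s 0 O.levels O.Rde) :
    O.expr = levelsVal O.levels O.Rde := by
  have h1 : O.expr = (∑ h ∈ Finset.range (O.hStar + 1), O.prefactor 0 0 h *
      (passesVal (Sum.inl 0) (O.level h).dPasses (O.level h).Rd +
        passesVal (Sum.inr 0) (O.level h).ePasses (O.level h).Re +
        termsVal (O.level h).cross)) + O.remDE := by
    rw [expr, remD, remE, ← Finset.sum_add_distrib, ← Finset.sum_add_distrib]
    congr 1
    exact Finset.sum_congr rfl fun h hh => level_sum hg (Nat.lt_succ_iff.1 (Finset.mem_range.1 hh))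
  rw [h1, levelsVal_eq_sum _ _ ⟨[], 0, [], 0, [], 0, 0⟩, hStar_add_one hg, remDE, hStar]
  simp only [prefactor, kappa, sigma, if_true, add_zero, hg.sum_take.1, hg.sum_take.2]
  rfl

end Output

/-! ### Change of coefficients -/

section Map

variable {K' : Type u2} [CommRing K'] (f : K →+* K')

theorem map_formalLin (e : ℕ → ℕ ⊕ ℕ) (w : ℕ → K) (p : ℕ) :
    map f (formalLin e w p) = formalLin e (fun k => f (w k)) p := by
  simp [formalLin]

theorem mapCoeff_mkTerm (w s : ℕ → K) (c : K) (o : Op) :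
    (mkTerm w s c o).mapCoeff f = mkTerm (fun k => f (w k)) (fun k => f (s k)) (f c) o := by
  simp only [Term.mapCoeff, mkTerm, apply_ite (map f), map_one, map_formalLin]

theorem map_shift (k : ℕ) (P : DEPoly K) : map f (shift k P) = shift k (map f P) :=
  map_rename f _ P

theorem value_mapCoeff (t : Term K) : (t.mapCoeff f).value = map f t.value := by
  rw [Term.value, Term.value, starProd_monomial, starProd_monomial, map_mul, map_mul, map_C,
    map_multiset_prod, map_multiset_prod, Multiset.map_map, Multiset.map_map]
  simp only [Function.comp_def, map_shift]
  rfl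

theorem termsVal_mapCoeff (ts : List (Term K)) :
    termsVal (ts.map (Term.mapCoeff f)) = map f (termsVal ts) := by
  rw [termsVal, termsVal, map_list_sum, List.map_map, List.map_map]
  exact congrArg List.sum (List.map_congr_left fun t _ => value_mapCoeff f t)

theorem passesVal_mapCoeff (x : ℕ ⊕ ℕ) (ps : List (Pass K)) (R : DEPoly K) :
    passesVal x (ps.map (Pass.mapCoeff f)) (map f R) = map f (passesVal x ps R) := by
  induction ps with
  | nil => rfl
  | cons p ps ih =>
    rw [List.map_cons, passesVal, ih]
    simp [passesVal, Pass.mapCoeff, termsVal_mapCoeff]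

theorem levelsVal_mapCoeff (ls : List (Level K)) (R : DEPoly K) :
    levelsVal (ls.map (Level.mapCoeff f)) (map f R) = map f (levelsVal ls R) := by
  induction ls with
  | nil => rfl
  | cons a ls ih =>
    rw [List.map_cons, levelsVal, ih]
    simp [levelsVal, Level.mapCoeff, termsVal_mapCoeff, passesVal_mapCoeff, del, eps]

theorem map_linPart (P : DEPoly K) : map f (linPart P) = linPart (map f P) := by
  refine ext_op fun o => ?_
  rw [coeff_map, coeff_linPart, coeff_linPart, coeff_map]
  split_ifs <;> simp

theorem map_deltaPart (P : DEPoly K) : map f (deltaPart P) = deltaPart (map f P) := by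
  refine ext_op fun o => ?_
  rw [coeff_map, coeff_deltaPart, coeff_deltaPart, coeff_map]
  split_ifs <;> simp

theorem map_epsPart (P : DEPoly K) : map f (epsPart P) = epsPart (map f P) := by
  refine ext_op fun o => ?_
  rw [coeff_map, coeff_epsPart, coeff_epsPart, coeff_map]
  split_ifs <;> simp

theorem GoodTerms.map {w s : ℕ → ℕ → K} {ts : List (Term K)} (h : GoodTerms w s ts) :
    GoodTerms (fun l k => f (w l k)) (fun l k => f (s l k)) (ts.map (Term.mapCoeff f)) := by
  induction ts generalizing w s with
  | nil => exact goodTerms_nil _ _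
  | cons t ts ih =>
    obtain ⟨⟨h1, h2⟩, h3, h4⟩ := goodTerms_cons.1 h
    refine goodTerms_cons.2 ⟨⟨?_, h2⟩, ?_, ih h4⟩
    · exact (congrArg (Term.mapCoeff f) h1).trans (mapCoeff_mkTerm f _ _ _ _)
    · intro t' ht'
      obtain ⟨t'', ht'', rfl⟩ := List.mem_map.1 ht'
      exact h3 t'' ht''

theorem IsLinear.map {e : ℕ → ℕ ⊕ ℕ} {P : DEPoly K} (h : IsLinear e P) :
    IsLinear e (map f P) :=
  ⟨h.1.map f, fun x hx => h.2 x (vars_map P f hx)⟩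

theorem GoodPasses.map {e : ℕ → ℕ ⊕ ℕ} {w s : ℕ → ℕ → ℕ → K} {n : ℕ} {ps : List (Pass K)}
    {R : DEPoly K} (h : GoodPasses e w s n ps R) :
    GoodPasses e (fun u l k => f (w u l k)) (fun u l k => f (s u l k)) n
      (ps.map (Pass.mapCoeff f)) (MvPolynomial.map f R) := by
  induction ps generalizing n with
  | nil =>
    refine ⟨(vars_map R f).trans h.1, ?_⟩
    rw [constantCoeff_map, h.2, map_zero]
  | cons p ps ih =>
    obtain ⟨h1, h2, h3, h4, h5, h6⟩ := h
    have hv : X (e 0) ^ p.exp * passesVal (e 0) (ps.map (Pass.mapCoeff f)) (MvPolynomial.map f R) =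
        MvPolynomial.map f (X (e 0) ^ p.exp * passesVal (e 0) ps R) := by
      rw [passesVal_mapCoeff, map_mul, map_pow, map_X]
    refine ⟨h1.map f, h2.map f, ?_, ?_, ?_, ih h6⟩
    · intro t ht
      obtain ⟨t', ht', rfl⟩ := List.mem_map.1 ht
      exact h3 t' ht'
    · have h7 : SuppIn {o | IsZeroOp o} _ := SuppIn.map f h4
      rw [← hv] at h7
      exact h7
    · have h8 := map_linPart f (X (e 0) ^ p.exp * passesVal (e 0) ps R)
      rw [h5, map_zero, ← hv] at h8
      exact h8.symm

theorem GoodParts.map {w s : ℕ → ℕ → ℕ → ℕ → K} {h : ℕ} {a : Level K} (g : GoodParts w s h a) :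
    GoodParts (fun l u h k => f (w l u h k)) (fun l om h k => f (s l om h k)) h
      (a.mapCoeff f) :=
  ⟨fun h => g.1 (List.map_eq_nil_iff.1 h), fun h => g.2.1 (List.map_eq_nil_iff.1 h),
    g.2.2.1.map f, g.2.2.2.map f⟩

theorem GoodLevels.map {w s : ℕ → ℕ → ℕ → ℕ → K} {h : ℕ} {ls : List (Level K)} {R : DEPoly K}
    (hg : GoodLevels w s h ls R) :
    GoodLevels (fun l u h k => f (w l u h k)) (fun l om h k => f (s l om h k)) h
      (ls.map (Level.mapCoeff f)) (MvPolynomial.map f R) := by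
  induction ls generalizing h with
  | nil => exact hg.elim
  | cons a ls ih =>
    rcases ls with _ | ⟨b, ls⟩
    · obtain ⟨g, h1, h2, h3, h4, h5⟩ := hg
      refine ⟨g.map f, ?_, h2, h3, isCross_iff.2 ((isCross_iff.1 h4).map f),
        (vars_map R f).trans h5⟩
      rw [Level.mapCoeff, h1]
      rfl
    · obtain ⟨g, h1, h2, h3, h4, h5⟩ := hg
      have hv : del 0 ^ a.kap * eps 0 ^ a.sig *
          levelsVal ((b :: ls).map (Level.mapCoeff f)) (MvPolynomial.map f R) =
          MvPolynomial.map f (del 0 ^ a.kap * eps 0 ^ a.sig * levelsVal (b :: ls) R) := by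
        rw [levelsVal_mapCoeff, map_mul, map_mul, map_pow, map_pow]
        simp only [del, eps, map_X]
      refine ⟨g.map f, h1.map f, ?_, ?_, ?_, ih h5⟩
      · intro t ht
        obtain ⟨t', ht', rfl⟩ := List.mem_map.1 ht
        exact h2 t' ht'
      · have h7 := isCross_iff.2 ((isCross_iff.1 h3).map f)
        rw [← hv] at h7
        exact h7
      · have h7 : SuppIn {o | IsZeroOp o} _ := SuppIn.map f h4
        rw [← hv] at h7
        exact h7

theorem shape_mapCoeff (O : Output K) : (O.mapCoeff f).shape = O.shape := by
  have h : ∀ ts : List (Term K), (ts.map (Term.mapCoeff f)).map Term.lead = ts.map Term.lead :=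
    fun ts => by rw [List.map_map]; rfl
  have hp : ∀ ps : List (Pass K), passesShape (ps.map (Pass.mapCoeff f)) = passesShape ps := by
    intro ps
    rw [passesShape, passesShape, List.map_map]
    exact List.map_congr_left fun p _ => Prod.ext (h p.terms) rfl
  rw [Output.shape, Output.shape, Output.mapCoeff, List.map_map]
  refine List.map_congr_left fun a _ => ?_
  simp only [Function.comp, Level.mapCoeff, h, hp]

end Map

theorem IsExpansion.eq_of_shape_eq {w s : ℕ → ℕ → ℕ → ℕ → K} {A : DEPoly K} {E O : Output K}
    (hE : IsExpansion w s A E) (hO : IsExpansion w s A O) (hs : E.shape = O.shape) : E = O := by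
  obtain ⟨h1, h2⟩ := hE.2.eq_of_value_eq hO.2 hs
    (by rw [← Output.expr_eq hE.2, ← Output.expr_eq hO.2, ← hE.1, ← hO.1])
  cases E
  cases O
  simp_all

theorem IsExpansion.run {w s : ℕ → ℕ → ℕ → ℕ → K} {tie : ℕ → Bool} {A : DEPoly K} {E : Output K}
    (hE : IsExpansion w s A E) (hr : IsReduced tie E) : Run w s tie A E := by
  have h := LevelLoop.of_goodLevels hE.2 hr
  rwa [← Output.expr_eq hE.2, ← hE.1] at h

theorem Run.unique {w s : ℕ → ℕ → ℕ → ℕ → K} {tie : ℕ → Bool} {A : DEPoly K} {E O : Output K}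
    (hE : Run w s tie A E) (hO : Run w s tie A O) : E = O := by
  obtain ⟨h1, h2⟩ := LevelLoop.unique hE hO
  cases E
  cases O
  simp_all

theorem Run.isExpansion {w s : ℕ → ℕ → ℕ → ℕ → K} {tie : ℕ → Bool} {A : DEPoly K} {O : Output K}
    (h : Run w s tie A O) (h0 : constantCoeff A = 0) : IsExpansion w s A O ∧ IsReduced tie O := by
  obtain ⟨h1, h2, h3⟩ := LevelLoop.spec h h0
  exact ⟨⟨h1.trans (Output.expr_eq h2).symm, h2⟩, h3⟩

theorem IsExpansion.mapCoeff {K' : Type u2} [CommRing K'] (f : K →+* K')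
    {w s : ℕ → ℕ → ℕ → ℕ → K} {A : DEPoly K} {O : Output K} (h : IsExpansion w s A O) :
    IsExpansion (fun l u h k => f (w l u h k)) (fun l om h k => f (s l om h k)) (map f A)
      (O.mapCoeff f) := by
  have hg := h.2.map f
  refine ⟨?_, hg⟩
  rw [Output.expr_eq (O := O.mapCoeff f) hg, h.1, Output.expr_eq h.2]
  exact (levelsVal_mapCoeff f _ _).symm

/-! ### The entries of the expression -/

theorem GoodTerms.getD_eq {w s : ℕ → ℕ → K} {ts : List (Term K)} (h : GoodTerms w s ts) {l : ℕ}
    (h1 : 1 ≤ l) (hl : l ≤ ts.length) (d : Term K) :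
    ts.getD (l - 1) d = mkTerm (w l) (s l) (ts.getD (l - 1) d).c (ts.getD (l - 1) d).lead := by
  have h2 := (h.1 (l - 1) (by omega)).1
  rw [Nat.sub_add_cancel h1] at h2
  rw [List.getD_eq_getElem _ _ (by omega)]
  exact h2

theorem mkTerm_L (w s : ℕ → K) (c : K) {o : Op} (h : o.1 ≠ 0) :
    (mkTerm w s c o).L = formalLin Sum.inl w (minDelay o.1) := if_neg h

theorem mkTerm_M (w s : ℕ → K) (c : K) {o : Op} (h : o.2 ≠ 0) :
    (mkTerm w s c o).M = formalLin Sum.inr s (minDelay o.2) := if_neg h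

namespace Output

variable {O : Output K} {w s : ℕ → ℕ → ℕ → ℕ → K}

theorem L_succ_eq (hg : GoodLevels w s 0 O.levels O.Rde) {h u l : ℕ} (hh : h ≤ O.hStar)
    (hu : u ≤ O.uStar h) (h1 : 1 ≤ l) (hl : l ≤ O.v u 0 h) :
    ∃ p, O.L l u h = formalLin Sum.inl (w l u h) p := by
  have hm := O.term_mem h1 hl
  rw [L, if_neg (by omega)]
  obtain ⟨ht, hI⟩ : GoodTerms (fun l => w l u h) (fun l => s l 0 h) (O.terms u 0 h) ∧
      (O.term l u 0 h).lead.1 ≠ 0 := by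
    rcases Nat.eq_zero_or_pos u with rfl | hu1
    · obtain ⟨-, h2, h3⟩ := good_level hg hh
      exact ⟨h2, (h3 _ hm).1⟩
    · obtain ⟨-, h2, h3⟩ := good_dPass hg hh hu1 hu
      exact ⟨h2, (mem_partOps_inl.1 (h3 _ hm)).1⟩
  have he := ht.getD_eq h1 hl ⟨0, 0, 0, 1, 1⟩
  exact ⟨_, (congrArg Term.L he).trans (mkTerm_L _ _ _ hI)⟩

theorem M_succ_eq (hg : GoodLevels w s 0 O.levels O.Rde) {h om l : ℕ} (hh : h ≤ O.hStar)
    (hom : om ≤ O.omStar h) (h1 : 1 ≤ l) (hl : l ≤ O.v 0 om h) :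
    ∃ p, O.M l om h = formalLin Sum.inr (s l om h) p := by
  have hm := O.term_mem h1 hl
  rw [M, if_neg (by omega)]
  obtain ⟨ht, hJ⟩ : GoodTerms (fun l => w l 0 h) (fun l => s l om h) (O.terms 0 om h) ∧
      (O.term l 0 om h).lead.2 ≠ 0 := by
    rcases Nat.eq_zero_or_pos om with rfl | hom1
    · obtain ⟨-, h2, h3⟩ := good_level hg hh
      exact ⟨h2, (h3 _ hm).2⟩
    · obtain ⟨-, h2, h3⟩ := good_ePass hg hh hom1 hom
      exact ⟨h2, (mem_partOps_inr.1 (h3 _ hm)).2⟩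
  have he := ht.getD_eq h1 hl ⟨0, 0, 0, 1, 1⟩
  exact ⟨_, (congrArg Term.M he).trans (mkTerm_M _ _ _ hJ)⟩

theorem jIdx_delta (hg : GoodLevels w s 0 O.levels O.Rde) {h u l : ℕ} (hh : h ≤ O.hStar)
    (hu1 : 1 ≤ u) (hu : u ≤ O.uStar h) (hl : l ≤ O.v u 0 h) : O.jIdx l u 0 h = 0 := by
  rw [jIdx]
  split_ifs with h1 h2
  · omega
  · rfl
  · have h3 := (good_dPass hg hh hu1 hu).2.2 _ (O.term_mem (Nat.one_le_iff_ne_zero.2 h1) hl)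
    exact normIdx_eq_zero.2 (mem_partOps_inl.1 h3).2

theorem iIdx_eps (hg : GoodLevels w s 0 O.levels O.Rde) {h om l : ℕ} (hh : h ≤ O.hStar)
    (hom1 : 1 ≤ om) (hom : om ≤ O.omStar h) (hl : l ≤ O.v 0 om h) : O.iIdx l 0 om h = 0 := by
  rw [iIdx]
  split_ifs with h1 h2
  · omega
  · rfl
  · have h3 := (good_ePass hg hh hom1 hom).2.2 _ (O.term_mem (Nat.one_le_iff_ne_zero.2 h1) hl)
    exact normIdx_eq_zero.2 (mem_partOps_inr.1 h3).1

theorem level_mem (hg : GoodLevels w s 0 O.levels O.Rde) {h : ℕ} (hh : h ≤ O.hStar) :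
    O.level h ∈ O.levels := getD_mem (by rw [← hStar_add_one hg]; omega) _

theorem dPass_mem {u h : ℕ} (h1 : 1 ≤ u) (hu : u ≤ O.uStar h) :
    O.dPass u h ∈ (O.level h).dPasses := getD_mem (by unfold uStar at hu; omega) _

theorem ePass_mem {om h : ℕ} (h1 : 1 ≤ om) (hom : om ≤ O.omStar h) :
    O.ePass om h ∈ (O.level h).ePasses := getD_mem (by unfold omStar at hom; omega) _

theorem term_mem_allTerms (hg : GoodLevels w s 0 O.levels O.Rde) {l u om h : ℕ}
    (hh : h ≤ O.hStar) (hom : om ≤ O.omStar h) (hu : u ≤ O.uStar h) (h1 : 1 ≤ l)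
    (hl : l ≤ O.v u om h) : O.term l u om h ∈ O.allTerms := by
  have hm := O.term_mem h1 hl
  refine List.mem_flatMap.2 ⟨O.level h, level_mem hg hh, ?_⟩
  rw [List.mem_append, List.mem_append, List.mem_flatMap, List.mem_flatMap]
  rw [terms] at hm
  split_ifs at hm with h2 h3 h3
  · exact .inr hm
  · exact .inl (.inr ⟨_, ePass_mem (by omega) hom, hm⟩)
  · exact .inl (.inl ⟨_, dPass_mem (by omega) hu, hm⟩)
  · exact absurd hm (List.not_mem_nil)

theorem mem_sets (hg : GoodLevels w s 0 O.levels O.Rde) {l u om h : ℕ}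
    (hh : h ≤ O.hStar) (hom : om ≤ O.omStar h) (hu : u ≤ O.uStar h) (hl : l ≤ O.v u om h)
    (hne : O.summand l u om h ≠ 0) :
    O.c l u om h ∈ O.setC ∧ (O.iIdx l u om h, O.jIdx l u om h) ∈ O.setO ∧
      (O.iIdx l u om h ≠ 0 → O.L l u h ∈ O.setL) ∧
      (O.jIdx l u om h ≠ 0 → O.M l om h ∈ O.setM) := by
  rcases Nat.eq_zero_or_pos l with rfl | h1
  · by_cases hu0 : u = 0 <;> by_cases hom0 : om = 0
    · exact absurd (summand_of_c_eq_zero (by simp [c, hu0, hom0])) hne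
    · subst hu0
      rw [summand_zero_eps hom0] at hne
      have hM : (O.ePass om h).lin ∈ O.eLins := ⟨right_ne_zero_of_mul hne, O.level h,
        level_mem hg hh, _, ePass_mem (by omega) hom, rfl⟩
      have hL : O.M 0 om h = (O.ePass om h).lin := by simp [M, hom0]
      refine ⟨.inl ⟨by simp [c, hom0], _, .inr hM⟩, .inl (.inr ⟨by simp [iIdx, jIdx, hom0], _, hM⟩),
        fun h => absurd (by simp [iIdx]) h, fun _ => .inl (hL ▸ hM)⟩
    · subst hom0
      rw [summand_zero_delta hu0] at hne
      have hM : (O.dPass u h).lin ∈ O.dLins := ⟨right_ne_zero_of_mul hne, O.level h,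
        level_mem hg hh, _, dPass_mem (by omega) hu, rfl⟩
      have hL : O.L 0 u h = (O.dPass u h).lin := by simp [L, hu0]
      refine ⟨.inl ⟨by simp [c, hu0], _, .inl hM⟩,
        .inl (.inl ⟨by simp [iIdx, jIdx, hu0], _, hM⟩),
        fun _ => .inl (hL ▸ hM), fun h => absurd (by simp [jIdx]) h⟩
    · exact absurd (summand_of_c_eq_zero (by simp [c, hu0, hom0])) hne
  · have hm := term_mem_allTerms hg hh hom hu h1 hl
    have hl0 : l ≠ 0 := by omega
    have ei : O.iIdx l u om h = (O.term l u om h).op.1 := if_neg hl0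
    have ej : O.jIdx l u om h = (O.term l u om h).op.2 := if_neg hl0
    have ec : O.c l u om h = (O.term l u om h).c := if_neg hl0
    refine ⟨.inr ⟨_, hm, ec.symm⟩, .inr ⟨_, hm, Prod.ext ei.symm ej.symm⟩, fun hi => ?_,
      fun hj => ?_⟩
    · obtain rfl : om = 0 := by
        by_contra hom0
        by_cases hu0 : u = 0
        · subst hu0
          exact hi (iIdx_eps hg hh (by omega) hom hl)
        · rw [O.v_eq_zero hu0 hom0] at hl
          omega
      rw [ei] at hi
      refine .inr ⟨_, hm, fun h0 => hi (normIdx_eq_zero.2 h0), ?_⟩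
      rw [L, if_neg hl0]
    · obtain rfl : u = 0 := by
        by_contra hu0
        by_cases hom0 : om = 0
        · subst hom0
          exact hj (jIdx_delta hg hh (by omega) hu hl)
        · rw [O.v_eq_zero hu0 hom0] at hl
          omega
      rw [ej] at hj
      refine .inr ⟨_, hm, fun h0 => hj (normIdx_eq_zero.2 h0), ?_⟩
      rw [M, if_neg hl0]

theorem one_le_uStar (hg : GoodLevels w s 0 O.levels O.Rde) {h : ℕ} (hh : h ≤ O.hStar) :
    1 ≤ O.uStar h := List.length_pos_of_ne_nil (good_level hg hh).1.1

theorem one_le_omStar (hg : GoodLevels w s 0 O.levels O.Rde) {h : ℕ} (hh : h ≤ O.hStar) :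
    1 ≤ O.omStar h := List.length_pos_of_ne_nil (good_level hg hh).1.2.1

theorem c_eq_zero_of_pos {l u om h : ℕ} (hu : 1 ≤ u) (hom : 1 ≤ om) : O.c l u om h = 0 := by
  have hu0 : u ≠ 0 := by omega
  have hom0 : om ≠ 0 := by omega
  rw [c]
  split_ifs with h1 h2
  · omega
  · rfl
  · rw [term, terms, if_neg hu0, if_neg hom0]
    rfl

/-- The first linear parts are those of the polynomial itself. -/
theorem first_linear_parts {A : DEPoly K} (hE : IsExpansion w s A O) :
    O.L 0 1 0 = linPart (deltaPart A) ∧ O.M 0 1 0 = linPart (epsPart A) := by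
  obtain ⟨hA, hg⟩ := hE
  rw [expr_eq hg] at hA
  have hg0 := good_level hg (Nat.zero_le O.hStar)
  obtain ⟨⟨hd, he, hd', he'⟩, -, -⟩ := hg0
  rcases O with ⟨_ | ⟨a, ls⟩, R⟩
  · exact hg.elim
  obtain ⟨p1, p2, -⟩ := hg.parts
  subst hA
  obtain ⟨dp, Rd, ep, Re, ts, κ, σ⟩ := a
  rcases dp with _ | ⟨p, dp⟩
  · exact absurd rfl hd
  rcases ep with _ | ⟨q, ep⟩
  · exact absurd rfl he
  constructor
  · exact ((congrArg linPart p1).trans (GoodPasses.linPart_eq (.inl rfl) hd')).symm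
  · exact ((congrArg linPart p2).trans (GoodPasses.linPart_eq (.inr rfl) he')).symm

end Output

end

end FLF

/-- `K` is a commutative `ℝ`-algebra that contains the parameters `w_{l,u,h,k}`, `s_{l,ω,h,k}`:
for `K = ℝ[w, s]` and the variables `w`, `s` they are formal, for `K = ℝ` they are numbers. -/
theorem theorem4p2 {K : Type*} [CommRing K] [Algebra ℝ K]
    (w s : ℕ → ℕ → ℕ → ℕ → K) (tie : ℕ → Bool)
    (A : FLF.DEPoly ℝ) (hA : MvPolynomial.constantCoeff A = 0) :
    ∃ O : FLF.Output K,
      -- the algorithm terminates, and `O` is its output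
      FLF.Run w s tie (MvPolynomial.map (algebraMap ℝ K) A) O ∧
      (∀ O' : FLF.Output K,
        FLF.Run w s tie (MvPolynomial.map (algebraMap ℝ K) A) O' → O' = O) ∧
      -- the expression
      MvPolynomial.map (algebraMap ℝ K) A = O.expr ∧
      -- its entries belong to the output sets
      (∀ h ≤ O.hStar, ∀ om ≤ O.omStar h, ∀ u ≤ O.uStar h, ∀ l ≤ O.v u om h,
        O.summand l u om h ≠ 0 →
          O.c l u om h ∈ O.setC ∧ (O.iIdx l u om h, O.jIdx l u om h) ∈ O.setO ∧
          (O.iIdx l u om h ≠ 0 → O.L l u h ∈ O.setL) ∧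
          (O.jIdx l u om h ≠ 0 → O.M l om h ∈ O.setM)) ∧
      -- its linear factors are linear polynomials, formal ones for `l ≥ 1`
      (∀ h ≤ O.hStar,
        (∀ u, 1 ≤ u → u ≤ O.uStar h → FLF.IsLinear Sum.inl (O.L 0 u h)) ∧
        (∀ om, 1 ≤ om → om ≤ O.omStar h → FLF.IsLinear Sum.inr (O.M 0 om h)) ∧
        (∀ u ≤ O.uStar h, ∀ l, 1 ≤ l → l ≤ O.v u 0 h →
          ∃ p, O.L l u h = FLF.formalLin Sum.inl (w l u h) p) ∧
        (∀ om ≤ O.omStar h, ∀ l, 1 ≤ l → l ≤ O.v 0 om h →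
          ∃ p, O.M l om h = FLF.formalLin Sum.inr (s l om h) p)) ∧
      -- border conditions
      (∀ h ≤ O.hStar, 1 ≤ O.uStar h ∧ 1 ≤ O.omStar h ∧
        O.kappa 1 h = 0 ∧ O.sigma 1 h = 0 ∧ O.c 0 0 0 h = 0 ∧
        (∀ u, 1 ≤ u → u ≤ O.uStar h →
          O.c 0 u 0 h = 1 ∧ O.iIdx 0 u 0 h = {0} ∧ ∀ l ≤ O.v u 0 h, O.jIdx l u 0 h = 0) ∧
        (∀ om, 1 ≤ om → om ≤ O.omStar h →
          O.c 0 0 om h = 1 ∧ O.jIdx 0 0 om h = {0} ∧ ∀ l ≤ O.v 0 om h, O.iIdx l 0 om h = 0) ∧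
        (∀ u om l, 1 ≤ u → 1 ≤ om → O.c l u om h = 0)) ∧
      O.kappa 0 0 = 0 ∧ O.sigma 0 0 = 0 ∧
      O.L 0 1 0 = MvPolynomial.map (algebraMap ℝ K) (FLF.linPart (FLF.deltaPart A)) ∧
      O.M 0 1 0 = MvPolynomial.map (algebraMap ℝ K) (FLF.linPart (FLF.epsPart A)) ∧
      -- remainders
      (∀ h ≤ O.hStar, (O.level h).Rd.vars ⊆ {Sum.inl 0} ∧ (O.level h).Re.vars ⊆ {Sum.inr 0}) ∧
      O.Rde.vars ⊆ {Sum.inl 0, Sum.inr 0} ∧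
      -- uniqueness, the parameters being constants of the coefficient ring
      FLF.IsExpansion w s (MvPolynomial.map (algebraMap ℝ K) A) O ∧ FLF.IsReduced tie O ∧
      (∀ E : FLF.Output K, FLF.IsExpansion w s (MvPolynomial.map (algebraMap ℝ K) A) E →
        FLF.IsReduced tie E ∨ E.shape = O.shape → E = O) ∧
      -- uniqueness after evaluation of the parameters at real numbers
      (∀ φ : K →ₐ[ℝ] ℝ,
        FLF.IsExpansion (fun l u h k => φ (w l u h k)) (fun l om h k => φ (s l om h k)) A
          (O.mapCoeff (φ : K →+* ℝ)) ∧
        ∀ E : FLF.Output ℝ,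
          FLF.IsExpansion (fun l u h k => φ (w l u h k)) (fun l om h k => φ (s l om h k)) A E →
          E.shape = O.shape → E = O.mapCoeff (φ : K →+* ℝ)) := by
  set B := MvPolynomial.map (algebraMap ℝ K) A with hB
  have hB0 : MvPolynomial.constantCoeff B = 0 := by
    rw [hB, MvPolynomial.constantCoeff_map, hA, map_zero]
  obtain ⟨ls, Rde, hrun⟩ := FLF.LevelLoop.exists w s tie 0 hB0
  let O : FLF.Output K := ⟨ls, Rde⟩
  have hO : FLF.Run w s tie B O := hrun
  obtain ⟨hE, hred⟩ := hO.isExpansion hB0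
  have hg := hE.2
  obtain ⟨hL, hM⟩ := FLF.Output.first_linear_parts hE
  refine ⟨O, hO, fun O' hO' => hO'.unique hO, hE.1,
    fun h hh om hom u hu l hl hne => FLF.Output.mem_sets hg hh hom hu hl hne,
    fun h hh => ⟨fun u h1 hu => ?_, fun om h1 hom => ?_,
      fun u hu l h1 hl => FLF.Output.L_succ_eq hg hh hu h1 hl,
      fun om hom l h1 hl => FLF.Output.M_succ_eq hg hh hom h1 hl⟩,
    fun h hh => ⟨FLF.Output.one_le_uStar hg hh, FLF.Output.one_le_omStar hg hh,
      by simp [FLF.Output.kappa], by simp [FLF.Output.sigma], by simp [FLF.Output.c],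
      fun u h1 hu => ⟨?_, ?_, fun l hl => FLF.Output.jIdx_delta hg hh h1 hu hl⟩,
      fun om h1 hom => ⟨?_, ?_, fun l hl => FLF.Output.iIdx_eps hg hh h1 hom hl⟩,
      fun u om l hu hom => FLF.Output.c_eq_zero_of_pos hu hom⟩,
    by simp [FLF.Output.kappa], by simp [FLF.Output.sigma], ?_, ?_,
    fun h hh => ?_, hg.vars, hE, hred, fun E hE' h => ?_, fun φ => ?_⟩
  · have h0 : u ≠ 0 := by omega
    simpa [FLF.Output.L, h0] using (FLF.Output.good_dPass hg hh h1 hu).1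
  · have h0 : om ≠ 0 := by omega
    simpa [FLF.Output.M, h0] using (FLF.Output.good_ePass hg hh h1 hom).1
  · have h0 : u ≠ 0 := by omega
    simp [FLF.Output.c, h0]
  · have h0 : u ≠ 0 := by omega
    simp [FLF.Output.iIdx, h0]
  · have h0 : om ≠ 0 := by omega
    simp [FLF.Output.c, h0]
  · have h0 : om ≠ 0 := by omega
    simp [FLF.Output.jIdx, h0]
  · rw [hL, FLF.map_linPart, FLF.map_deltaPart]
  · rw [hM, FLF.map_linPart, FLF.map_epsPart]
  · have h1 := (FLF.Output.good_level hg hh).1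
    exact ⟨h1.2.2.1.vars, h1.2.2.2.vars⟩
  · rcases h with h | h
    · exact (hE'.run h).unique hO
    · exact hE'.eq_of_shape_eq hE h
  · have hφ : MvPolynomial.map (φ : K →+* ℝ) B = A := by
      have hc : (φ : K →+* ℝ).comp (algebraMap ℝ K) = RingHom.id ℝ := RingHom.ext fun r => by
        simp
      rw [hB, MvPolynomial.map_map, hc, MvPolynomial.map_id]
    have h1 := hE.mapCoeff (φ : K →+* ℝ)
    rw [hφ] at h1
    exact ⟨h1, fun E hE' hs => hE'.eq_of_shape_eq h1
      (hs.trans (FLF.shape_mapCoeff (φ : K →+* ℝ) O).symm)⟩
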